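/- **Setting.** A diagram is a plane picture of a 4-valent rigid vertex embedded graph (closed loops without vertices are allowed), having finitely many 4-valent vertices and finitely many crossings. Ambient isotopy of rigid vertex graphs is the equivalence relation on diagrams generated by planar isotopy and the generalized Reidemeister moves: (I) removal of a curl; (II) cancellation of two crossings of two strands; (III) passing a strand over or under a crossing; (IV) passing a strand over or under a vertex; (V) turning a vertex over, i.e. removing two opposite crossings of the two pairs of ends of a vertex that lie on its two sides. Regular isotopy is the same without (I). For $a,z$ in a commutative ring with $a$ and $z$ invertible, the Dubrovnik polynomial $D_L$ of a (non-empty) link diagram $L$ is the regular isotopy invariant with $D_{O}=1$ for the circle $O$, with $D_{L}=aD_{L'}$ (resp. $D_{L}=a^{-1}D_{L'}$) when $L'$ arises from $L$ by removing a curl with a positive (resp. negative) crossing, and with $$D_{L_+}-D_{L_-}=z\,(D_{L_0}-D_{L_\infty})$$ whenever $L_+,L_-,L_0,L_\infty$ differ only at one place, where they have, respectively, a crossing that is positive when its two strands are both directed upwards, the opposite crossing, two vertical strands, and two horizontal strands. For parameters $A,B,a$ with $a$ and $A-B$ invertible, the Kauffman–Vogel polynomial of a diagram $G$ is obtained as follows.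 Choose at each vertex one of the two crossings by which it may be replaced, and draw the picture so that this crossing, called $X$, is positive when both of its strands are directed upwards. Let $\mathcal L$ be the family of link diagrams obtained by replacing each vertex in one of three ways: by $X$, by two vertical strands, or by two horizontal strands. Then $$[G]=\sum_{L\in\mathcal L}(-A)^{i(L)}(-B)^{j(L)}D_L,\qquad z=A-B,$$ where $i(L)$ is the number of replacements by two vertical strands and $j(L)$ the number of replacements by two horizontal strands. A knot-theoretic circuit of $G$ is a closed walk on $G$ that corresponds to a component of the link obtained by replacing the vertices by crossings (it goes straight on at every vertex). Its writhe is the sum of the signs of its self-crossings (crossings of the diagram, not vertices) for an orientation of the circuit; it does not depend on that orientation. The twisting number $t(G)$ is the sum of the writhes of all knot-theoretic circuits of $G$. **Corollary 5.** Let $G$ be a non-empty diagram of a 4-valent rigid vertex embedded graph that is ambient isotopic to a planar graph, i.e. to a diagram without crossings. Then, for $B=A^{-1}$ and $a=A$, and for every choice of crossings at the vertices, $$[G]=2^{c-1}(-A-A^{-1})^{v}A^{t(G)},$$ where $c$ is the number of connected components of $G$ (as a graph), $v$ is its number of vertices, and $t(G)$ is its twisting number. Here $A$ may be any invertible element of a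 commutative ring such that $A-A^{-1}$ is invertible, in particular the variable of $\mathbb Z[A^{\pm1},(A-A^{-1})^{-1}]$. -/

import Mathlib

/-!
Diagrams of 4-valent rigid vertex embedded graphs (possibly with closed loops without vertices) are
plane pictures made of strands. Put in general position with respect to the height function of the
plane, such a picture is a finite sequence of horizontal layers, read from bottom to top; each layer
consists of vertical strands and exactly one elementary piece. The pictures below are those pieces.
-/

namespace RigidVertex

/-- The elementary pieces. `cup` is a local minimum, `cap` a local maximum. In `pos`, `neg` and
`vertex` the lower left end is opposite to the upper right end and the lower right end is opposite
to the upper left end; `pos` is a crossing in which the strand from the lower left to the upper right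
is the over strand (a positive crossing if both strands are directed upwards), `neg` is a crossing in
which it is the under strand, and `vertex` is a rigid 4-valent vertex. -/
inductive Kind
  | cup | cap | pos | neg | vertex
  deriving DecidableEq

/-- Number of strands that enter a piece from below. -/
def Kind.ins : Kind → ℕ
  | .cup => 0
  | _ => 2

/-- Number of strands that leave a piece at the top. -/
def Kind.outs : Kind → ℕ
  | .cap => 0
  | _ => 2

/-- Crossings. -/
def Kind.IsCrossing (κ : Kind) : Prop := κ = .pos ∨ κ = .neg

/-- Crossings and vertices. -/
def Kind.IsNode (κ : Kind) : Prop := κ = .pos ∨ κ = .neg ∨ κ = .vertex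

/-- A layer: the piece, and the number of vertical strands to the left of it. -/
structure Layer where
  kind : Kind
  place : ℕ

/-- A picture: its layers from bottom to top. -/
abbrev Word := List Layer

abbrev cup (i : ℕ) : Layer := ⟨.cup, i⟩
abbrev cap (i : ℕ) : Layer := ⟨.cap, i⟩
abbrev pos (i : ℕ) : Layer := ⟨.pos, i⟩
abbrev neg (i : ℕ) : Layer := ⟨.neg, i⟩
abbrev vertex (i : ℕ) : Layer := ⟨.vertex, i⟩

/-- `Runs n w m`: the layers of `w` fit together, with `n` ends at the bottom and `m` at the top. -/
def Runs : ℕ → Word → ℕ → Prop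
  | n, [], m => n = m
  | n, l :: w, m => l.place + l.kind.ins ≤ n ∧ Runs (n - l.kind.ins + l.kind.outs) w m

/-- A (closed) diagram: a picture without free ends. -/
def IsDiagram (w : Word) : Prop := Runs 0 w 0

/-- A link diagram: a diagram without vertices. -/
def IsLinkDiagram (w : Word) : Prop := IsDiagram w ∧ ∀ l ∈ w, l.kind ≠ .vertex

/-- A planar diagram: a diagram without crossings. -/
def IsPlanarDiagram (w : Word) : Prop := IsDiagram w ∧ ∀ l ∈ w, ¬ l.kind.IsCrossing

/-! ### Isotopy -/

/-- Local planar isotopies. -/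
inductive PlaneMove : Word → Word → Prop
  /-- Two pieces beside each other may be passed in either order. -/
  | exchange (κ τ : Kind) (i k : ℕ) :
      PlaneMove [⟨κ, i⟩, ⟨τ, i + κ.outs + k⟩] [⟨τ, i + κ.ins + k⟩, ⟨κ, i⟩]
  /-- A maximum and a minimum of a strand cancel. -/
  | zigzag_left (i : ℕ) : PlaneMove [cup (i + 1), cap i] []
  | zigzag_right (i : ℕ) : PlaneMove [cup i, cap (i + 1)] []
  /-- A crossing or a vertex is turned past a maximum or a minimum. -/
  | cap_pos (i : ℕ) : PlaneMove [pos i, cap (i + 1)] [neg (i + 1), cap i]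
  | cap_neg (i : ℕ) : PlaneMove [neg i, cap (i + 1)] [pos (i + 1), cap i]
  | cap_vertex (i : ℕ) : PlaneMove [vertex i, cap (i + 1)] [vertex (i + 1), cap i]
  | cup_pos (i : ℕ) : PlaneMove [cup (i + 1), pos i] [cup i, neg (i + 1)]
  | cup_neg (i : ℕ) : PlaneMove [cup (i + 1), neg i] [cup i, pos (i + 1)]
  | cup_vertex (i : ℕ) : PlaneMove [cup (i + 1), vertex i] [cup i, vertex (i + 1)]

/-- `PosKink i u`: the picture `u` is one strand, at place `i`, with a curl whose crossing is
positive; the loop of the curl lies to the right or to the left. -/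
inductive PosKink (i : ℕ) : Word → Prop
  | right : PosKink i [cup (i + 1), pos i, cap (i + 1)]
  | left : PosKink i [cup i, pos (i + 1), cap i]

/-- The same for a curl whose crossing is negative. -/
inductive NegKink (i : ℕ) : Word → Prop
  | right : NegKink i [cup (i + 1), neg i, cap (i + 1)]
  | left : NegKink i [cup i, neg (i + 1), cap i]

/-- The local moves of type II, III, IV and V. -/
inductive RegularMove : Word → Word → Prop
  /-- II: two crossings of two strands cancel. -/
  | cancel_pos_neg (i : ℕ) : RegularMove [pos i, neg i] []
  | cancel_neg_pos (i : ℕ) : RegularMove [neg i, pos i] []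
  /-- III and IV: a strand passes over or under a crossing (III) or a vertex (IV). -/
  | pass_over (κ : Kind) (hκ : κ.IsNode) (i : ℕ) :
      RegularMove [pos i, pos (i + 1), ⟨κ, i⟩] [⟨κ, i + 1⟩, pos i, pos (i + 1)]
  | pass_under (κ : Kind) (hκ : κ.IsNode) (i : ℕ) :
      RegularMove [neg i, neg (i + 1), ⟨κ, i⟩] [⟨κ, i + 1⟩, neg i, neg (i + 1)]
  /-- V: a rigid vertex is turned over. -/
  | flip_pos_neg (i : ℕ) : RegularMove [pos i, vertex i, neg i] [vertex i]
  | flip_neg_pos (i : ℕ) : RegularMove [neg i, vertex i, pos i] [vertex i]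

/-- The local moves of type I: a curl is removed. -/
inductive KinkMove : Word → Word → Prop
  | pos (i : ℕ) (u : Word) (hu : PosKink i u) : KinkMove u []
  | neg (i : ℕ) (u : Word) (hu : NegKink i u) : KinkMove u []

/-- `Applied M G H`: the diagram `H` arises from the diagram `G` by a local move `M`. -/
def Applied (M : Word → Word → Prop) (G H : Word) : Prop :=
  IsDiagram G ∧ IsDiagram H ∧
    ∃ x u v y : Word, M u v ∧ G = x ++ u ++ y ∧ H = x ++ v ++ y

/-- Regular isotopy: a finite sequence of planar isotopies and of moves II to V and their inverses. -/
def RegularIsotopic : Word → Word → Prop :=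
  Relation.EqvGen (Applied fun u v => PlaneMove u v ∨ RegularMove u v)

/-- Ambient isotopy of rigid vertex graphs: the moves of type I are allowed as well. -/
def AmbientIsotopic : Word → Word → Prop :=
  Relation.EqvGen (Applied fun u v => PlaneMove u v ∨ RegularMove u v ∨ KinkMove u v)

/-! ### The polynomial -/

/-- The vertices of a diagram. -/
abbrev Vertices (w : Word) : Type := {k : Fin w.length // (w.get k).kind = .vertex}

/-- The two markers of a vertex; they select the crossing by which it may be replaced. -/
inductive Marker
  | pos | neg

/-- The three replacements of a marked vertex. -/
inductive Replacement
  | crossing | smoothA | smoothB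
  deriving DecidableEq

instance : Fintype Replacement where
  elems := {.crossing, .smoothA, .smoothB}
  complete := by intro x; cases x <;> simp

/-- The local picture that replaces a marked vertex at place `i`: two vertical strands are the empty
word; a maximum below a minimum is `[cap i, cup i]`. -/
def replace (i : ℕ) : Marker → Replacement → Word
  | .pos, .crossing => [pos i]
  | .pos, .smoothA => []
  | .pos, .smoothB => [cap i, cup i]
  | .neg, .crossing => [neg i]
  | .neg, .smoothA => [cap i, cup i]
  | .neg, .smoothB => []

section Polynomial

variable {R : Type*} [CommRing R]

/-- The axioms of the Dubrovnik polynomial with parameters `a`, `z`. -/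
structure IsDubrovnik (a : Rˣ) (z : R) (D : Word → R) : Prop where
  /-- invariance under regular isotopy of link diagrams -/
  regular : ∀ L L' : Word, IsLinkDiagram L → IsLinkDiagram L' → RegularIsotopic L L' → D L = D L'
  /-- the skein relation -/
  skein : ∀ (x y : Word) (i : ℕ), IsLinkDiagram (x ++ [pos i] ++ y) →
    D (x ++ [pos i] ++ y) - D (x ++ [neg i] ++ y) =
      z * (D (x ++ y) - D (x ++ [cap i, cup i] ++ y))
  /-- removal of a positive curl -/
  pos_kink : ∀ (x u y : Word) (i : ℕ), PosKink i u → IsLinkDiagram (x ++ u ++ y) →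
    D (x ++ u ++ y) = a * D (x ++ y)
  /-- removal of a negative curl -/
  neg_kink : ∀ (x u y : Word) (i : ℕ), NegKink i u → IsLinkDiagram (x ++ u ++ y) →
    D (x ++ u ++ y) = (a⁻¹ : Rˣ) * D (x ++ y)
  /-- the circle has value 1 -/
  unknot : D [cup 0, cap 0] = 1

/-- The Dubrovnik polynomial with parameters `a`, `z` (on non-empty link diagrams its axioms
determine it when `z` is a unit). -/
noncomputable def dubrovnik (a : Rˣ) (z : R) : Word → R :=
  Classical.epsilon (IsDubrovnik a z)

/-- The link diagram obtained from `w` by the replacements `s` at its vertices. -/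
def resolve (w : Word) (m : Vertices w → Marker) (s : Vertices w → Replacement) : Word :=
  (List.finRange w.length).flatMap fun k =>
    if h : (w.get k).kind = .vertex then replace (w.get k).place (m ⟨k, h⟩) (s ⟨k, h⟩)
    else [w.get k]

/-- The polynomial `[w]` with parameters `A`, `B`, `a`, computed with the markers `m`. -/
noncomputable def kauffmanVogel (A B : R) (a : Rˣ) (w : Word) (m : Vertices w → Marker) : R :=
  ∑ s : Vertices w → Replacement,
    (-A) ^ Fintype.card {x // s x = .smoothA} * (-B) ^ Fintype.card {x // s x = .smoothB} *
      dubrovnik a (A - B) (resolve w m s)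

end Polynomial

/-! ### Components, circuits and the twisting number -/

/-- The number of strands just below layer `k` of `w`. -/
def widthAt (w : Word) (k : ℕ) : ℕ :=
  (w.take k).foldl (fun n l => n - l.kind.ins + l.kind.outs) 0

/-- The points at which the horizontal lines between the layers meet the strands: `(k, j)` lies just
below layer `k` (above all layers if `k` is their number) and has `j` strands to its left. -/
def points (w : Word) : Set (ℕ × ℕ) := {p | p.1 ≤ w.length ∧ p.2 < widthAt w p.1}

/-- `Through w p q`: one goes straight up from `p` to `q` through one layer; at crossings and at
vertices one goes on to the opposite end. -/
inductive Through (w : Word) : ℕ × ℕ → ℕ × ℕ → Prop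
  | left (k j : ℕ) (l : Layer) (h : w[k]? = some l) (hj : j < l.place) : Through w (k, j) (k + 1, j)
  | right (k j : ℕ) (l : Layer) (h : w[k]? = some l) (hj : l.place ≤ j) :
      Through w (k, j + l.kind.ins) (k + 1, j + l.kind.outs)
  | slope_right (k : ℕ) (l : Layer) (h : w[k]? = some l) (hl : l.kind.IsNode) :
      Through w (k, l.place) (k + 1, l.place + 1)
  | slope_left (k : ℕ) (l : Layer) (h : w[k]? = some l) (hl : l.kind.IsNode) :
      Through w (k, l.place + 1) (k + 1, l.place)

/-- `Turn w p q`: `p` and `q` are the left and right end of a minimum or of a maximum. -/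
inductive Turn (w : Word) : ℕ × ℕ → ℕ × ℕ → Prop
  | cup (k i : ℕ) (h : w[k]? = some ⟨.cup, i⟩) : Turn w (k + 1, i) (k + 1, i + 1)
  | cap (k i : ℕ) (h : w[k]? = some ⟨.cap, i⟩) : Turn w (k, i) (k, i + 1)

/-- `Meet w p q`: `p` and `q` are the two lower ends of a vertex. -/
inductive Meet (w : Word) : ℕ × ℕ → ℕ × ℕ → Prop
  | vertex (k i : ℕ) (h : w[k]? = some ⟨.vertex, i⟩) : Meet w (k, i) (k, i + 1)

/-- Adjacency of points in the graph (the two strands of a crossing are not connected there). -/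
def GraphAdj (w : Word) (p q : ℕ × ℕ) : Prop := Through w p q ∨ Turn w p q ∨ Meet w p q

/-- Adjacency of points along the link obtained when vertices are replaced by crossings. -/
def StrandAdj (w : Word) (p q : ℕ × ℕ) : Prop := Through w p q ∨ Turn w p q

/-- Adjacency along that link of points with a direction of travel (`true` is upwards). -/
def DirectedAdj (w : Word) (p q : (ℕ × ℕ) × Bool) : Prop :=
  (Through w p.1 q.1 ∧ q.2 = p.2) ∨ (Turn w p.1 q.1 ∧ q.2 = !p.2)

/-- The number of connected components of the graph. -/
noncomputable def numComponents (w : Word) : ℕ := (Quot.mk (GraphAdj w) '' points w).ncard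

/-- The number of vertices of the graph. -/
def numVertices (w : Word) : ℕ := Fintype.card (Vertices w)

/-- The knot-theoretic circuits of the graph. -/
def circuits (w : Word) : Set (Quot (StrandAdj w)) := Quot.mk (StrandAdj w) '' points w

open Classical in
/-- The sign of layer `k` as a self-crossing of a circuit (`0` if the layer is not a crossing): a
`pos` crossing has sign 1 if the circuit, travelled upwards along one of the two strands, runs
upwards along the other one as well, and sign -1 otherwise; `neg` crossings have opposite signs. -/
noncomputable def crossingSign (w : Word) (k : ℕ) : ℤ :=
  match w[k]? with
  | some ⟨.pos, i⟩ =>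
      if Quot.mk (DirectedAdj w) ((k, i), true) = Quot.mk (DirectedAdj w) ((k, i + 1), true)
      then 1 else -1
  | some ⟨.neg, i⟩ =>
      if Quot.mk (DirectedAdj w) ((k, i), true) = Quot.mk (DirectedAdj w) ((k, i + 1), true)
      then -1 else 1
  | _ => 0

/-- `SelfCrossing w C k`: layer `k` is a crossing both of whose strands belong to the circuit `C`. -/
def SelfCrossing (w : Word) (C : Quot (StrandAdj w)) (k : ℕ) : Prop :=
  ∃ l, w[k]? = some l ∧ l.kind.IsCrossing ∧
    Quot.mk (StrandAdj w) (k, l.place) = C ∧ Quot.mk (StrandAdj w) (k, l.place + 1) = C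

open Classical in
/-- The writhe of a circuit: the sum of the signs of its self-crossings. -/
noncomputable def writhe (w : Word) (C : Quot (StrandAdj w)) : ℤ :=
  ∑ k ∈ (Finset.range w.length).filter (SelfCrossing w C), crossingSign w k

/-- The twisting number: the sum of the writhes of the circuits. -/
noncomputable def twistingNumber (w : Word) : ℤ := ∑ᶠ C ∈ circuits w, writhe w C

end RigidVertex

namespace RigidVertex

/-! For $z = a - a^{-1}$ the Dubrovnik polynomial has a closed form: $D_L$ is half the sum of
$a^{w(o)}$ over all orientations $o$ of the link diagram, where $w(o)$ is the total sign of the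
crossings. Locally this is a finite check on the directions of the ends of each move and of the
skein relation (`isDubrovnik_halfStateSum`). Since `dubrovnik` is only chosen through its axioms, it
must also be shown that they determine it on non-empty link diagrams (`IsDubrovnik.unique`).

Insert this into the definition of $[G]$ with $B = A^{-1}$. At a vertex, the combination of $X$,
$-A$ times the vertical and $-A^{-1}$ times the horizontal smoothing kills every choice of
directions of the four ends, except those in which two opposite ends point in and the other two
point out; these receive the factor $-A-A^{-1}$ (`sum_replace`, `sum_resolve`). Hence $[G]$ is
$(-A-A^{-1})^v$ times half the sum of $A^{\text{total sign}}$ over such source-sink orientations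
(`kauffmanVogel_eq`).

There are thus two state sums: orientations that go straight on at vertices (`s = true`) and
source-sink orientations (`s = false`). Both are invariant under II to V, and a curl multiplies both
by the same power of $A$. If $G$ is isotopic to a planar $P$, each equals $A^k$ times the number of
corresponding orientations of $P$, with one common $k$. All coefficients are nonnegative, so nothing
can cancel and every orientation of $G$, of either kind, has total sign $k$ (`totalSign_eq`).
Averaged over the straight orientations, crossings of different circuits contribute zero and
self-crossings contribute their sign, so $k = t(G)$ (`twistingNumber_eq_of_totalSign`). A planar
graph has a source-sink orientation by checkerboard colouring (`nonempty_states_of_planar`);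
therefore $G$ has one too, and reversing it on components yields exactly $2^c$ of them
(`ncard_states`). Halving gives $2^{c-1}$. -/

open LaurentPolynomial

set_option linter.unusedSimpArgs false
set_option linter.unnecessarySeqFocus false

/-! ### Transfer operators of layers and their invariance under the moves -/

/-- The successor states of the bits `b` of the strands below a piece (`true` is upwards). At a vertex,
`s` decides whether the states go straight on or make the vertex a source for one pair of opposite ends
and a sink for the other. -/
def successors (s : Bool) : Kind → ℕ → List Bool → Finset (List Bool)
  | κ, i + 1, x :: b => (successors s κ i b).map ⟨List.cons x, List.cons_injective⟩
  | _, _ + 1, [] => ∅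
  | .cup, 0, b => {true :: false :: b, false :: true :: b}
  | .cap, 0, x :: y :: b => if x = y then ∅ else {b}
  | .pos, 0, x :: y :: b => {y :: x :: b}
  | .neg, 0, x :: y :: b => {y :: x :: b}
  | .vertex, 0, x :: y :: b => if s then {y :: x :: b} else if x = y then ∅ else {x :: y :: b}
  | _, 0, _ => ∅

/-- The sign of a piece whose two lower ends have the bits `x`, `y`. -/
def pieceSign : Kind → Bool → Bool → ℤ
  | .pos, x, y => if x = y then 1 else -1
  | .neg, x, y => if x = y then -1 else 1
  | _, _, _ => 0

/-- The sign of a layer below which the strands have the bits `b`. -/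
def layerSign : Kind → ℕ → List Bool → ℤ
  | κ, i + 1, _ :: b => layerSign κ i b
  | _, _ + 1, [] => 0
  | κ, 0, x :: y :: _ => pieceSign κ x y
  | _, 0, _ => 0

/-- The transfer operator of a layer. -/
noncomputable def layerOp (s : Bool) (κ : Kind) (i : ℕ) :
    Module.End ℤ[T;T⁻¹] (List Bool → ℤ[T;T⁻¹]) where
  toFun f b := T (layerSign κ i b) * ∑ b' ∈ successors s κ i b, f b'
  map_add' f g := by
    funext b
    simp [Finset.sum_add_distrib, mul_add]
  map_smul' c f := by
    funext b
    simp [← Finset.mul_sum, mul_left_comm]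

theorem layerOp_apply (s : Bool) (κ : Kind) (i : ℕ) (f : List Bool → ℤ[T;T⁻¹]) (b : List Bool) :
    layerOp s κ i f b = T (layerSign κ i b) * ∑ b' ∈ successors s κ i b, f b' := rfl

/-- The transfer operator of a picture. -/
noncomputable def wordOp (s : Bool) (w : Word) : Module.End ℤ[T;T⁻¹] (List Bool → ℤ[T;T⁻¹]) :=
  (w.map fun l => layerOp s l.kind l.place).prod

@[simp] theorem wordOp_nil (s : Bool) : wordOp s [] = 1 := rfl

theorem wordOp_cons (s : Bool) (l : Layer) (w : Word) :
    wordOp s (l :: w) = layerOp s l.kind l.place * wordOp s w := by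
  simp [wordOp]

theorem wordOp_append (s : Bool) (u w : Word) : wordOp s (u ++ w) = wordOp s u * wordOp s w := by
  simp [wordOp]

theorem layerOp_succ (s : Bool) (κ : Kind) (i : ℕ) (f : List Bool → ℤ[T;T⁻¹]) (x : Bool)
    (b : List Bool) :
    layerOp s κ (i + 1) f (x :: b) = layerOp s κ i (fun b' => f (x :: b')) b := by
  simp [layerOp_apply, successors, layerSign]

theorem layerOp_cup (s : Bool) (f : List Bool → ℤ[T;T⁻¹]) (b : List Bool) :
    layerOp s .cup 0 f b = f (true :: false :: b) + f (false :: true :: b) := by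
  have h : layerSign .cup 0 b = 0 := by
    rcases b with _ | ⟨x, _ | ⟨y, b⟩⟩ <;> rfl
  rw [layerOp_apply, h]
  simp [successors]

theorem layerOp_cap (s : Bool) (f : List Bool → ℤ[T;T⁻¹]) (x y : Bool) (b : List Bool) :
    layerOp s .cap 0 f (x :: y :: b) = if x = y then 0 else f b := by
  simp only [layerOp_apply, successors, layerSign, pieceSign]
  split_ifs <;> simp

theorem layerOp_pos (s : Bool) (f : List Bool → ℤ[T;T⁻¹]) (x y : Bool) (b : List Bool) :
    layerOp s .pos 0 f (x :: y :: b) = T (if x = y then 1 else -1) * f (y :: x :: b) := by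
  simp [layerOp_apply, successors, layerSign, pieceSign]

theorem layerOp_neg (s : Bool) (f : List Bool → ℤ[T;T⁻¹]) (x y : Bool) (b : List Bool) :
    layerOp s .neg 0 f (x :: y :: b) = T (if x = y then -1 else 1) * f (y :: x :: b) := by
  simp [layerOp_apply, successors, layerSign, pieceSign]

theorem layerOp_vertex (s : Bool) (f : List Bool → ℤ[T;T⁻¹]) (x y : Bool) (b : List Bool) :
    layerOp s .vertex 0 f (x :: y :: b) =
      if s then f (y :: x :: b) else if x = y then 0 else f (x :: y :: b) := by
  simp only [layerOp_apply, successors, layerSign, pieceSign]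
  split_ifs <;> simp

/-- A picture with `i` more strands to the left. -/
def raise (i : ℕ) (w : Word) : Word := w.map fun l => ⟨l.kind, i + l.place⟩

theorem raise_succ (i : ℕ) (w : Word) : raise (i + 1) w = raise 1 (raise i w) := by
  simp only [raise, List.map_map, Function.comp_def]
  refine List.map_congr_left fun l _ => ?_
  rw [add_comm i 1, add_assoc]

theorem wordOp_raise_one (s : Bool) (w : Word) (f : List Bool → ℤ[T;T⁻¹]) (x : Bool)
    (b : List Bool) :
    wordOp s (raise 1 w) f (x :: b) = wordOp s w (fun b' => f (x :: b')) b := by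
  induction w generalizing b with
  | nil => rfl
  | cons l w ih =>
    simp only [raise, List.map_cons, wordOp_cons, Module.End.mul_apply] at ih ⊢
    rw [add_comm 1 l.place, layerOp_succ]
    exact congrArg (fun g => layerOp s l.kind l.place g b) (funext ih)

/-- A strand to the left of a piece only carries its bit along, so a local identity needs to be
checked at place 0 alone. The bound `N` excludes lists that are too short for the pieces, on which
the operators take meaningless values. -/
theorem wordOp_raise_eq (s : Bool) (u w : Word) (N : ℕ)
    (h : ∀ f b, N ≤ b.length → wordOp s u f b = wordOp s w f b) (i : ℕ) :
    ∀ f b, i + N ≤ b.length → wordOp s (raise i u) f b = wordOp s (raise i w) f b := by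
  induction i with
  | zero => simpa [raise] using h
  | succ i ih =>
    intro f b hb
    rcases b with _ | ⟨x, b⟩
    · simp at hb
    · rw [raise_succ i u, raise_succ i w, wordOp_raise_one, wordOp_raise_one]
      exact ih _ _ (by simp at hb; omega)

theorem T_one_mul_T_neg_one_mul (f : ℤ[T;T⁻¹]) : T 1 * (T (-1) * f) = f := by
  rw [← mul_assoc, ← T_add]; simp

theorem T_neg_one_mul_T_one_mul (f : ℤ[T;T⁻¹]) : T (-1) * (T 1 * f) = f := by
  rw [← mul_assoc, ← T_add]; simp

/-- The two pieces act on disjoint sets of bits, and the operator of `τ` is linear in the sum or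
weight that `κ` contributes. -/
theorem layerOp_exchange (s : Bool) (κ τ : Kind) (k : ℕ) (f : List Bool → ℤ[T;T⁻¹])
    (b : List Bool) (hb : κ.ins ≤ b.length) :
    layerOp s κ 0 (layerOp s τ (κ.outs + k) f) b = layerOp s τ (κ.ins + k) (layerOp s κ 0 f) b := by
  have two : ∀ (g : List Bool → ℤ[T;T⁻¹]) x y b,
      layerOp s τ (2 + k) g (x :: y :: b) = layerOp s τ k (fun b' => g (x :: y :: b')) b := by
    intro g x y b
    rw [show 2 + k = k + 1 + 1 by omega, layerOp_succ, layerOp_succ]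
  cases κ with
  | cup =>
    simp only [Kind.ins, Kind.outs, layerOp_cup, two, zero_add]
    rw [← Pi.add_apply, ← map_add]
    exact congrArg (fun g => layerOp s τ k g b) (funext fun b => (layerOp_cup s f b).symm)
  | cap =>
    rcases b with _ | ⟨x, _ | ⟨y, b⟩⟩
    · simp [Kind.ins] at hb
    · simp [Kind.ins] at hb
    · simp only [Kind.ins, Kind.outs, layerOp_cap, two, zero_add]
      split_ifs with h
      · simp [layerOp_apply]
      · rfl
  | pos =>
    rcases b with _ | ⟨x, _ | ⟨y, b⟩⟩
    · simp [Kind.ins] at hb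
    · simp [Kind.ins] at hb
    · simp only [Kind.ins, Kind.outs, layerOp_pos, two]
      rw [← smul_eq_mul, ← Pi.smul_apply, ← map_smul]
      rfl
  | neg =>
    rcases b with _ | ⟨x, _ | ⟨y, b⟩⟩
    · simp [Kind.ins] at hb
    · simp [Kind.ins] at hb
    · simp only [Kind.ins, Kind.outs, layerOp_neg, two]
      rw [← smul_eq_mul, ← Pi.smul_apply, ← map_smul]
      rfl
  | vertex =>
    rcases b with _ | ⟨x, _ | ⟨y, b⟩⟩
    · simp [Kind.ins] at hb
    · simp [Kind.ins] at hb
    · simp only [Kind.ins, Kind.outs, layerOp_vertex, two]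
      split_ifs with h
      · rfl
      · simp [layerOp_apply]
      · rfl

theorem exists_cons_two {b : List Bool} (h : 2 ≤ b.length) : ∃ x y b', b = x :: y :: b' := by
  rcases b with _ | ⟨x, _ | ⟨y, b⟩⟩
  · simp at h
  · simp at h
  · exact ⟨x, y, b, rfl⟩

theorem exists_cons_three {b : List Bool} (h : 3 ≤ b.length) : ∃ x y z b', b = x :: y :: z :: b' := by
  rcases b with _ | ⟨x, _ | ⟨y, _ | ⟨z, b⟩⟩⟩
  · simp at h
  · simp at h
  · simp at h
  · exact ⟨x, y, z, b, rfl⟩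

theorem exists_cons_one {b : List Bool} (h : 1 ≤ b.length) : ∃ x b', b = x :: b' := by
  rcases b with _ | ⟨x, b⟩
  · simp at h
  · exact ⟨x, b, rfl⟩

/-- Turning a crossing past an extremum interchanges `pos` and `neg` and also reverses the vertical
direction of one strand, so the sign as an oriented crossing is unchanged. What remains is a finite
check over the bits. -/
theorem wordOp_planeMove (s : Bool) {u w : Word} (h : PlaneMove u w) {n m : ℕ} (hr : Runs n u m)
    (f : List Bool → ℤ[T;T⁻¹]) (b : List Bool) (hb : b.length = n) :
    wordOp s u f b = wordOp s w f b := by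
  subst hb
  cases h with
  | exchange κ τ i k =>
    have := wordOp_raise_eq s [⟨κ, 0⟩, ⟨τ, κ.outs + k⟩] [⟨τ, κ.ins + k⟩, ⟨κ, 0⟩] κ.ins
      (fun f b hb => layerOp_exchange s κ τ k f b hb) i f b (by simp [Runs] at hr; omega)
    simpa [raise, add_assoc] using this
  | zigzag_left i =>
    refine wordOp_raise_eq s [cup 1, cap 0] [] 1 ?_ i f b (by simp [Runs, Kind.ins] at hr; omega)
    intro f b hb
    obtain ⟨x, b, rfl⟩ := exists_cons_one hb
    cases x <;> simp [wordOp_cons, layerOp_succ, layerOp_cup, layerOp_cap]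
  | zigzag_right i =>
    refine wordOp_raise_eq s [cup 0, cap 1] [] 1 ?_ i f b
      (by simp [Runs, Kind.ins, Kind.outs] at hr; omega)
    intro f b hb
    obtain ⟨x, b, rfl⟩ := exists_cons_one hb
    cases x <;> simp [wordOp_cons, layerOp_succ, layerOp_cup, layerOp_cap]
  | cap_pos i =>
    refine wordOp_raise_eq s [pos 0, cap 1] [neg 1, cap 0] 3 ?_ i f b
      (by simp [Runs, Kind.ins, Kind.outs] at hr; omega)
    intro f b hb
    obtain ⟨x, y, z, b, rfl⟩ := exists_cons_three hb
    cases x <;> cases y <;> cases z <;>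
      simp [wordOp_cons, layerOp_succ, layerOp_pos, layerOp_neg, layerOp_cap]
  | cap_neg i =>
    refine wordOp_raise_eq s [neg 0, cap 1] [pos 1, cap 0] 3 ?_ i f b
      (by simp [Runs, Kind.ins, Kind.outs] at hr; omega)
    intro f b hb
    obtain ⟨x, y, z, b, rfl⟩ := exists_cons_three hb
    cases x <;> cases y <;> cases z <;>
      simp [wordOp_cons, layerOp_succ, layerOp_pos, layerOp_neg, layerOp_cap]
  | cap_vertex i =>
    refine wordOp_raise_eq s [vertex 0, cap 1] [vertex 1, cap 0] 3 ?_ i f b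
      (by simp [Runs, Kind.ins, Kind.outs] at hr; omega)
    intro f b hb
    obtain ⟨x, y, z, b, rfl⟩ := exists_cons_three hb
    cases s <;> cases x <;> cases y <;> cases z <;>
      simp [wordOp_cons, layerOp_succ, layerOp_vertex, layerOp_cap]
  | cup_pos i =>
    refine wordOp_raise_eq s [cup 1, pos 0] [cup 0, neg 1] 1 ?_ i f b
      (by simp [Runs, Kind.ins, Kind.outs] at hr; omega)
    intro f b hb
    obtain ⟨x, b, rfl⟩ := exists_cons_one hb
    cases x <;>
      simp [wordOp_cons, layerOp_succ, layerOp_pos, layerOp_neg, layerOp_cup, add_comm]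
  | cup_neg i =>
    refine wordOp_raise_eq s [cup 1, neg 0] [cup 0, pos 1] 1 ?_ i f b
      (by simp [Runs, Kind.ins, Kind.outs] at hr; omega)
    intro f b hb
    obtain ⟨x, b, rfl⟩ := exists_cons_one hb
    cases x <;>
      simp [wordOp_cons, layerOp_succ, layerOp_pos, layerOp_neg, layerOp_cup, add_comm]
  | cup_vertex i =>
    refine wordOp_raise_eq s [cup 1, vertex 0] [cup 0, vertex 1] 1 ?_ i f b
      (by simp [Runs, Kind.ins, Kind.outs] at hr; omega)
    intro f b hb
    obtain ⟨x, b, rfl⟩ := exists_cons_one hb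
    cases s <;> cases x <;>
      simp [wordOp_cons, layerOp_succ, layerOp_vertex, layerOp_cup, add_comm]

/-- For `s = false` the two strands at a vertex have opposite bits. Therefore a strand passing it
collects signs that cancel, before as well as after move IV, and the two crossings of move V have
opposite signs. -/
theorem wordOp_regularMove (s : Bool) {u w : Word} (h : RegularMove u w) {n m : ℕ} (hr : Runs n u m)
    (f : List Bool → ℤ[T;T⁻¹]) (b : List Bool) (hb : b.length = n) :
    wordOp s u f b = wordOp s w f b := by
  subst hb
  cases h with
  | cancel_pos_neg i =>
    refine wordOp_raise_eq s [pos 0, neg 0] [] 2 ?_ i f b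
      (by simp [Runs, Kind.ins, Kind.outs] at hr; omega)
    intro f b hb
    obtain ⟨x, y, b, rfl⟩ := exists_cons_two hb
    cases x <;> cases y <;> simp [wordOp_cons, layerOp_pos, layerOp_neg, T_one_mul_T_neg_one_mul,
      T_neg_one_mul_T_one_mul]
  | cancel_neg_pos i =>
    refine wordOp_raise_eq s [neg 0, pos 0] [] 2 ?_ i f b
      (by simp [Runs, Kind.ins, Kind.outs] at hr; omega)
    intro f b hb
    obtain ⟨x, y, b, rfl⟩ := exists_cons_two hb
    cases x <;> cases y <;> simp [wordOp_cons, layerOp_pos, layerOp_neg, T_one_mul_T_neg_one_mul,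
      T_neg_one_mul_T_one_mul]
  | pass_over κ hκ i =>
    refine wordOp_raise_eq s [pos 0, pos 1, ⟨κ, 0⟩] [⟨κ, 1⟩, pos 0, pos 1] 3 ?_ i f b
      (by rcases hκ with rfl | rfl | rfl <;> simp [Runs, Kind.ins, Kind.outs] at hr <;> omega)
    intro f b hb
    obtain ⟨x, y, z, b, rfl⟩ := exists_cons_three hb
    rcases hκ with rfl | rfl | rfl <;> cases s <;> cases x <;> cases y <;> cases z <;>
      simp [wordOp_cons, layerOp_succ, layerOp_pos, layerOp_neg, layerOp_vertex,
        T_one_mul_T_neg_one_mul, T_neg_one_mul_T_one_mul]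
  | pass_under κ hκ i =>
    refine wordOp_raise_eq s [neg 0, neg 1, ⟨κ, 0⟩] [⟨κ, 1⟩, neg 0, neg 1] 3 ?_ i f b
      (by rcases hκ with rfl | rfl | rfl <;> simp [Runs, Kind.ins, Kind.outs] at hr <;> omega)
    intro f b hb
    obtain ⟨x, y, z, b, rfl⟩ := exists_cons_three hb
    rcases hκ with rfl | rfl | rfl <;> cases s <;> cases x <;> cases y <;> cases z <;>
      simp [wordOp_cons, layerOp_succ, layerOp_pos, layerOp_neg, layerOp_vertex,
        T_one_mul_T_neg_one_mul, T_neg_one_mul_T_one_mul]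
  | flip_pos_neg i =>
    refine wordOp_raise_eq s [pos 0, vertex 0, neg 0] [vertex 0] 2 ?_ i f b
      (by simp [Runs, Kind.ins, Kind.outs] at hr; omega)
    intro f b hb
    obtain ⟨x, y, b, rfl⟩ := exists_cons_two hb
    cases s <;> cases x <;> cases y <;> simp [wordOp_cons, layerOp_pos, layerOp_neg,
      layerOp_vertex, T_one_mul_T_neg_one_mul, T_neg_one_mul_T_one_mul]
  | flip_neg_pos i =>
    refine wordOp_raise_eq s [neg 0, vertex 0, pos 0] [vertex 0] 2 ?_ i f b
      (by simp [Runs, Kind.ins, Kind.outs] at hr; omega)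
    intro f b hb
    obtain ⟨x, y, b, rfl⟩ := exists_cons_two hb
    cases s <;> cases x <;> cases y <;> simp [wordOp_cons, layerOp_pos, layerOp_neg,
      layerOp_vertex, T_one_mul_T_neg_one_mul, T_neg_one_mul_T_one_mul]

theorem smul_raise_eq (s : Bool) (u : Word) (c : ℤ[T;T⁻¹])
    (h : ∀ f b, 1 ≤ b.length → wordOp s u f b = c * f b) (i : ℕ) :
    ∀ f b, i + 1 ≤ b.length → wordOp s (raise i u) f b = c * f b := by
  induction i with
  | zero => simpa [raise] using h
  | succ i ih =>
    intro f b hb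
    rcases b with _ | ⟨x, b⟩
    · simp at hb
    · rw [raise_succ i u, wordOp_raise_one]
      exact ih _ _ (by simp at hb; omega)

/-- Of the two states of the minimum in the curl just one survives the maximum, and in it the two
bits below the crossing agree. So the weight is the same for both directions of the strand. -/
theorem wordOp_posKink (s : Bool) {u : Word} {i : ℕ} (h : PosKink i u) {n m : ℕ} (hr : Runs n u m)
    (f : List Bool → ℤ[T;T⁻¹]) (b : List Bool) (hb : b.length = n) :
    wordOp s u f b = T 1 * f b := by
  subst hb
  cases h with
  | right =>
    refine smul_raise_eq s [cup 1, pos 0, cap 1] (T 1) ?_ i f b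
      (by simp [Runs, Kind.ins, Kind.outs] at hr; omega)
    intro f b hb
    obtain ⟨x, b, rfl⟩ := exists_cons_one hb
    cases x <;> simp [wordOp_cons, layerOp_succ, layerOp_pos, layerOp_cup, layerOp_cap]
  | left =>
    refine smul_raise_eq s [cup 0, pos 1, cap 0] (T 1) ?_ i f b
      (by simp [Runs, Kind.ins, Kind.outs] at hr; omega)
    intro f b hb
    obtain ⟨x, b, rfl⟩ := exists_cons_one hb
    cases x <;> simp [wordOp_cons, layerOp_succ, layerOp_pos, layerOp_cup, layerOp_cap]

theorem wordOp_negKink (s : Bool) {u : Word} {i : ℕ} (h : NegKink i u) {n m : ℕ} (hr : Runs n u m)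
    (f : List Bool → ℤ[T;T⁻¹]) (b : List Bool) (hb : b.length = n) :
    wordOp s u f b = T (-1) * f b := by
  subst hb
  cases h with
  | right =>
    refine smul_raise_eq s [cup 1, neg 0, cap 1] (T (-1)) ?_ i f b
      (by simp [Runs, Kind.ins, Kind.outs] at hr; omega)
    intro f b hb
    obtain ⟨x, b, rfl⟩ := exists_cons_one hb
    cases x <;> simp [wordOp_cons, layerOp_succ, layerOp_neg, layerOp_cup, layerOp_cap]
  | left =>
    refine smul_raise_eq s [cup 0, neg 1, cap 0] (T (-1)) ?_ i f b
      (by simp [Runs, Kind.ins, Kind.outs] at hr; omega)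
    intro f b hb
    obtain ⟨x, b, rfl⟩ := exists_cons_one hb
    cases x <;> simp [wordOp_cons, layerOp_succ, layerOp_neg, layerOp_cup, layerOp_cap]

/-! ### State sums of diagrams -/

theorem runs_append {n m : ℕ} {u w : Word} :
    Runs n (u ++ w) m ↔ ∃ k, Runs n u k ∧ Runs k w m := by
  induction u generalizing n with
  | nil => simp [Runs]
  | cons l u ih => simp [Runs, ih, and_assoc]

theorem runs_unique {n m m' : ℕ} {w : Word} (h : Runs n w m) (h' : Runs n w m') : m = m' := by
  induction w generalizing n with
  | nil => exact h.symm.trans h'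
  | cons l w ih => exact ih h.2 h'.2

theorem length_of_mem_successors {s : Bool} {κ : Kind} {i : ℕ} {b b' : List Bool}
    (hb : i + κ.ins ≤ b.length) (h : b' ∈ successors s κ i b) :
    b'.length = b.length - κ.ins + κ.outs := by
  induction i generalizing b b' with
  | zero =>
    cases κ with
    | cup => simp [successors] at h; rcases h with rfl | rfl <;> simp [Kind.ins, Kind.outs]
    | _ =>
      obtain ⟨x, y, b, rfl⟩ := exists_cons_two (b := b) (by simpa [Kind.ins] using hb)
      simp only [successors] at h
      (try split_ifs at h) <;> simp_all [Kind.ins, Kind.outs]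
  | succ i ih =>
    rcases b with _ | ⟨x, b⟩
    · simp at hb
    · rw [successors, Finset.mem_map] at h
      obtain ⟨c, hc, rfl⟩ := h
      have h1 : i + κ.ins ≤ b.length := by simp at hb; omega
      have := ih h1 hc
      simp [this]; omega

theorem layerOp_congr {s : Bool} {κ : Kind} {i : ℕ} {b : List Bool} {f g : List Bool → ℤ[T;T⁻¹]}
    (hb : i + κ.ins ≤ b.length)
    (h : ∀ b' : List Bool, b'.length = b.length - κ.ins + κ.outs → f b' = g b') :
    layerOp s κ i f b = layerOp s κ i g b := by
  rw [layerOp_apply, layerOp_apply]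
  congr 1
  exact Finset.sum_congr rfl fun b' hb' => h b' (length_of_mem_successors hb hb')

theorem wordOp_congr {s : Bool} {w : Word} {n m : ℕ} (hw : Runs n w m) {b : List Bool}
    {f g : List Bool → ℤ[T;T⁻¹]} (hb : b.length = n)
    (h : ∀ b' : List Bool, b'.length = m → f b' = g b') :
    wordOp s w f b = wordOp s w g b := by
  induction w generalizing n b with
  | nil => exact h b (hb.trans hw)
  | cons l w ih =>
    subst hb
    rw [wordOp_cons, Module.End.mul_apply, Module.End.mul_apply]
    exact layerOp_congr hw.1 fun b' hb' => ih hw.2 hb'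

/-- The state sum of a picture above which no strands are left. -/
noncomputable def stateSumFrom (s : Bool) (w : Word) : List Bool → ℤ[T;T⁻¹] :=
  wordOp s w fun b => if b = [] then 1 else 0

/-- The state sum of a diagram. -/
noncomputable def stateSum (s : Bool) (w : Word) : ℤ[T;T⁻¹] := stateSumFrom s w []

/-- The operator of `x` is linear, and started at the empty state it sees only states of length `n`.
So a local identity valid for bit lists of this length suffices. -/
theorem stateSum_context (s : Bool) {x u v y : Word} {c : ℤ[T;T⁻¹]}
    (hd : IsDiagram (x ++ u ++ y))
    (h : ∀ n m, Runs 0 x n → Runs n u m → ∀ f b, b.length = n → wordOp s u f b = c * wordOp s v f b) :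
    stateSum s (x ++ u ++ y) = c * stateSum s (x ++ v ++ y) := by
  obtain ⟨k, hk, -⟩ := runs_append.1 hd
  obtain ⟨n, hx, hu⟩ := runs_append.1 hk
  simp only [stateSum, stateSumFrom, wordOp_append, Module.End.mul_apply]
  rw [← smul_eq_mul, ← Pi.smul_apply, ← map_smul]
  exact wordOp_congr hx rfl fun b hb => h n k hx hu _ b hb

theorem stateSum_applied (s : Bool) {M : Word → Word → Prop} {G H : Word} (h : Applied M G H)
    (hM : ∀ u v, M u v → PlaneMove u v ∨ RegularMove u v) :
    stateSum s G = stateSum s H := by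
  obtain ⟨hG, hH, x, u, v, y, huv, rfl, rfl⟩ := h
  have := stateSum_context s (c := 1) (v := v) hG fun n m _ hu f b hb => by
    rw [one_mul]
    rcases hM _ _ huv with h | h
    · exact wordOp_planeMove s h hu f b hb
    · exact wordOp_regularMove s h hu f b hb
  simpa using this

theorem stateSum_regularIsotopic (s : Bool) {G H : Word} (h : RegularIsotopic G H) :
    stateSum s G = stateSum s H := by
  induction h with
  | rel G H h => exact stateSum_applied s h fun _ _ => id
  | refl => rfl
  | symm _ _ _ ih => exact ih.symm
  | trans _ _ _ _ _ ih ih' => exact ih.trans ih'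

theorem stateSum_posKink (s : Bool) {x u y : Word} {i : ℕ} (hu : PosKink i u)
    (hd : IsDiagram (x ++ u ++ y)) : stateSum s (x ++ u ++ y) = T 1 * stateSum s (x ++ y) := by
  simpa using stateSum_context s (v := []) hd fun n m _ hr f b hb => wordOp_posKink s hu hr f b hb

theorem stateSum_negKink (s : Bool) {x u y : Word} {i : ℕ} (hu : NegKink i u)
    (hd : IsDiagram (x ++ u ++ y)) : stateSum s (x ++ u ++ y) = T (-1) * stateSum s (x ++ y) := by
  simpa using stateSum_context s (v := []) hd fun n m _ hr f b hb => wordOp_negKink s hu hr f b hb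

/-- The exponent does not depend on `s`. This is what carries the twisting number, found from
straight orientations, over to the source-sink orientations that compute the polynomial. -/
theorem stateSum_ambientIsotopic {G H : Word} (h : AmbientIsotopic G H) :
    ∃ k : ℤ, ∀ s, stateSum s G = T k * stateSum s H := by
  induction h with
  | rel G H h =>
    obtain ⟨hG, hH, x, u, v, y, huv, rfl, rfl⟩ := h
    rcases huv with huv | huv | huv
    · exact ⟨0, fun s => by
        simpa using stateSum_applied s ⟨hG, hH, x, u, v, y, huv, rfl, rfl⟩ fun _ _ => Or.inl⟩
    · exact ⟨0, fun s => by
        simpa using stateSum_applied s ⟨hG, hH, x, u, v, y, huv, rfl, rfl⟩ fun _ _ => Or.inr⟩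
    · cases huv with
      | pos i _ hu => exact ⟨1, fun s => by simpa using stateSum_posKink s hu hG⟩
      | neg i _ hu => exact ⟨-1, fun s => by simpa using stateSum_negKink s hu hG⟩
  | refl => exact ⟨0, fun s => by simp⟩
  | symm _ _ _ ih =>
    obtain ⟨k, hk⟩ := ih
    exact ⟨-k, fun s => by rw [hk s, ← mul_assoc, ← T_add]; simp⟩
  | trans _ _ _ _ _ ih ih' =>
    obtain ⟨k, hk⟩ := ih
    obtain ⟨k', hk'⟩ := ih'
    exact ⟨k + k', fun s => by rw [hk s, hk' s, ← mul_assoc, ← T_add]⟩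

theorem layerOp_map_not (s : Bool) (κ : Kind) (i : ℕ) (f : List Bool → ℤ[T;T⁻¹]) (b : List Bool) :
    layerOp s κ i f (b.map not) = layerOp s κ i (fun b' => f (b'.map not)) b := by
  induction i generalizing f b with
  | zero =>
    cases κ with
    | cup => simp [layerOp_cup, add_comm]
    | _ =>
      rcases b with _ | ⟨x, _ | ⟨y, b⟩⟩
      · simp [layerOp_apply, successors]
      · simp [layerOp_apply, successors]
      · cases s <;> cases x <;> cases y <;>
          simp [layerOp_cap, layerOp_pos, layerOp_neg, layerOp_vertex]
  | succ i ih =>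
    rcases b with _ | ⟨x, b⟩
    · simp [layerOp_apply, successors]
    · rw [List.map_cons, layerOp_succ, layerOp_succ, ih]
      rfl

theorem wordOp_map_not (s : Bool) (w : Word) (f : List Bool → ℤ[T;T⁻¹]) (b : List Bool) :
    wordOp s w f (b.map not) = wordOp s w (fun b' => f (b'.map not)) b := by
  induction w generalizing b with
  | nil => rfl
  | cons l w ih =>
    rw [wordOp_cons, Module.End.mul_apply, Module.End.mul_apply, layerOp_map_not]
    exact congrArg (fun g => layerOp s l.kind l.place g b) (funext ih)

theorem stateSumFrom_map_not (s : Bool) (w : Word) (b : List Bool) :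
    stateSumFrom s w (b.map not) = stateSumFrom s w b := by
  simp [stateSumFrom, wordOp_map_not]

theorem IsDiagram.exists_cons {w : Word} (h : IsDiagram w) (hne : w ≠ []) :
    ∃ w', w = cup 0 :: w' ∧ Runs 2 w' 0 := by
  rcases w with _ | ⟨⟨κ, i⟩, w⟩
  · exact absurd rfl hne
  · obtain ⟨h1, h2⟩ := h
    cases κ <;> simp [Kind.ins] at h1
    subst h1
    exact ⟨w, rfl, h2⟩

/-- The state sum of a diagram over the states in which the left end of the first minimum is directed
upwards. -/
noncomputable def halfStateSum (s : Bool) (w : Word) : ℤ[T;T⁻¹] :=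
  stateSumFrom s w.tail [true, false]

/-- Reversing all directions preserves every sign and interchanges the two states of the first
minimum. Halving is done in this way over integral Laurent polynomials because 2 need not be
cancellable in the ring of the theorem. -/
theorem two_mul_halfStateSum (s : Bool) {w : Word} (h : IsDiagram w) (hne : w ≠ []) :
    2 * halfStateSum s w = stateSum s w := by
  obtain ⟨w, rfl, -⟩ := h.exists_cons hne
  have := stateSumFrom_map_not s w [true, false]
  simp only [List.map_cons, List.map_nil, Bool.not_true, Bool.not_false] at this
  have h' : stateSum s (cup 0 :: w) = stateSumFrom s w [true, false] + stateSumFrom s w [false, true] := by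
    rw [stateSum, stateSumFrom, wordOp_cons, Module.End.mul_apply, layerOp_cup]
    rfl
  rw [h', this, halfStateSum, List.tail_cons, two_mul]

theorem two_ne_zero_laurent : (2 : ℤ[T;T⁻¹]) ≠ 0 := by
  intro h
  have := congrArg (LaurentPolynomial.eval₂ (RingHom.id ℤ) 1) h
  rw [map_ofNat, map_zero] at this
  exact two_ne_zero this

theorem stateSum_empty (s : Bool) : stateSum s [] = 1 := by simp [stateSum, stateSumFrom]

/-- The state sum of a non-empty diagram is divisible by 2, which is incompatible with the value 1
after setting the variable to 1. Hence regular isotopy separates the empty diagram from all others.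
-/
theorem eq_nil_of_stateSum_eq_one {s : Bool} {w : Word} (h : IsDiagram w) (h1 : stateSum s w = 1) :
    w = [] := by
  by_contra hne
  rw [← two_mul_halfStateSum s h hne] at h1
  have := congrArg (LaurentPolynomial.eval₂ (RingHom.id ℤ) 1) h1
  rw [map_mul, map_ofNat, map_one] at this
  omega

theorem regularIsotopic_nil_iff {G H : Word} (hG : IsDiagram G) (hH : IsDiagram H)
    (h : RegularIsotopic G H) : G = [] ↔ H = [] := by
  have := stateSum_regularIsotopic true h
  constructor
  · rintro rfl
    exact eq_nil_of_stateSum_eq_one hH (this.symm.trans (stateSum_empty true))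
  · rintro rfl
    exact eq_nil_of_stateSum_eq_one hG (this.trans (stateSum_empty true))

theorem halfStateSum_eq_of_mul {s : Bool} {u w : Word} {c : ℤ[T;T⁻¹]} (hu : IsDiagram u)
    (hw : IsDiagram w) (hu' : u ≠ []) (hw' : w ≠ []) (h : stateSum s u = c * stateSum s w) :
    halfStateSum s u = c * halfStateSum s w := by
  apply mul_left_cancel₀ two_ne_zero_laurent
  rw [mul_left_comm, two_mul_halfStateSum s hu hu', two_mul_halfStateSum s hw hw', h]

/-- For equal bits the maximum gives 0 and the crossings differ by $T - T^{-1}$. For opposite bits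
the pair of maximum and minimum yields both the kept and the swapped bits; the kept ones cancel
against the vertical strands, and the swapped ones match the crossings. -/
theorem wordOp_skein (s : Bool) (i : ℕ) (f : List Bool → ℤ[T;T⁻¹]) (b : List Bool)
    (hb : i + 2 ≤ b.length) :
    wordOp s [pos i] f b - wordOp s [neg i] f b =
      (T 1 - T (-1)) * (f b - wordOp s [cap i, cup i] f b) := by
  simp only [wordOp_cons, wordOp_nil, mul_one, Module.End.mul_apply]
  induction i generalizing f b with
  | zero =>
    obtain ⟨x, y, b, rfl⟩ := exists_cons_two (by omega)
    cases x <;> cases y <;> simp [layerOp_pos, layerOp_neg, layerOp_cap, layerOp_cup] <;> ring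
  | succ i ih =>
    obtain ⟨x, b, rfl⟩ := exists_cons_one (by omega : 1 ≤ b.length)
    have := ih (fun b' => f (x :: b')) b (by simp at hb; omega)
    simpa only [layerOp_succ] using this

theorem stateSum_skein (s : Bool) {x y : Word} {i : ℕ} (h : IsDiagram (x ++ [pos i] ++ y)) :
    stateSum s (x ++ [pos i] ++ y) - stateSum s (x ++ [neg i] ++ y) =
      (T 1 - T (-1)) * (stateSum s (x ++ y) - stateSum s (x ++ [cap i, cup i] ++ y)) := by
  obtain ⟨k, hk, -⟩ := runs_append.1 h
  obtain ⟨n, hx, hu⟩ := runs_append.1 hk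
  simp only [stateSum, stateSumFrom, wordOp_append, Module.End.mul_apply]
  rw [← Pi.sub_apply, ← Pi.sub_apply, ← map_sub, ← map_sub, ← smul_eq_mul, ← Pi.smul_apply,
    ← map_smul]
  refine wordOp_congr hx rfl fun b hb => wordOp_skein s i _ b ?_
  rw [hb]
  exact hu.1

theorem runs_skein {n m i : ℕ} (h : i + 2 ≤ n) {y : Word} :
    (Runs n ([pos i] ++ y) m ↔ Runs n y m) ∧ (Runs n ([neg i] ++ y) m ↔ Runs n y m) ∧
      (Runs n ([cap i, cup i] ++ y) m ↔ Runs n y m) := by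
  have e : n - 2 + 2 = n := by omega
  refine ⟨?_, ?_, ?_⟩ <;> simp [Runs, Kind.ins, Kind.outs, e, h]
  intro _
  omega

theorem isDiagram_skein {x y : Word} {i : ℕ} (h : IsDiagram (x ++ [pos i] ++ y)) :
    IsDiagram (x ++ [neg i] ++ y) ∧ IsDiagram (x ++ y) ∧ IsDiagram (x ++ [cap i, cup i] ++ y) ∧
      x ≠ [] := by
  simp only [IsDiagram, List.append_assoc] at h ⊢
  obtain ⟨n, hx, h⟩ := runs_append.1 h
  have hn : i + 2 ≤ n := h.1
  obtain ⟨h1, h2, h3⟩ := runs_skein (m := 0) hn (y := y)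
  refine ⟨runs_append.2 ⟨n, hx, h2.2 (h1.1 h)⟩, runs_append.2 ⟨n, hx, h1.1 h⟩,
    runs_append.2 ⟨n, hx, h3.2 (h1.1 h)⟩, ?_⟩
  rintro rfl
  have : 0 = n := hx
  omega

theorem PosKink.runs {i n m : ℕ} {u : Word} (h : PosKink i u) (hr : Runs n u m) :
    i + 1 ≤ n ∧ m = n := by
  cases h <;> simp [Runs, Kind.ins, Kind.outs] at hr <;> omega

theorem NegKink.runs {i n m : ℕ} {u : Word} (h : NegKink i u) (hr : Runs n u m) :
    i + 1 ≤ n ∧ m = n := by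
  cases h <;> simp [Runs, Kind.ins, Kind.outs] at hr <;> omega

theorem isDiagram_of_kink {x u y : Word} (h : IsDiagram (x ++ u ++ y))
    (hu : ∀ n m, Runs n u m → 1 ≤ n ∧ m = n) : IsDiagram (x ++ y) ∧ x ≠ [] := by
  obtain ⟨k, hk, hy⟩ := runs_append.1 h
  obtain ⟨n, hx, hr⟩ := runs_append.1 hk
  obtain ⟨h1, rfl⟩ := hu n k hr
  refine ⟨runs_append.2 ⟨_, hx, hy⟩, ?_⟩
  rintro rfl
  have : 0 = k := hx
  omega

/-! ### Existence: the Dubrovnik polynomial as a sum over orientations -/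

section Existence

variable {R : Type*} [CommRing R]

/-- Evaluation of integral Laurent polynomials at a unit. -/
noncomputable def evalAt (a : Rˣ) : ℤ[T;T⁻¹] →+* R := LaurentPolynomial.eval₂ (Int.castRingHom R) a

theorem evalAt_T (a : Rˣ) (n : ℤ) : evalAt a (T n) = ((a ^ n : Rˣ) : R) := by
  simp [evalAt]

/-- The Dubrovnik polynomial with `z = a - a⁻¹` is a sum over the orientations of a link diagram. -/
theorem isDubrovnik_halfStateSum (a : Rˣ) :
    IsDubrovnik a ((a : R) - ((a⁻¹ : Rˣ) : R)) fun w => evalAt a (halfStateSum true w) where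
  regular L L' hL hL' h := by
    have hiff := regularIsotopic_nil_iff hL.1 hL'.1 h
    by_cases hne : L = []
    · rw [hne, hiff.1 hne]
    · refine congrArg (evalAt a) ?_
      simpa using halfStateSum_eq_of_mul (c := 1) hL.1 hL'.1 hne (fun h' => hne (hiff.2 h'))
        (by simpa using stateSum_regularIsotopic true h)
  skein x y i h := by
    obtain ⟨h1, h2, h3, hx⟩ := isDiagram_skein h.1
    have key : halfStateSum true (x ++ [pos i] ++ y) - halfStateSum true (x ++ [neg i] ++ y) =
        (T 1 - T (-1)) *
          (halfStateSum true (x ++ y) - halfStateSum true (x ++ [cap i, cup i] ++ y)) := by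
      -- The full state sums obey the relation, and Laurent polynomials over the integers have no
      -- 2-torsion. All four diagrams are non-empty, as at least two strands reach the crossing from
      -- below.
      apply mul_left_cancel₀ two_ne_zero_laurent
      rw [mul_left_comm, mul_sub, mul_sub, two_mul_halfStateSum true h.1 (by simp),
        two_mul_halfStateSum true h1 (by simp), two_mul_halfStateSum true h2 (by simp [hx]),
        two_mul_halfStateSum true h3 (by simp), stateSum_skein true h.1]
    simpa [evalAt_T] using congrArg (evalAt a) key
  pos_kink x u y i hu h := by
    obtain ⟨h1, hx⟩ := isDiagram_of_kink h.1 fun n m hr => by have := hu.runs hr; omega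
    have := halfStateSum_eq_of_mul h.1 h1 (by simp [hx]) (by simp [hx]) (stateSum_posKink true hu h.1)
    simpa only [map_mul, evalAt_T, zpow_one, zpow_neg_one] using congrArg (evalAt a) this
  neg_kink x u y i hu h := by
    obtain ⟨h1, hx⟩ := isDiagram_of_kink h.1 fun n m hr => by have := hu.runs hr; omega
    have := halfStateSum_eq_of_mul h.1 h1 (by simp [hx]) (by simp [hx]) (stateSum_negKink true hu h.1)
    simpa only [map_mul, evalAt_T, zpow_one, zpow_neg_one] using congrArg (evalAt a) this
  unknot := by
    simp [halfStateSum, stateSumFrom, wordOp_cons, layerOp_cap]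

end Existence

/-! ### Uniqueness: functionals of tangles and relations between pictures -/

section Uniqueness

variable {R : Type*} [CommRing R]

/-- A picture without vertices, with `n` ends at the bottom and `m` at the top. -/
def IsTangle (n : ℕ) (u : Word) (m : ℕ) : Prop := Runs n u m ∧ ∀ l ∈ u, l.kind ≠ .vertex

theorem IsTangle.append {n k m : ℕ} {u v : Word} (hu : IsTangle n u k) (hv : IsTangle k v m) :
    IsTangle n (u ++ v) m :=
  ⟨runs_append.2 ⟨k, hu.1, hv.1⟩, fun l hl => (List.mem_append.1 hl).elim (hu.2 l) (hv.2 l)⟩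

/-- The homogeneous linear relations between the values of Dubrovnik polynomials. -/
structure SkeinFunctional (a : Rˣ) (z : R) (E : Word → R) : Prop where
  zero : ∀ w, ¬ IsDiagram w → E w = 0
  empty : E [] = 0
  unknot : E [cup 0, cap 0] = 0
  move : ∀ {n m : ℕ} {x u v : Word}, IsTangle 0 x n → IsTangle n u m → IsTangle n v m →
    (PlaneMove u v ∨ RegularMove u v) → ∀ y, E (x ++ u ++ y) = E (x ++ v ++ y)
  skein : ∀ {n i : ℕ} {x : Word}, IsTangle 0 x n → i + 2 ≤ n → ∀ y,
    E (x ++ [pos i] ++ y) - E (x ++ [neg i] ++ y) =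
      z * (E (x ++ y) - E (x ++ [cap i, cup i] ++ y))
  pos_kink : ∀ {n i : ℕ} {x u : Word}, IsTangle 0 x n → PosKink i u → i + 1 ≤ n → ∀ y,
    E (x ++ u ++ y) = a * E (x ++ y)
  neg_kink : ∀ {n i : ℕ} {x u : Word}, IsTangle 0 x n → NegKink i u → i + 1 ≤ n → ∀ y,
    E (x ++ u ++ y) = (a⁻¹ : Rˣ) * E (x ++ y)

/-- The right action of pictures on functionals. -/
def act (u : Word) : (Word → R) →ₗ[R] (Word → R) := LinearMap.funLeft R R (u ++ ·)

theorem act_apply (u : Word) (f : Word → R) (y : Word) : act u f y = f (u ++ y) := rfl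

theorem act_append (u v : Word) (f : Word → R) : act (u ++ v) f = act v (act u f) := by
  funext y
  simp [act_apply]

theorem act_nil (f : Word → R) : act [] f = f := rfl

/-- The functionals that come from tangles with `n` ends at the top. -/
def tangleSpan (E : Word → R) (n : ℕ) : Submodule R (Word → R) :=
  Submodule.span R {f | ∃ x, IsTangle 0 x n ∧ f = act x E}

theorem act_mem_tangleSpan {E : Word → R} {n m : ℕ} {u : Word} (hu : IsTangle n u m) {f : Word → R}
    (hf : f ∈ tangleSpan E n) : act u f ∈ tangleSpan E m := by
  induction hf using Submodule.span_induction with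
  | mem f h =>
    obtain ⟨x, hx, rfl⟩ := h
    exact Submodule.subset_span ⟨x ++ u, hx.append hu, (act_append _ _ _).symm⟩
  | zero => simp
  | add f g _ _ hf hg => rw [map_add]; exact add_mem hf hg
  | smul c f _ hf => rw [map_smul]; exact Submodule.smul_mem _ c hf

theorem linear_eq_on_tangleSpan {E : Word → R} {n : ℕ} {φ ψ : (Word → R) →ₗ[R] (Word → R)}
    (h : ∀ x, IsTangle 0 x n → φ (act x E) = ψ (act x E)) {f : Word → R}
    (hf : f ∈ tangleSpan E n) : φ f = ψ f := by
  have : Set.EqOn φ ψ {f | ∃ x, IsTangle 0 x n ∧ f = act x E} := by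
    rintro _ ⟨x, hx, rfl⟩
    exact h x hx
  exact LinearMap.eqOn_span this hf

/-- Pictures with `n` ends at the bottom that act equally. -/
def Related (E : Word → R) (n : ℕ) (u v : Word) : Prop :=
  ∀ f ∈ tangleSpan E n, act u f = act v f

namespace Related

variable {E : Word → R} {n k : ℕ} {u v w x y : Word}

theorem refl (u : Word) : Related E n u u := fun _ _ => rfl

theorem symm (h : Related E n u v) : Related E n v u := fun f hf => (h f hf).symm

theorem trans (h : Related E n u v) (h' : Related E n v w) : Related E n u w :=
  fun f hf => (h f hf).trans (h' f hf)

theorem append_right (h : Related E n u v) (y : Word) : Related E n (u ++ y) (v ++ y) :=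
  fun f hf => by rw [act_append, act_append, h f hf]

theorem append_left (hx : IsTangle n x k) (h : Related E k u v) : Related E n (x ++ u) (x ++ v) :=
  fun f hf => by rw [act_append, act_append, h _ (act_mem_tangleSpan hx hf)]

theorem mid (x y : Word) (hx : IsTangle n x k) (h : Related E k u v) :
    Related E n (x ++ (u ++ y)) (x ++ (v ++ y)) :=
  append_left hx (append_right h y)

end Related

theorem isTangle_one {κ : Kind} {i n m : ℕ} (hκ : κ ≠ .vertex) (h : i + κ.ins ≤ n)
    (hm : m = n - κ.ins + κ.outs) : IsTangle n [⟨κ, i⟩] m :=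
  ⟨⟨h, hm.symm⟩, by simpa using hκ⟩

/-- The strand at place `j + k` passes over `k` strands to its left. -/
def overRun (j : ℕ) : ℕ → Word
  | 0 => []
  | k + 1 => pos (j + k) :: overRun j k

theorem overRun_add (j k l : ℕ) : overRun j (k + l) = overRun (j + k) l ++ overRun j k := by
  induction l with
  | zero => rfl
  | succ l ih => simp [overRun, ← add_assoc, ih]

theorem overRun_succ' (j k : ℕ) : overRun j (k + 1) = overRun (j + 1) k ++ [pos j] := by
  rw [add_comm, overRun_add]
  rfl

/-- A new strand: its right end is the last one, its left end has passed over `k` strands. -/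
def star (j k : ℕ) : Word := cup (j + k) :: overRun j k

theorem star_succ (j k : ℕ) : star j (k + 1) = star (j + 1) k ++ [pos j] := by
  rw [star, overRun_succ', star, add_assoc, add_comm 1 k]
  rfl

theorem isTangle_overRun {j k n : ℕ} (h : j + k + 1 ≤ n) : IsTangle n (overRun j k) n := by
  induction k with
  | zero => exact ⟨rfl, by simp [overRun]⟩
  | succ k ih =>
    exact (isTangle_one (κ := .pos) (i := j + k) (m := n) (by simp) (by simp [Kind.ins]; omega)
      (by simp [Kind.ins, Kind.outs]; omega)).append (ih (by omega))

theorem isTangle_star {j k n : ℕ} (h : n = j + k) : IsTangle n (star j k) (n + 2) :=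
  (isTangle_one (κ := .cup) (i := j + k) (m := n + 2) (by simp) (by simp [Kind.ins]; omega)
    (by simp [Kind.ins, Kind.outs])).append (isTangle_overRun (by omega))

end Uniqueness

theorem Kind.ins_pos : Kind.ins .pos = 2 := rfl

theorem Kind.ins_cup : Kind.ins .cup = 0 := rfl

theorem Kind.ins_cap : Kind.ins .cap = 2 := rfl

theorem Kind.outs_pos : Kind.outs .pos = 2 := rfl

theorem Kind.outs_cup : Kind.outs .cup = 2 := rfl

namespace SkeinFunctional

variable {R : Type*} [CommRing R] {a : Rˣ} {z : R} {E : Word → R}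

theorem related_move (hE : SkeinFunctional a z E) {n : ℕ} (m : ℕ) {u v : Word} (hu : IsTangle n u m)
    (hv : IsTangle n v m) (h : PlaneMove u v ∨ RegularMove u v) : Related E n u v := by
  intro f hf
  refine linear_eq_on_tangleSpan (fun x hx => ?_) hf
  funext y
  simpa [act_apply] using hE.move hx hu hv h y

theorem act_skein (hE : SkeinFunctional a z E) {n i : ℕ} (hi : i + 2 ≤ n) {f : Word → R}
    (hf : f ∈ tangleSpan E n) :
    act [pos i] f - act [neg i] f = z • (f - act [cup i] (act [cap i] f)) := by
  have := linear_eq_on_tangleSpan (φ := act [pos i] - act [neg i])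
    (ψ := z • (LinearMap.id - act [cup i] ∘ₗ act [cap i])) (fun x hx => ?_) hf
  · simpa using this
  · funext y
    simpa [act_apply] using hE.skein hx hi y

theorem act_pos_kink (hE : SkeinFunctional a z E) {n i : ℕ} {u : Word} (hu : PosKink i u)
    (hi : i + 1 ≤ n) {f : Word → R} (hf : f ∈ tangleSpan E n) : act u f = (a : R) • f := by
  refine linear_eq_on_tangleSpan (φ := act u) (ψ := (a : R) • LinearMap.id) (fun x hx => ?_) hf
  funext y
  simpa [act_apply] using hE.pos_kink hx hu hi y

theorem act_neg_kink (hE : SkeinFunctional a z E) {n i : ℕ} {u : Word} (hu : NegKink i u)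
    (hi : i + 1 ≤ n) {f : Word → R} (hf : f ∈ tangleSpan E n) :
    act u f = ((a⁻¹ : Rˣ) : R) • f := by
  refine linear_eq_on_tangleSpan (φ := act u) (ψ := ((a⁻¹ : Rˣ) : R) • LinearMap.id)
    (fun x hx => ?_) hf
  funext y
  simpa [act_apply] using hE.neg_kink hx hu hi y

theorem exchange (hE : SkeinFunctional a z E) {κ τ : Kind} (hκ : κ ≠ .vertex) (hτ : τ ≠ .vertex)
    {n : ℕ} (i k : ℕ) (h : i + κ.ins + k + τ.ins ≤ n) :
    Related E n [⟨κ, i⟩, ⟨τ, i + κ.outs + k⟩] [⟨τ, i + κ.ins + k⟩, ⟨κ, i⟩] := by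
  refine hE.related_move (n - κ.ins + κ.outs - τ.ins + τ.outs)
    ((isTangle_one hκ (by omega) rfl).append (isTangle_one hτ (by omega) rfl)) ?_
    (.inl (.exchange κ τ i k))
  refine (isTangle_one hτ (by omega) rfl).append (isTangle_one hκ ?_ ?_) <;>
    (cases κ <;> cases τ <;> simp only [Kind.ins, Kind.outs] at * <;> omega)

theorem zigzag_left (hE : SkeinFunctional a z E) {n : ℕ} (i : ℕ) (h : i + 1 ≤ n) :
    Related E n [cup (i + 1), cap i] [] := by
  refine hE.related_move n ?_ ?_ (.inl (.zigzag_left i)) <;>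
    simp [IsTangle, Runs, Kind.ins, Kind.outs] <;> omega

theorem zigzag_right (hE : SkeinFunctional a z E) {n : ℕ} (i : ℕ) (h : i + 1 ≤ n) :
    Related E n [cup i, cap (i + 1)] [] := by
  refine hE.related_move n ?_ ?_ (.inl (.zigzag_right i)) <;>
    simp [IsTangle, Runs, Kind.ins, Kind.outs] <;> omega

theorem cap_pos (hE : SkeinFunctional a z E) {n : ℕ} (i : ℕ) (h : i + 3 ≤ n) :
    Related E n [pos i, cap (i + 1)] [neg (i + 1), cap i] := by
  refine hE.related_move (n - 2) ?_ ?_ (.inl (.cap_pos i)) <;>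
    simp [IsTangle, Runs, Kind.ins, Kind.outs] <;> omega

theorem cap_neg (hE : SkeinFunctional a z E) {n : ℕ} (i : ℕ) (h : i + 3 ≤ n) :
    Related E n [neg i, cap (i + 1)] [pos (i + 1), cap i] := by
  refine hE.related_move (n - 2) ?_ ?_ (.inl (.cap_neg i)) <;>
    simp [IsTangle, Runs, Kind.ins, Kind.outs] <;> omega

theorem cup_pos (hE : SkeinFunctional a z E) {n : ℕ} (i : ℕ) (h : i + 1 ≤ n) :
    Related E n [cup (i + 1), pos i] [cup i, neg (i + 1)] := by
  refine hE.related_move (n + 2) ?_ ?_ (.inl (.cup_pos i)) <;>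
    simp [IsTangle, Runs, Kind.ins, Kind.outs] <;> omega

theorem cup_neg (hE : SkeinFunctional a z E) {n : ℕ} (i : ℕ) (h : i + 1 ≤ n) :
    Related E n [cup (i + 1), neg i] [cup i, pos (i + 1)] := by
  refine hE.related_move (n + 2) ?_ ?_ (.inl (.cup_neg i)) <;>
    simp [IsTangle, Runs, Kind.ins, Kind.outs] <;> omega

theorem cancel_pos_neg (hE : SkeinFunctional a z E) {n : ℕ} (i : ℕ) (h : i + 2 ≤ n) :
    Related E n [pos i, neg i] [] := by
  refine hE.related_move n ?_ ?_ (.inr (.cancel_pos_neg i)) <;>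
    simp [IsTangle, Runs, Kind.ins, Kind.outs] <;> omega

theorem cancel_neg_pos (hE : SkeinFunctional a z E) {n : ℕ} (i : ℕ) (h : i + 2 ≤ n) :
    Related E n [neg i, pos i] [] := by
  refine hE.related_move n ?_ ?_ (.inr (.cancel_neg_pos i)) <;>
    simp [IsTangle, Runs, Kind.ins, Kind.outs] <;> omega

theorem braid (hE : SkeinFunctional a z E) {n : ℕ} (i : ℕ) (h : i + 3 ≤ n) :
    Related E n [pos (i + 1), pos i, pos (i + 1)] [pos i, pos (i + 1), pos i] := by
  refine (hE.related_move n ?_ ?_ (.inr (.pass_over .pos (.inl rfl) i))).symm <;>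
    simp [IsTangle, Runs, Kind.ins, Kind.outs] <;> omega

theorem over_cap (hE : SkeinFunctional a z E) {n : ℕ} (i : ℕ) (h : i + 3 ≤ n) :
    Related E n [pos (i + 1), pos i, cap (i + 1)] [cap i] := by
  have h1 : IsTangle n [pos (i + 1)] n := by
    simp [IsTangle, Runs, Kind.ins, Kind.outs]; omega
  exact (Related.mid [pos (i + 1)] [] h1 (hE.cap_pos i h)).trans
    (Related.mid [] [cap i] (n := n) (k := n) (by simp [IsTangle, Runs])
      (hE.cancel_pos_neg (i + 1) (by omega)))

theorem over_cup (hE : SkeinFunctional a z E) {n : ℕ} (i : ℕ) (h : i + 1 ≤ n) :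
    Related E n [cup (i + 1)] [cup i, pos (i + 1), pos i] := by
  have h1 : IsTangle n [cup (i + 1)] (n + 2) := by
    simp [IsTangle, Runs, Kind.ins, Kind.outs]; omega
  exact (Related.mid [cup (i + 1)] [] h1 (hE.cancel_neg_pos i (by omega))).symm.trans
    (Related.mid [] [pos i] (n := n) (k := n) (by simp [IsTangle, Runs]) (hE.cup_neg i h))

theorem overRun_left (hE : SkeinFunctional a z E) {κ : Kind} (hκ : κ ≠ .vertex) (i d k : ℕ) {n : ℕ}
    (h : i + κ.ins + d + k + 1 ≤ n) :
    Related E n (overRun (i + κ.ins + d) k ++ [⟨κ, i⟩]) (⟨κ, i⟩ :: overRun (i + κ.outs + d) k) := by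
  induction k with
  | zero => exact .refl _
  | succ k ih =>
    have h1 : IsTangle n [pos (i + κ.ins + d + k)] n :=
      isTangle_one (by simp) (by simp only [Kind.ins_pos, Kind.ins_cup, Kind.ins_cap]; omega) (by simp only [Kind.ins_pos, Kind.outs_pos]; omega)
    have e := (hE.exchange hκ (τ := .pos) (by simp) (n := n) i (d + k)
      (by simp only [Kind.ins_pos, Kind.ins_cup, Kind.ins_cap]; omega)).symm.append_right (overRun (i + κ.outs + d) k)
    simp only [← add_assoc] at e
    exact (Related.append_left h1 (ih (by omega))).trans e

theorem overRun_right (hE : SkeinFunctional a z E) {κ : Kind} (hκ : κ ≠ .vertex) (j k d : ℕ) {n : ℕ}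
    (h : j + k + 1 + d + κ.ins ≤ n) :
    Related E n (overRun j k ++ [⟨κ, j + k + 1 + d⟩]) (⟨κ, j + k + 1 + d⟩ :: overRun j k) := by
  induction k generalizing d with
  | zero => exact .refl _
  | succ k ih =>
    have h1 : IsTangle n [pos (j + k)] n :=
      isTangle_one (by simp) (by simp only [Kind.ins_pos, Kind.ins_cup, Kind.ins_cap]; omega) (by simp only [Kind.ins_pos, Kind.outs_pos]; omega)
    have ih' := ih (d + 1) (by omega)
    have e : j + (k + 1) + 1 + d = j + k + 1 + (d + 1) := by omega
    have e' := (hE.exchange (κ := .pos) (by simp) hκ (n := n) (j + k) d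
      (by simp only [Kind.ins_pos, Kind.ins_cup, Kind.ins_cap]; omega)).append_right (overRun j k)
    simp only [Kind.ins, Kind.outs] at e'
    have e'' : j + k + 2 + d = j + k + 1 + (d + 1) := by omega
    rw [e''] at e'
    rw [e]
    exact (Related.append_left h1 ih').trans e'

theorem star_left (hE : SkeinFunctional a z E) {κ : Kind} (hκ : κ ≠ .vertex) (i d k : ℕ) {n : ℕ}
    (h : n = i + κ.ins + d + k) :
    Related E n (star (i + κ.ins + d) k ++ [⟨κ, i⟩]) (⟨κ, i⟩ :: star (i + κ.outs + d) k) := by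
  have h1 : IsTangle n [cup (i + κ.ins + d + k)] (n + 2) :=
    isTangle_one (by simp) (by simp only [Kind.ins_pos, Kind.ins_cup, Kind.ins_cap]; omega) (by simp only [Kind.ins_cup, Kind.outs_cup]; omega)
  have e := (hE.exchange hκ (τ := .cup) (by simp) (n := n) i (d + k)
    (by simp only [Kind.ins_pos, Kind.ins_cup, Kind.ins_cap]; omega)).symm.append_right (overRun (i + κ.outs + d) k)
  simp only [← add_assoc] at e
  exact (Related.append_left h1 (hE.overRun_left hκ i d k (by omega))).trans e

/-- A strand that passes over a piece. -/
theorem overRun_under (hE : SkeinFunctional a z E) {κ : Kind} (hκ : κ = .cup ∨ κ = .cap ∨ κ = .pos)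
    (j d e : ℕ) {n : ℕ} (h : j + d + κ.ins + e + 1 ≤ n) :
    Related E n (overRun j (d + κ.ins + e) ++ [⟨κ, j + d + 1⟩])
      (⟨κ, j + d⟩ :: overRun j (d + κ.outs + e)) := by
  have hv : κ ≠ .vertex := by rcases hκ with rfl | rfl | rfl <;> simp
  -- The run splits into its crossings to the right of the piece, with the strands of the piece, and
  -- to the left of it. The outer parts commute with the piece; the middle part needs a strand
  -- pulled across a minimum or maximum, or the braid relation.
  have key : Related E n (overRun (j + d) κ.ins ++ [⟨κ, j + d + 1⟩])
      (⟨κ, j + d⟩ :: overRun (j + d) κ.outs) := by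
    rcases hκ with rfl | rfl | rfl
    · exact hE.over_cup (j + d) (by simp [Kind.ins] at h; omega)
    · exact hE.over_cap (j + d) (by simp [Kind.ins] at h; omega)
    · exact hE.braid (j + d) (by simp [Kind.ins] at h; omega)
  have t1 : IsTangle n (overRun (j + d + κ.ins) e) n := isTangle_overRun (by omega)
  have t2 : IsTangle n (overRun (j + d) κ.ins) n := isTangle_overRun (by omega)
  have s1 := Related.append_left (t1.append t2) (hE.overRun_right hv j d 0 (n := n) (by omega))
  have s2 := Related.mid _ (overRun j d) t1 key
  have s3 := (hE.overRun_left hv (j + d) 0 e (n := n) (by omega)).append_right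
    (overRun (j + d) κ.outs ++ overRun j d)
  have e1 : ∀ q, overRun j (d + q + e) = overRun (j + d + q) e ++ (overRun (j + d) q ++ overRun j d) := by
    intro q
    rw [overRun_add, overRun_add, add_assoc]
  simp only [add_zero, List.append_assoc, List.cons_append, List.nil_append] at s1 s2 s3
  rw [e1, e1]
  simp only [List.append_assoc]
  exact s1.trans (s2.trans s3)

theorem star_under (hE : SkeinFunctional a z E) {κ : Kind} (hκ : κ = .cup ∨ κ = .cap ∨ κ = .pos)
    (j d e : ℕ) {n : ℕ} (h : n = j + d + κ.ins + e) :
    Related E n (star j (d + κ.ins + e) ++ [⟨κ, j + d + 1⟩])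
      (⟨κ, j + d⟩ :: star j (d + κ.outs + e)) := by
  have hv : κ ≠ .vertex := by rcases hκ with rfl | rfl | rfl <;> simp
  have h1 : IsTangle n [cup (j + (d + κ.ins + e))] (n + 2) :=
    isTangle_one (by simp) (by simp only [Kind.ins_pos, Kind.ins_cup, Kind.ins_cap]; omega) (by simp only [Kind.ins_cup, Kind.outs_cup]; omega)
  have s := (hE.exchange hv (τ := .cup) (by simp) (n := n) (j + d) e
    (by simp only [Kind.ins_pos, Kind.ins_cup, Kind.ins_cap]; omega)).symm.append_right (overRun j (d + κ.outs + e))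
  simp only [add_assoc] at s h1
  have s' := Related.append_left h1 (hE.overRun_under hκ j d e (by omega))
  simp only [add_assoc] at s'
  simp only [star, add_assoc]
  exact s'.trans s

/-- Put a negative curl on the right end of the minimum; plane moves turn it into the crossing of
the two ends. The factor is $a^{-1}$ although the layer is `pos`, since the two ends of a minimum
are oppositely directed. -/
theorem act_cup_pos (hE : SkeinFunctional a z E) {n : ℕ} (i : ℕ) (h : i ≤ n) {f : Word → R}
    (hf : f ∈ tangleSpan E n) :
    act [cup i, pos i] f = ((a⁻¹ : Rˣ) : R) • act [cup i] f := by
  have t1 : IsTangle n [cup i] (n + 2) := by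
    simp [IsTangle, Runs, Kind.ins, Kind.outs]; omega
  have t0 : IsTangle n [] n := by simp [IsTangle, Runs]
  have hl := hE.act_neg_kink (i := i + 1) (n := n + 2) (.right) (by omega) (act_mem_tangleSpan t1 hf)
  rw [← hl, ← act_append]
  have e1 := Related.mid [] [neg (i + 1), cap (i + 2)] t0
    (hE.exchange (κ := .cup) (τ := .cup) (by simp) (by simp) (n := n) i 0 (by simp only [Kind.ins_pos, Kind.ins_cup, Kind.ins_cap]; omega))
  have e2 := Related.mid [cup i] [cap (i + 2)] t1 (hE.cup_pos (n := n + 2) i (by omega)).symm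
  have e3 := Related.mid [cup i, cup (i + 1)] [] (n := n) (k := n + 4)
    (by simp [IsTangle, Runs, Kind.ins, Kind.outs]; omega)
    (hE.exchange (κ := .pos) (τ := .cap) (by simp) (by simp) (n := n + 4) i 0
      (by simp only [Kind.ins_pos, Kind.ins_cup, Kind.ins_cap]; omega))
  have e4 := Related.mid [cup i] [pos i] t1 (hE.zigzag_right (n := n + 2) (i + 1) (by omega))
  exact (((e1.trans (e2.trans (e3.trans e4))) f hf)).symm

theorem act_pos_cap (hE : SkeinFunctional a z E) {n : ℕ} (i : ℕ) (h : i + 2 ≤ n) {f : Word → R}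
    (hf : f ∈ tangleSpan E n) :
    act [pos i, cap i] f = ((a⁻¹ : Rˣ) : R) • act [cap i] f := by
  have t0 : IsTangle n [] n := by simp [IsTangle, Runs]
  have k := hE.act_neg_kink (i := i + 1) (n := n) (.right) (by omega) hf
  have e1 := Related.mid [cup (i + 2), neg (i + 1)] [] (n := n) (k := n + 2)
    (by simp [IsTangle, Runs, Kind.ins, Kind.outs]; omega)
    (hE.exchange (κ := .cap) (τ := .cap) (by simp) (by simp) (n := n + 2) i 0
      (by simp only [Kind.ins_pos, Kind.ins_cup, Kind.ins_cap]; omega)).symm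
  have e2 := Related.mid [cup (i + 2)] [cap i] (n := n) (k := n + 2)
    (by simp [IsTangle, Runs, Kind.ins, Kind.outs]; omega)
    (hE.cap_pos (n := n + 2) i (by omega)).symm
  have e3 := Related.mid [] [cap (i + 1), cap i] t0
    (hE.exchange (κ := .pos) (τ := .cup) (by simp) (by simp) (n := n) i 0
      (by simp only [Kind.ins_pos, Kind.ins_cup, Kind.ins_cap]; omega)).symm
  have e4 := Related.mid [pos i] [cap i] (n := n) (k := n)
    (by simp [IsTangle, Runs, Kind.ins, Kind.outs]; omega)
    (hE.zigzag_left (n := n) (i + 1) (by omega))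
  rw [← map_smul, ← k, ← act_append]
  exact (((e1.trans (e2.trans (e3.trans e4))) f hf)).symm

/-- The skein relation at the crossing of a curl reads $a - a^{-1} = z(\mu - 1)$: one smoothing
splits off the circle, the other straightens the strand. Being a unit, $z$ can be divided out. A
strand beside the circle is required for forming the curl. -/
theorem act_circle (hE : SkeinFunctional a z E) (hz : IsUnit z) {n : ℕ} {f : Word → R}
    (hf : f ∈ tangleSpan E (n + 1)) :
    ∃ μ : R, act [cup (n + 1), cap (n + 1)] f = μ • f := by
  have t0 : IsTangle (n + 1) [] (n + 1) := by simp [IsTangle, Runs]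
  have t1 : IsTangle (n + 1) [cup (n + 1)] (n + 3) := by
    simp [IsTangle, Runs, Kind.ins, Kind.outs]
  have hp := hE.act_pos_kink (i := n) (.right) le_rfl hf
  have hn := hE.act_neg_kink (i := n) (.right) le_rfl hf
  have hs := congrArg (act [cap (n + 1)]) (hE.act_skein (i := n) (by omega) (act_mem_tangleSpan t1 hf))
  have z1 := Related.mid [] [cup n, cap (n + 1)] t0 (hE.zigzag_left (n := n + 1) n le_rfl) f hf
  have z2 := hE.zigzag_right (n := n + 1) n le_rfl f hf
  simp only [map_sub, map_smul, ← act_append] at hs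
  have hs' : act [cup (n + 1), pos n, cap (n + 1)] f - act [cup (n + 1), neg n, cap (n + 1)] f =
    z • (act [cup (n + 1), cap (n + 1)] f - act [cup (n + 1), cap n, cup n, cap (n + 1)] f) := hs
  have z3 : act [cup (n + 1), cap n, cup n, cap (n + 1)] f = f := z1.trans z2
  rw [hp, hn, z3] at hs'
  obtain ⟨u, rfl⟩ := hz
  refine ⟨((u⁻¹ : Rˣ) : R) * ((a : R) - ((a⁻¹ : Rˣ) : R)) + 1, ?_⟩
  rw [add_smul, mul_smul, sub_smul, hs', smul_smul, Units.inv_mul]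
  simp

end SkeinFunctional

/-! ### Uniqueness: reduction to layered tangles -/

section Uniqueness

variable {R : Type*} [CommRing R] {a : Rˣ} {z : R} {E : Word → R}

/-- The functionals that come from layered tangles: each new strand lies over the earlier ones. -/
def normalSpan (E : Word → R) : ℕ → Submodule R (Word → R)
  | 0 => Submodule.span R {E}
  -- A tangle without ends at the bottom has an even number of ends at the top.
  | 1 => ⊥
  | n + 2 => ⨆ p : {p : ℕ × ℕ // n = p.1 + p.2}, (normalSpan E n).map (act (star p.1.1 p.1.2))

theorem star_mem_normalSpan {n j k : ℕ} (h : n = j + k) {f : Word → R} (hf : f ∈ normalSpan E n) :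
    act (star j k) f ∈ normalSpan E (n + 2) :=
  Submodule.mem_iSup_of_mem (p := fun p : {p : ℕ × ℕ // n = p.1 + p.2} =>
    (normalSpan E n).map (act (star p.1.1 p.1.2))) ⟨(j, k), h⟩ (Submodule.mem_map_of_mem hf)

theorem normalSpan_closure {n : ℕ} {u : Word} {N : Submodule R (Word → R)}
    (h : ∀ j k, n = j + k → ∀ f ∈ normalSpan E n, act u (act (star j k) f) ∈ N) {f : Word → R}
    (hf : f ∈ normalSpan E (n + 2)) : act u f ∈ N := by
  have : normalSpan E (n + 2) ≤ N.comap (act u) := by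
    refine iSup_le fun p => ?_
    rintro _ ⟨g, hg, rfl⟩
    exact h _ _ p.2 g hg
  exact this hf

theorem normalSpan_le_tangleSpan (n : ℕ) : normalSpan E n ≤ tangleSpan E n := by
  induction n using Nat.twoStepInduction with
  | zero =>
    refine Submodule.span_le.2 ?_
    rintro _ rfl
    exact Submodule.subset_span ⟨[], ⟨rfl, by simp⟩, (act_nil _).symm⟩
  | one => exact bot_le
  | more n ih _ =>
    refine iSup_le fun p => ?_
    rintro _ ⟨g, hg, rfl⟩
    exact act_mem_tangleSpan (isTangle_star p.2) (ih hg)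

namespace SkeinFunctional

/-- A minimum at the far right is itself a new layer. Any other one can be moved below the latest
strand, either beside it or through its run of crossings, and then induction applies. -/
theorem cup_mem_normalSpan (hE : SkeinFunctional a z E) (n : ℕ) :
    ∀ i ≤ n, ∀ f ∈ normalSpan E n, act [cup i] f ∈ normalSpan E (n + 2) := by
  induction n using Nat.twoStepInduction with
  | zero =>
    intro i hi f hf
    obtain rfl : i = 0 := by omega
    exact star_mem_normalSpan (j := 0) (k := 0) rfl hf
  | one =>
    intro i hi f hf
    rw [(Submodule.mem_bot R).1 hf, map_zero]
    exact zero_mem _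
  | more n ih _ =>
    intro i hi f hf
    by_cases hin : i = n + 2
    · subst hin
      exact star_mem_normalSpan (j := n + 2) (k := 0) rfl hf
    refine normalSpan_closure (fun j k hjk g hg => ?_) hf
    have hg' := normalSpan_le_tangleSpan n hg
    rw [← act_append]
    rcases le_or_gt i j with hij | hij
    · obtain ⟨d, rfl⟩ := Nat.exists_eq_add_of_le hij
      have := hE.star_left (κ := .cup) (by simp) i d k hjk g hg'
      simp only [Kind.ins_cup, Kind.outs_cup, add_zero] at this
      rw [this, ← List.singleton_append, act_append]
      exact star_mem_normalSpan (by omega) (ih i (by omega) g hg)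
    · obtain ⟨d, rfl⟩ := Nat.exists_eq_add_of_le hij
      obtain ⟨e, rfl⟩ := Nat.exists_eq_add_of_le (show d ≤ k by omega)
      have := hE.star_under (κ := .cup) (by simp) j d e (n := n)
        (by simp only [Kind.ins_cup]; omega) g hg'
      simp only [Kind.ins_cup, Kind.outs_cup, add_zero] at this
      rw [show j.succ + d = j + d + 1 by omega, this, ← List.singleton_append, act_append]
      exact star_mem_normalSpan (by omega) (ih (j + d) (by omega) g hg)

/-- Crossings and maxima preserve the functionals of layered tangles with `n` ends. -/
structure Closed (E : Word → R) (n : ℕ) : Prop where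
  pos : ∀ i, i + 2 ≤ n → ∀ f ∈ normalSpan E n, act [pos i] f ∈ normalSpan E n
  neg : ∀ i, i + 2 ≤ n → ∀ f ∈ normalSpan E n, act [neg i] f ∈ normalSpan E n
  cap : ∀ i m, n = m + 2 → i ≤ m → ∀ f ∈ normalSpan E n, act [cap i] f ∈ normalSpan E m

theorem overRun_mem_normalSpan {n N : ℕ} (h : ∀ i < n, ∀ f ∈ normalSpan E N,
    act [RigidVertex.pos i] f ∈ normalSpan E N) {j k : ℕ} (hjk : j + k ≤ n) :
    ∀ f ∈ normalSpan E N, act (overRun j k) f ∈ normalSpan E N := by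
  induction k with
  | zero => exact fun f hf => hf
  | succ k ih =>
    intro f hf
    rw [overRun, ← List.singleton_append, act_append]
    exact ih (by omega) _ (h _ (by omega) f hf)

theorem mem_of_eq_smul {N : Submodule R (Word → R)} {f g : Word → R} {c : R}
    (h : f = c • g) (hg : g ∈ N) : f ∈ N := h ▸ N.smul_mem c hg

/-- With no strand beside the circle, `act_circle` does not apply directly. A non-empty continuation
starts with a minimum, which can be moved below the circle and supplies the strand; for the empty
continuation both sides vanish by the normalisation of `E`. This is where the values at the circle
and at the empty diagram enter. -/
theorem circle_mem_normalSpan (hE : SkeinFunctional a z E) (hz : IsUnit z) (n : ℕ) :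
    ∀ f ∈ normalSpan E n, act [RigidVertex.cup n, RigidVertex.cap n] f ∈ normalSpan E n := by
  intro f hf
  rcases n with _ | n
  · have t : IsTangle 0 [RigidVertex.cup 0] 2 := by
      simp [IsTangle, Runs, Kind.ins, Kind.outs]
    have hE' : E ∈ tangleSpan E 0 := normalSpan_le_tangleSpan 0 (Submodule.subset_span rfl)
    obtain ⟨μ, hμ⟩ := hE.act_circle hz (n := 1) (act_mem_tangleSpan t hE')
    have key : act [RigidVertex.cup 0, RigidVertex.cap 0] E = μ • E := by
      funext y
      by_cases hy : IsDiagram y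
      · by_cases hne : y = []
        · subst hne
          simp [act_apply, hE.empty, hE.unknot]
        · obtain ⟨y, rfl, -⟩ := hy.exists_cons hne
          have e1 := Related.mid [RigidVertex.cup 0] [] t
            (hE.exchange (κ := .cup) (τ := .cap) (by simp) (by simp) (n := 2) 0 0
              (by simp only [Kind.ins_cup, Kind.ins_cap]; omega)).symm _ hE'
          have e2 := Related.mid [] [RigidVertex.cap 2] (n := 0) (k := 0) ⟨rfl, by simp⟩
            (hE.exchange (κ := .cup) (τ := .cup) (by simp) (by simp) (n := 0) 0 0
              (by simp only [Kind.ins_cup]; omega)).symm _ hE'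
          have e3 : act [RigidVertex.cup 0, RigidVertex.cap 0, RigidVertex.cup 0] E =
              act [RigidVertex.cup 0, RigidVertex.cup 2, RigidVertex.cap 2] E := e1.trans e2
          rw [← act_append] at hμ
          exact congrFun (e3.trans hμ) y
      · have : ¬ IsDiagram ([RigidVertex.cup 0, RigidVertex.cap 0] ++ y) := by
          simpa [IsDiagram, Runs, Kind.ins, Kind.outs] using hy
        rw [act_apply, hE.zero _ this, Pi.smul_apply, hE.zero _ hy, smul_zero]
    obtain ⟨c, rfl⟩ := Submodule.mem_span_singleton.1 hf
    rw [map_smul, key, smul_comm]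
    exact Submodule.smul_mem _ _ hf
  · obtain ⟨μ, hμ⟩ := hE.act_circle hz (normalSpan_le_tangleSpan _ hf)
    exact mem_of_eq_smul hμ hf

/-- The maximum joins the left end of the latest strand to its left neighbour. Turning the last
crossing of the run past the maximum makes it a crossing of older strands, and the run becomes
shorter; a run of length zero is a zigzag. -/
theorem star_cap_pred_mem (hE : SkeinFunctional a z E) {n : ℕ} (hn : Closed E n) (j k : ℕ)
    (hjk : n = j + 1 + k) :
    ∀ f ∈ normalSpan E n, act (star (j + 1) k ++ [RigidVertex.cap j]) f ∈ normalSpan E n := by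
  induction k generalizing j with
  | zero =>
    intro f hf
    have := hE.zigzag_left (n := n) j (by omega) f (normalSpan_le_tangleSpan n hf)
    rw [show star (j + 1) 0 ++ [RigidVertex.cap j] = [RigidVertex.cup (j + 1), RigidVertex.cap j] from rfl,
      this]
    exact hf
  | succ k ih =>
    intro f hf
    have h1 := Related.append_left (isTangle_star (j := j + 2) (k := k) (n := n) (by omega))
      (hE.cap_neg (n := n + 2) j (by omega)).symm
    have h2 := (hE.star_left (κ := .neg) (by simp) j 0 k (n := n)
      (by simp only [Kind.ins]; omega)).append_right [RigidVertex.cap (j + 1)]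
    have h3 : act (star (j + 1) (k + 1) ++ [RigidVertex.cap j]) f =
        act ([RigidVertex.neg j] ++ (star (j + 1 + 1) k ++ [RigidVertex.cap (j + 1)])) f := by
      rw [star_succ, List.append_assoc]
      have h2' := h2 f (normalSpan_le_tangleSpan n hf)
      simp only [List.append_assoc] at h2'
      exact (h1 f (normalSpan_le_tangleSpan n hf)).trans h2'
    rw [h3, act_append]
    exact ih (j + 1) (by omega) _ (hn.neg j (by omega) f hf)

/-- The cases depend on which ends of the latest strand the maximum meets. If none, it slides below
that strand and acts on the older tangle. If both, it closes a circle. If the left end is joined to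
its left neighbour, the preceding lemma applies; to its right neighbour, the last crossing first
comes off as a curl. If the right end is joined to its neighbour, the first crossing comes off as a
curl and the rest of the run consists of crossings of older strands. -/
theorem cap_mem_normalSpan (hE : SkeinFunctional a z E) (hz : IsUnit z) {n : ℕ} (hn : Closed E n)
    {i : ℕ} (hi : i ≤ n) : ∀ f ∈ normalSpan E (n + 2), act [RigidVertex.cap i] f ∈ normalSpan E n := by
  intro f hf
  refine normalSpan_closure (fun j k hjk f hf => ?_) hf
  have hf' := normalSpan_le_tangleSpan n hf
  rw [← act_append]
  rcases lt_trichotomy (i + 1) j with hij | rfl | hij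
  · obtain ⟨d, rfl⟩ := Nat.exists_eq_add_of_le (show i + 2 ≤ j by omega)
    obtain ⟨m, rfl⟩ := Nat.exists_eq_add_of_le (show 2 ≤ n by omega)
    have := hE.star_left (κ := .cap) (by simp) i d k hjk f hf'
    simp only [Kind.ins_cap, show Kind.outs .cap = 0 from rfl, add_zero] at this
    rw [this, ← List.singleton_append, act_append, add_comm 2 m]
    exact star_mem_normalSpan (by omega) (hn.cap i m (by omega) (by omega) f hf)
  · exact hE.star_cap_pred_mem hn i k hjk f hf
  · rcases k with _ | k
    · obtain rfl : i = j := by omega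
      obtain rfl : n = i := by omega
      exact hE.circle_mem_normalSpan hz n f hf
    · rcases Nat.lt_or_ge j i with hji | hji
      · rcases Nat.lt_or_ge i n with hin | hin
        · obtain ⟨d, rfl⟩ := Nat.exists_eq_add_of_le (show j + 1 ≤ i by omega)
          obtain ⟨e, rfl⟩ := Nat.exists_eq_add_of_le (show d + 1 ≤ k by omega)
          obtain ⟨m, rfl⟩ := Nat.exists_eq_add_of_le (show 2 ≤ n by omega)
          have := hE.star_under (κ := .cap) (by simp) j d e (n := 2 + m)
            (by simp only [Kind.ins_cap]; omega) f hf'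
          simp only [Kind.ins_cap, show Kind.outs .cap = 0 from rfl, add_zero] at this
          rw [show j + 1 + d = j + d + 1 by omega, show d + 1 + e + 1 = d + 2 + e by omega, this,
            ← List.singleton_append, act_append, add_comm 2 m]
          exact star_mem_normalSpan (by omega) (hn.cap (j + d) m (by omega) (by omega) f hf)
        · obtain rfl : i = j + k + 1 + 0 := by omega
          have t : IsTangle n [RigidVertex.cup (j + k + 1), RigidVertex.pos (j + k)] (n + 2) := by
            simp [IsTangle, Runs, Kind.ins, Kind.outs]; omega
          have h1 := Related.append_left t (hE.overRun_right (κ := .cap) (by simp) j k 0 (n := n + 2)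
            (by simp only [Kind.ins_cap]; omega)) f hf'
          have h2 := hE.act_pos_kink (i := j + k) (n := n) .right (by omega) hf'
          have h3 : act (star j (k + 1) ++ [RigidVertex.cap (j + k + 1 + 0)]) f =
              act (overRun j k) ((a : R) • f) := by
            rw [← h2, ← act_append]
            exact h1
          rw [h3]
          exact overRun_mem_normalSpan (n := j + k) (fun i hi f hf => hn.pos i (by omega) f hf) le_rfl _
            (Submodule.smul_mem _ _ hf)
      · obtain rfl : i = j := by omega
        have h1 := hE.act_pos_cap (n := n + 2) i (by omega)
          (act_mem_tangleSpan (isTangle_star (j := i + 1) (k := k) (n := n) (by omega)) hf')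
        rw [← act_append, ← act_append] at h1
        rw [star_succ, List.append_assoc]
        exact mem_of_eq_smul h1 (hE.star_cap_pred_mem hn i k (by omega) f hf)

/-- Crossings that avoid the right end of the latest strand. One away from the left end slides below
the strand; one just to the left of it lengthens the run. One just to the right would repeat a
crossing of the run: the skein relation replaces it by its inverse, which cancels, and by terms with
a maximum and a minimum. -/
theorem pos_mem_normalSpan_of_lt (hE : SkeinFunctional a z E) (hz : IsUnit z) {n : ℕ}
    (hn : Closed E n) {i : ℕ} (hi : i < n) :
    ∀ f ∈ normalSpan E (n + 2), act [RigidVertex.pos i] f ∈ normalSpan E (n + 2) := by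
  intro f hf
  refine normalSpan_closure (fun j k hjk f hf => ?_) hf
  have hf' := normalSpan_le_tangleSpan n hf
  rw [← act_append]
  rcases lt_trichotomy (i + 1) j with hij | rfl | hij
  · obtain ⟨d, rfl⟩ := Nat.exists_eq_add_of_le (show i + 2 ≤ j by omega)
    have := hE.star_left (κ := .pos) (by simp) i d k hjk f hf'
    simp only [Kind.ins_pos, Kind.outs_pos] at this
    rw [this, ← List.singleton_append, act_append]
    exact star_mem_normalSpan (by omega) (hn.pos i (by omega) f hf)
  · rw [← star_succ]
    exact star_mem_normalSpan (by omega) hf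
  · rcases Nat.lt_or_ge j i with hji | hji
    · obtain ⟨d, rfl⟩ := Nat.exists_eq_add_of_le (show j + 1 ≤ i by omega)
      obtain ⟨e, rfl⟩ := Nat.exists_eq_add_of_le (show d + 2 ≤ k by omega)
      have := hE.star_under (κ := .pos) (by simp) j d e (n := n)
        (by simp only [Kind.ins_pos]; omega) f hf'
      simp only [Kind.ins_pos, Kind.outs_pos] at this
      rw [show j + 1 + d = j + d + 1 by omega, this, ← List.singleton_append, act_append]
      exact star_mem_normalSpan (by omega) (hn.pos (j + d) (by omega) f hf)
    · obtain rfl : i = j := by omega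
      obtain ⟨k, rfl⟩ := Nat.exists_eq_add_of_le' (show 1 ≤ k by omega)
      have hg : act (star i (k + 1)) f ∈ normalSpan E (n + 2) := star_mem_normalSpan (by omega) hf
      have h0 : act (star (i + 1) k) f ∈ normalSpan E (n + 2) := star_mem_normalSpan (by omega) hf
      have h1 := hE.act_skein (i := i) (n := n + 2) (by omega) (normalSpan_le_tangleSpan _ hg)
      have h2 : act [RigidVertex.neg i] (act (star i (k + 1)) f) = act (star (i + 1) k) f := by
        have := hE.cancel_pos_neg (n := n + 2) i (by omega) _ (normalSpan_le_tangleSpan _ h0)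
        rw [star_succ, act_append, ← act_append]
        exact this
      rw [act_append, sub_eq_iff_eq_add.1 h1, h2]
      refine add_mem (Submodule.smul_mem _ _ (sub_mem hg ?_)) h0
      exact hE.cup_mem_normalSpan n i (by omega) _ (hE.cap_mem_normalSpan hz hn (by omega) _ hg)

/-- The remaining crossing involves the right end. With an empty run it is a curl on the minimum.
Otherwise it slides down to the minimum and cancels the first crossing of the run after a turn,
leaving a minimum one place further left and crossings already treated. -/
theorem pos_mem_normalSpan (hE : SkeinFunctional a z E) (hz : IsUnit z) {n : ℕ} (hn : Closed E n)
    {i : ℕ} (hi : i ≤ n) :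
    ∀ f ∈ normalSpan E (n + 2), act [RigidVertex.pos i] f ∈ normalSpan E (n + 2) := by
  rcases hi.lt_or_eq with hi | rfl
  · exact hE.pos_mem_normalSpan_of_lt hz hn hi
  intro f hf
  refine normalSpan_closure (fun j k hjk f hf => ?_) hf
  have hf' := normalSpan_le_tangleSpan i hf
  rw [← act_append]
  rcases k with _ | k
  · obtain rfl : i = j := by omega
    have h1 := hE.act_cup_pos (n := i) i le_rfl hf'
    exact mem_of_eq_smul h1 (hE.cup_mem_normalSpan i i le_rfl f hf)
  · obtain rfl : i = j + k + 1 := by omega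
    have t : IsTangle (j + k + 1) [RigidVertex.cup (j + k + 1), RigidVertex.pos (j + k)]
        (j + k + 1 + 2) := by
      simp [IsTangle, Runs, Kind.ins, Kind.outs]
    have t' : IsTangle (j + k + 1) [RigidVertex.cup (j + k)] (j + k + 1 + 2) := by
      simp [IsTangle, Runs, Kind.ins, Kind.outs]
    have h1 := Related.append_left t (hE.overRun_right (κ := .pos) (by simp) j k 0
      (by simp only [Kind.ins_pos]; omega)) f hf'
    have h2 := Related.mid [] [RigidVertex.pos (j + k + 1)] (n := j + k + 1) (k := j + k + 1)
      ⟨rfl, by simp⟩ (hE.cup_pos (j + k) (by omega))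
    have h3 := Related.append_left t' (hE.cancel_neg_pos (j + k + 1) (by omega))
    have h4 := (h2.trans h3).append_right (overRun j k) f hf'
    have h5 : act (star j (k + 1) ++ [RigidVertex.pos (j + k + 1)]) f =
        act ([RigidVertex.cup (j + k)] ++ overRun j k) f := h1.trans h4
    rw [h5, act_append]
    exact overRun_mem_normalSpan (fun i hi => hE.pos_mem_normalSpan_of_lt hz hn hi) (by omega) _
      (hE.cup_mem_normalSpan _ _ (by omega) f hf)

/-- Induction on the number of ends in steps of two. Maxima come before negative crossings, which
are expressed by the skein relation through positive ones, a maximum and a minimum. -/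
theorem closed (hE : SkeinFunctional a z E) (hz : IsUnit z) (n : ℕ) : Closed E n := by
  induction n using Nat.twoStepInduction with
  | zero => exact ⟨fun i hi => by omega, fun i hi => by omega, fun i m h => by omega⟩
  | one => exact ⟨fun i hi => by omega, fun i hi => by omega, fun i m h => by omega⟩
  | more n hn _ =>
    have hpos : ∀ i, i + 2 ≤ n + 2 → ∀ f ∈ normalSpan E (n + 2),
        act [RigidVertex.pos i] f ∈ normalSpan E (n + 2) :=
      fun i hi => hE.pos_mem_normalSpan hz hn (by omega)
    have hcap : ∀ i ≤ n, ∀ f ∈ normalSpan E (n + 2), act [RigidVertex.cap i] f ∈ normalSpan E n :=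
      fun i hi => hE.cap_mem_normalSpan hz hn hi
    refine ⟨hpos, fun i hi f hf => ?_, fun i m hm hi => ?_⟩
    · have h1 := hE.act_skein hi (normalSpan_le_tangleSpan _ hf)
      rw [← sub_sub_cancel (act [RigidVertex.pos i] f) (act [RigidVertex.neg i] f), h1]
      refine sub_mem (hpos i hi f hf) (Submodule.smul_mem _ _ (sub_mem hf ?_))
      exact hE.cup_mem_normalSpan n i (by omega) _ (hcap i (by omega) f hf)
    · obtain rfl : m = n := by omega
      exact hcap i hi

theorem act_mem_normalSpan (hE : SkeinFunctional a z E) (hz : IsUnit z) {n m : ℕ} {u : Word}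
    (hu : IsTangle n u m) : ∀ f ∈ normalSpan E n, act u f ∈ normalSpan E m := by
  induction u generalizing n with
  | nil =>
    obtain rfl : n = m := hu.1
    exact fun f hf => hf
  | cons l u ih =>
    intro f hf
    obtain ⟨⟨h1, h2⟩, hv⟩ := hu
    rw [← List.singleton_append, act_append]
    refine ih ⟨h2, fun l hl => hv l (List.mem_cons_of_mem _ hl)⟩ _ ?_
    have hl := hv l (List.mem_cons_self)
    obtain ⟨κ, i⟩ := l
    have hn := hE.closed hz n
    cases κ with
    | cup => exact hE.cup_mem_normalSpan n i (by simpa [Kind.ins] using h1) f hf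
    | cap =>
      simp only [Kind.ins] at h1
      exact hn.cap i (n - 2) (by omega) (by omega) f hf
    | pos =>
      simp only [Kind.ins, Kind.outs] at h1 ⊢
      rw [Nat.sub_add_cancel (by omega)]
      exact hn.pos i h1 f hf
    | neg =>
      simp only [Kind.ins, Kind.outs] at h1 ⊢
      rw [Nat.sub_add_cancel (by omega)]
      exact hn.neg i h1 f hf
    | vertex => exact absurd rfl hl

/-- A closed link diagram acts on `E` by a scalar, since layered tangles without ends span only the
multiples of `E`. Evaluation at the empty continuation, where `E` vanishes, gives the claim. -/
theorem eq_zero (hE : SkeinFunctional a z E) (hz : IsUnit z) {w : Word} (hw : IsLinkDiagram w) :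
    E w = 0 := by
  have := hE.act_mem_normalSpan hz hw E (Submodule.subset_span rfl)
  obtain ⟨c, hc⟩ := Submodule.mem_span_singleton.1 this
  have := congrFun hc []
  simpa [act_apply, hE.empty] using this.symm

end SkeinFunctional

open Classical in
/-- The difference of two Dubrovnik polynomials, on non-empty link diagrams. -/
noncomputable def dubrovnikDifference (D D' : Word → R) (w : Word) : R :=
  if IsLinkDiagram w ∧ w ≠ [] then D w - D' w else 0

theorem isLinkDiagram_append_iff {x u y : Word} {n m : ℕ} (hx : IsTangle 0 x n)
    (hu : IsTangle n u m) : IsLinkDiagram (x ++ u ++ y) ↔ IsTangle m y 0 := by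
  constructor
  · rintro ⟨h1, h2⟩
    obtain ⟨k, h3, h4⟩ := runs_append.1 h1
    obtain rfl := runs_unique h3 (hx.append hu).1
    exact ⟨h4, fun l hl => h2 l (by simp [hl])⟩
  · exact fun h => (hx.append hu).append h

open Classical in
theorem dubrovnikDifference_append (D D' : Word → R) {x u : Word} {n m : ℕ} (hx : IsTangle 0 x n)
    (hne : x ≠ []) (hu : IsTangle n u m) (y : Word) :
    dubrovnikDifference D D' (x ++ u ++ y) =
      if IsTangle m y 0 then D (x ++ u ++ y) - D' (x ++ u ++ y) else 0 := by
  have : IsLinkDiagram (x ++ u ++ y) ∧ x ++ u ++ y ≠ [] ↔ IsTangle m y 0 := by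
    rw [isLinkDiagram_append_iff hx hu]
    simp [hne]
  rw [dubrovnikDifference]
  by_cases h : IsTangle m y 0
  · rw [if_pos (this.2 h), if_pos h]
  · rw [if_neg (fun h' => h (this.1 h')), if_neg h]

/-- Cutting off at the empty diagram is harmless: moves never relate it to a non-empty one, and in
the skein and curl relations the part `x` below the local picture is non-empty. For tangles, being a
link diagram depends only on the continuation `y`, so all terms of a relation are cut off together.
-/
theorem skeinFunctional_dubrovnikDifference {D D' : Word → R} (h : IsDubrovnik a z D)
    (h' : IsDubrovnik a z D') : SkeinFunctional a z (dubrovnikDifference D D') where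
  zero w hw := if_neg fun h => hw h.1.1
  empty := if_neg fun h => h.2 rfl
  unknot := by simp [dubrovnikDifference, h.unknot, h'.unknot]
  move {n m x u v} hx hu hv hm y := by
    by_cases hy : IsTangle m y 0
    · have h1 : IsLinkDiagram (x ++ u ++ y) := (isLinkDiagram_append_iff hx hu).2 hy
      have h2 : IsLinkDiagram (x ++ v ++ y) := (isLinkDiagram_append_iff hx hv).2 hy
      have hr : RegularIsotopic (x ++ u ++ y) (x ++ v ++ y) :=
        .rel _ _ ⟨h1.1, h2.1, x, u, v, y, hm, rfl, rfl⟩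
      have hiff := regularIsotopic_nil_iff h1.1 h2.1 hr
      rw [dubrovnikDifference, dubrovnikDifference, h.regular _ _ h1 h2 hr, h'.regular _ _ h1 h2 hr]
      by_cases hne : x ++ u ++ y = []
      · rw [if_neg (fun h => h.2 hne), if_neg (fun h => h.2 (hiff.1 hne))]
      · rw [if_pos ⟨h1, hne⟩, if_pos ⟨h2, fun h => hne (hiff.2 h)⟩]
    · rw [dubrovnikDifference, dubrovnikDifference,
        if_neg (fun h => hy ((isLinkDiagram_append_iff hx hu).1 h.1)),
        if_neg (fun h => hy ((isLinkDiagram_append_iff hx hv).1 h.1))]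
  skein {n i x} hx hi y := by
    have tp : IsTangle n [pos i] n := by simp [IsTangle, Runs, Kind.ins, Kind.outs]; omega
    have tn : IsTangle n [neg i] n := by simp [IsTangle, Runs, Kind.ins, Kind.outs]; omega
    have tc : IsTangle n [cap i, cup i] n := by simp [IsTangle, Runs, Kind.ins, Kind.outs]; omega
    have t0 : IsTangle n [] n := by simp [IsTangle, Runs]
    have hne : x ≠ [] := by
      rintro rfl
      have : 0 = n := hx.1
      omega
    have h0 := dubrovnikDifference_append D D' hx hne t0 y
    rw [List.append_nil] at h0
    rw [dubrovnikDifference_append D D' hx hne tp, dubrovnikDifference_append D D' hx hne tn,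
      dubrovnikDifference_append D D' hx hne tc, h0]
    by_cases hy : IsTangle n y 0
    · have hp := (isLinkDiagram_append_iff hx tp).2 hy
      simp only [if_pos hy]
      linear_combination h.skein x y i hp - h'.skein x y i hp
    · simp [hy]
  pos_kink {n i x u} hx hu hi y := by
    have tu : IsTangle n u n := by
      cases hu <;> simp [IsTangle, Runs, Kind.ins, Kind.outs] <;> omega
    have hne : x ≠ [] := by
      rintro rfl
      have : 0 = n := hx.1
      omega
    have t0 : IsTangle n [] n := by simp [IsTangle, Runs]
    have h0 := dubrovnikDifference_append D D' hx hne t0 y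
    rw [List.append_nil] at h0
    rw [dubrovnikDifference_append D D' hx hne tu, h0]
    by_cases hy : IsTangle n y 0
    · have hd := (isLinkDiagram_append_iff hx tu).2 hy
      simp only [if_pos hy]
      rw [h.pos_kink x u y i hu hd, h'.pos_kink x u y i hu hd, mul_sub]
    · simp [hy]
  neg_kink {n i x u} hx hu hi y := by
    have tu : IsTangle n u n := by
      cases hu <;> simp [IsTangle, Runs, Kind.ins, Kind.outs] <;> omega
    have hne : x ≠ [] := by
      rintro rfl
      have : 0 = n := hx.1
      omega
    have t0 : IsTangle n [] n := by simp [IsTangle, Runs]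
    have h0 := dubrovnikDifference_append D D' hx hne t0 y
    rw [List.append_nil] at h0
    rw [dubrovnikDifference_append D D' hx hne tu, h0]
    by_cases hy : IsTangle n y 0
    · have hd := (isLinkDiagram_append_iff hx tu).2 hy
      simp only [if_pos hy]
      rw [h.neg_kink x u y i hu hd, h'.neg_kink x u y i hu hd, mul_sub]
    · simp [hy]

/-- The axioms determine the Dubrovnik polynomial on non-empty link diagrams. -/
theorem IsDubrovnik.unique {D D' : Word → R} (hz : IsUnit z) (h : IsDubrovnik a z D)
    (h' : IsDubrovnik a z D') {w : Word} (hw : IsLinkDiagram w) (hne : w ≠ []) : D w = D' w := by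
  have := (skeinFunctional_dubrovnikDifference h h').eq_zero hz hw
  rw [dubrovnikDifference, if_pos ⟨hw, hne⟩] at this
  exact sub_eq_zero.1 this

theorem dubrovnik_eq (a : Rˣ) (hz : IsUnit ((a : R) - ((a⁻¹ : Rˣ) : R))) {w : Word}
    (hw : IsLinkDiagram w) (hne : w ≠ []) :
    dubrovnik a ((a : R) - ((a⁻¹ : Rˣ) : R)) w = evalAt a (halfStateSum true w) :=
  (Classical.epsilon_spec ⟨_, isDubrovnik_halfStateSum a⟩ :
    IsDubrovnik a ((a : R) - ((a⁻¹ : Rˣ) : R)) (dubrovnik a _)).unique hz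
    (isDubrovnik_halfStateSum a) hw hne

end Uniqueness

/-! ### Expansion over the replacements at the vertices -/

/-- A vertex of a picture as a vertex of the picture with one more layer at the bottom. -/
def Vertices.succ {w : Word} (l : Layer) (x : Vertices w) : Vertices (l :: w) := ⟨x.1.succ, x.2⟩

/-- The vertices of a picture whose lowest layer is not a vertex. -/
noncomputable def verticesEquiv {l : Layer} (h : l.kind ≠ .vertex) (w : Word) :
    Vertices w ≃ Vertices (l :: w) :=
  Equiv.ofBijective (Vertices.succ l) <| by
    constructor
    · intro x y hxy
      exact Subtype.ext (Fin.succ_injective _ (congrArg Subtype.val hxy))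
    · rintro ⟨k, hk⟩
      induction k using Fin.cases with
      | zero => exact absurd hk h
      | succ k => exact ⟨⟨k, hk⟩, rfl⟩

/-- The vertices of a picture whose lowest layer is a vertex. -/
noncomputable def verticesOptionEquiv {l : Layer} (h : l.kind = .vertex) (w : Word) :
    Option (Vertices w) ≃ Vertices (l :: w) :=
  Equiv.ofBijective (fun x => x.elim ⟨(0 : Fin (w.length + 1)), h⟩ (Vertices.succ l)) <| by
    constructor
    · rintro (_ | x) (_ | y) hxy
      · rfl
      · exact absurd (congrArg Subtype.val hxy) (Fin.succ_ne_zero _).symm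
      · exact absurd (congrArg Subtype.val hxy) (Fin.succ_ne_zero _)
      · exact congrArg some (Subtype.ext (Fin.succ_injective _ (congrArg Subtype.val hxy)))
    · rintro ⟨k, hk⟩
      induction k using Fin.cases with
      | zero => exact ⟨none, rfl⟩
      | succ k => exact ⟨some ⟨k, hk⟩, rfl⟩

theorem resolve_cons_of_ne {l : Layer} (h : l.kind ≠ .vertex) (w : Word)
    (m : Vertices (l :: w) → Marker) (s : Vertices (l :: w) → Replacement) :
    resolve (l :: w) m s = l :: resolve w (m ∘ Vertices.succ l) (s ∘ Vertices.succ l) := by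
  have e : List.finRange (l :: w).length = 0 :: (List.finRange w.length).map Fin.succ :=
    List.finRange_succ
  unfold resolve
  rw [e, List.flatMap_cons, List.flatMap_map, dif_neg (show ((l :: w).get (0 : Fin (w.length + 1))).kind ≠ .vertex from h)]
  rfl

theorem resolve_cons_of_eq {l : Layer} (h : l.kind = .vertex) (w : Word)
    (m : Vertices (l :: w) → Marker) (s : Vertices (l :: w) → Replacement) :
    resolve (l :: w) m s =
      replace l.place (m ⟨(0 : Fin (w.length + 1)), h⟩) (s ⟨(0 : Fin (w.length + 1)), h⟩) ++
        resolve w (m ∘ Vertices.succ l) (s ∘ Vertices.succ l) := by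
  have e : List.finRange (l :: w).length = 0 :: (List.finRange w.length).map Fin.succ :=
    List.finRange_succ
  unfold resolve
  rw [e, List.flatMap_cons, List.flatMap_map, dif_pos (show ((l :: w).get (0 : Fin (w.length + 1))).kind = .vertex from h)]
  rfl

theorem isTangle_replace {n i : ℕ} (h : i + 2 ≤ n) (m : Marker) (r : Replacement) :
    IsTangle n (replace i m r) n := by
  cases m <;> cases r <;> simp [replace, IsTangle, Runs, Kind.ins, Kind.outs] <;> omega

theorem isTangle_resolve {n k : ℕ} {w : Word} (h : Runs n w k) (m : Vertices w → Marker)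
    (s : Vertices w → Replacement) : IsTangle n (resolve w m s) k := by
  induction w generalizing n with
  | nil => exact ⟨h, by simp [resolve]⟩
  | cons l w ih =>
    by_cases hl : l.kind = .vertex
    · rw [resolve_cons_of_eq hl]
      obtain ⟨h1, h2⟩ := h
      simp only [hl, Kind.ins, Kind.outs] at h1 h2
      rw [Nat.sub_add_cancel (by omega)] at h2
      exact (isTangle_replace h1 _ _).append (ih h2 _ _)
    · rw [resolve_cons_of_ne hl]
      exact (isTangle_one hl h.1 rfl).append (ih h.2 _ _)

theorem sum_replacement {M : Type*} [AddCommMonoid M] (f : Replacement → M) :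
    ∑ r, f r = f .crossing + f .smoothA + f .smoothB := by
  rw [show (Finset.univ : Finset Replacement) = {.crossing, .smoothA, .smoothB} from rfl]
  simp [add_assoc]

/-- The coefficient of a replacement. -/
def replacementCoeff {R : Type*} [CommRing R] (A B : R) : Replacement → R
  | .crossing => 1
  | .smoothA => -A
  | .smoothB => -B

theorem prod_replacementCoeff {R : Type*} [CommRing R] (A B : R) {V : Type*} [Fintype V]
    (s : V → Replacement) :
    (-A) ^ Fintype.card {x // s x = .smoothA} * (-B) ^ Fintype.card {x // s x = .smoothB} =
      ∏ x, replacementCoeff A B (s x) := by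
  have : ∀ r, replacementCoeff A B r =
      (if r = .smoothA then -A else 1) * (if r = .smoothB then -B else 1) := by
    intro r
    cases r <;> simp [replacementCoeff]
  simp only [this, Finset.prod_mul_distrib, Finset.prod_ite, Finset.prod_const, Finset.prod_const_one,
    one_pow, mul_one, Fintype.card_subtype]

/-- For equal bits the crossing cancels the vertical smoothing, whatever the marker. For opposite
bits the swapped terms of the crossing and of maximum with minimum cancel, and the kept terms add up
to $-T-T^{-1}$. This uses $B = A^{-1}$ and $a = A$. -/
theorem sum_replace (m : Marker) (i : ℕ) (f : List Bool → ℤ[T;T⁻¹]) (b : List Bool)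
    (hb : i + 2 ≤ b.length) :
    ∑ r, replacementCoeff (T 1) (T (-1)) r * wordOp true (replace i m r) f b =
      (-T 1 - T (-1)) * layerOp false .vertex i f b := by
  rw [sum_replacement]
  induction i generalizing f b with
  | zero =>
    obtain ⟨x, y, b, rfl⟩ := exists_cons_two (by omega)
    cases m <;> cases x <;> cases y <;>
      simp [replace, replacementCoeff, wordOp_cons, layerOp_pos, layerOp_neg, layerOp_cap, layerOp_cup,
        layerOp_vertex] <;> ring
  | succ i ih =>
    obtain ⟨x, b, rfl⟩ := exists_cons_one (by omega : 1 ≤ b.length)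
    have := ih (fun b' => f (x :: b')) b (by simp at hb; omega)
    cases m <;>
      simp only [replace, wordOp_cons, wordOp_nil, mul_one, Module.End.mul_apply, Module.End.one_apply,
        layerOp_succ] at this ⊢ <;> exact this

theorem numVertices_cons_of_ne {l : Layer} (h : l.kind ≠ .vertex) (w : Word) :
    numVertices (l :: w) = numVertices w :=
  (Fintype.card_congr (verticesEquiv h w)).symm

theorem numVertices_cons_of_eq {l : Layer} (h : l.kind = .vertex) (w : Word) :
    numVertices (l :: w) = numVertices w + 1 :=
  (Fintype.card_congr (verticesOptionEquiv h w)).symm.trans Fintype.card_option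

/-- Induction on the layers. At a vertex the sum over replacements factors into its own three
choices and those above; linearity of the operators allows the inner sum to be taken first. -/
theorem sum_resolve {w : Word} {n k : ℕ} (hw : Runs n w k) (m : Vertices w → Marker)
    (f : List Bool → ℤ[T;T⁻¹]) (b : List Bool) (hb : b.length = n) :
    ∑ s : Vertices w → Replacement, (∏ x, replacementCoeff (T 1) (T (-1)) (s x)) *
        wordOp true (resolve w m s) f b =
      (-T 1 - T (-1)) ^ numVertices w * wordOp false w f b := by
  induction w generalizing n b with
  | nil =>
    have : IsEmpty (Vertices []) := ⟨fun x => x.1.elim0⟩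
    simp [resolve, numVertices]
  | cons l w ih =>
    subst hb
    by_cases hl : l.kind = .vertex
    · let e : Replacement × (Vertices w → Replacement) ≃ (Vertices (l :: w) → Replacement) :=
        (Equiv.piOptionEquivProd (β := fun _ => Replacement)).symm.trans
          ((verticesOptionEquiv hl w).arrowCongr (Equiv.refl _))
      have e0 : ∀ r s, e (r, s) ⟨(0 : Fin (w.length + 1)), hl⟩ = r := fun r s => by
        have : (verticesOptionEquiv hl w).symm ⟨(0 : Fin (w.length + 1)), hl⟩ = none :=
          (Equiv.symm_apply_eq _).2 rfl
        simp only [e, Equiv.trans_apply, Equiv.arrowCongr_apply, Function.comp_apply, this]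
        rfl
      have e1 : ∀ r s x, e (r, s) (Vertices.succ l x) = s x := fun r s x => by
        have : (verticesOptionEquiv hl w).symm (Vertices.succ l x) = some x :=
          (Equiv.symm_apply_eq _).2 rfl
        simp only [e, Equiv.trans_apply, Equiv.arrowCongr_apply, Function.comp_apply, this]
        rfl
      have e2 : ∀ (g : Vertices (l :: w) → ℤ[T;T⁻¹]),
          ∏ x, g x = g ⟨(0 : Fin (w.length + 1)), hl⟩ * ∏ x, g (Vertices.succ l x) := fun g => by
        rw [← (verticesOptionEquiv hl w).prod_comp, Fintype.prod_option]
        rfl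
      obtain ⟨h1, h2⟩ := hw
      simp only [hl, Kind.ins, Kind.outs] at h1 h2
      rw [Nat.sub_add_cancel (by omega)] at h2
      have e3 : ∀ r s, e (r, s) ∘ Vertices.succ l = s := fun r s => funext (e1 r s)
      rw [← e.sum_comp, Fintype.sum_prod_type]
      simp only [e2, resolve_cons_of_eq hl, e0, e1, e3, wordOp_append, Module.End.mul_apply, mul_assoc,
        ← Finset.mul_sum]
      have e4 : ∀ r, ∑ s : Vertices w → Replacement, (∏ x, replacementCoeff (T 1) (T (-1)) (s x)) *
          wordOp true (replace l.place (m ⟨(0 : Fin (w.length + 1)), hl⟩) r)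
            (wordOp true (resolve w (m ∘ Vertices.succ l) s) f) b =
          (-T 1 - T (-1)) ^ numVertices w *
            wordOp true (replace l.place (m ⟨(0 : Fin (w.length + 1)), hl⟩) r)
              (wordOp false w f) b := by
        intro r
        have : ∀ (c : ℤ[T;T⁻¹]) (u : Word) (g : List Bool → ℤ[T;T⁻¹]),
            c * wordOp true u g b = wordOp true u (c • g) b := fun c u g => by
          rw [map_smul, Pi.smul_apply, smul_eq_mul]
        simp only [this]
        rw [← Finset.sum_apply, ← map_sum]
        refine wordOp_congr (isTangle_replace h1 _ _).1 rfl fun b' hb' => ?_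
        simpa [Finset.sum_apply] using ih h2 (m ∘ Vertices.succ l) b' hb'
      simp only [e4]
      simp only [mul_left_comm _ ((-T 1 - T (-1)) ^ numVertices w), ← Finset.mul_sum]
      rw [sum_replace _ _ _ _ h1, numVertices_cons_of_eq hl, wordOp_cons, hl, pow_succ, mul_assoc]
      rfl
    · let e : (Vertices w → Replacement) ≃ (Vertices (l :: w) → Replacement) :=
        (verticesEquiv hl w).arrowCongr (Equiv.refl _)
      have e1 : ∀ s x, e s (Vertices.succ l x) = s x := fun s x => by
        have : (verticesEquiv hl w).symm (Vertices.succ l x) = x :=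
          (Equiv.symm_apply_eq _).2 rfl
        simp only [e, Equiv.arrowCongr_apply, Function.comp_apply, this]
        rfl
      have e2 : ∀ (g : Vertices (l :: w) → ℤ[T;T⁻¹]),
          ∏ x, g x = ∏ x, g (Vertices.succ l x) := fun g => by
        rw [← (verticesEquiv hl w).prod_comp]
        rfl
      have e3 : ∀ s, e s ∘ Vertices.succ l = s := fun s => funext (e1 s)
      -- The parameter `s` affects vertices only.
      have e5 : ∀ g, layerOp true l.kind l.place g b = layerOp false l.kind l.place g b := by
        have : ∀ i b, successors true l.kind i b = successors false l.kind i b := by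
          intro i
          induction i with
          | zero =>
            intro b
            rcases h : l.kind <;> first | exact absurd h hl | rcases b with _ | ⟨x, _ | ⟨y, b⟩⟩ <;> rfl
          | succ i ih =>
            intro b
            rcases b with _ | ⟨x, b⟩
            · rfl
            · simp only [successors, ih]
        intro g
        rw [layerOp_apply, layerOp_apply, this]
      rw [← e.sum_comp]
      simp only [e2, resolve_cons_of_ne hl, e1, e3, wordOp_cons, Module.End.mul_apply, e5]
      have : ∀ (c : ℤ[T;T⁻¹]) (g : List Bool → ℤ[T;T⁻¹]),
          c * layerOp false l.kind l.place g b = layerOp false l.kind l.place (c • g) b := fun c g => by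
        rw [map_smul, Pi.smul_apply, smul_eq_mul]
      simp only [this]
      rw [← Finset.sum_apply, ← map_sum]
      refine layerOp_congr hw.1 fun b' hb' => ?_
      simpa [Finset.sum_apply, numVertices_cons_of_ne hl] using ih hw.2 (m ∘ Vertices.succ l) b' hb'

theorem resolve_ne_nil {w : Word} (hw : IsDiagram w) (hne : w ≠ []) (m : Vertices w → Marker)
    (s : Vertices w → Replacement) : resolve w m s ≠ [] := by
  obtain ⟨w, rfl, -⟩ := hw.exists_cons hne
  rw [resolve_cons_of_ne (by simp)]
  simp

theorem kauffmanVogel_eq {R : Type*} [CommRing R] (A : Rˣ)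
    (hA : IsUnit ((A : R) - ((A⁻¹ : Rˣ) : R))) {w : Word} (hw : IsDiagram w) (hne : w ≠ [])
    (m : Vertices w → Marker) :
    kauffmanVogel (A : R) ((A⁻¹ : Rˣ) : R) A w m =
      evalAt A ((-T 1 - T (-1)) ^ numVertices w * halfStateSum false w) := by
  have key : ∑ s : Vertices w → Replacement, (∏ x, replacementCoeff (T 1) (T (-1)) (s x)) *
      halfStateSum true (resolve w m s) =
        (-T 1 - T (-1)) ^ numVertices w * halfStateSum false w := by
    apply mul_left_cancel₀ two_ne_zero_laurent
    rw [mul_left_comm, two_mul_halfStateSum false hw hne, Finset.mul_sum]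
    simp only [mul_left_comm (2 : ℤ[T;T⁻¹])]
    rw [stateSum, stateSumFrom, ← sum_resolve hw m _ [] rfl]
    refine Finset.sum_congr rfl fun s _ => ?_
    rw [two_mul_halfStateSum true (isTangle_resolve hw m s).1 (resolve_ne_nil hw hne m s)]
    rfl
  rw [← key, map_sum, kauffmanVogel]
  refine Finset.sum_congr rfl fun s _ => ?_
  rw [dubrovnik_eq A hA (isTangle_resolve hw m s) (resolve_ne_nil hw hne m s), map_mul, map_prod,
    prod_replacementCoeff]
  congr 1
  refine Finset.prod_congr rfl fun x _ => ?_
  cases s x <;> simp [replacementCoeff, evalAt_T]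

/-! ### States as directions at the points of a diagram -/

theorem eq_of_getD_eq {b c : List Bool} (h : b.length = c.length)
    (h' : ∀ j, b.getD j false = c.getD j false) : b = c := by
  refine List.ext_getElem h fun j hj hj' => ?_
  have := h' j
  rwa [List.getD_eq_getElem _ _ hj, List.getD_eq_getElem _ _ hj'] at this

/-- The condition on the bits at the lower ends `x`, `y` and the upper ends `x'`, `y'` of a piece. -/
def LocalRule (s : Bool) : Kind → Bool → Bool → Bool → Bool → Prop
  | .cup, _, _, x', y' => x' ≠ y'
  | .cap, x, y, _, _ => x ≠ y
  | .vertex, x, y, x', y' => if s then x' = y ∧ y' = x else x ≠ y ∧ x' = x ∧ y' = y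
  | _, x, y, x', y' => x' = y ∧ y' = x

/-- Bits beyond the ends of a list read as `false` on both sides, so the shift condition can be
stated for all `j`; the length condition then recovers the list. -/
theorem mem_successors_iff (s : Bool) (κ : Kind) (i : ℕ) {b b' : List Bool}
    (hb : i + κ.ins ≤ b.length) :
    b' ∈ successors s κ i b ↔
      b'.length = b.length - κ.ins + κ.outs ∧ (∀ j < i, b'.getD j false = b.getD j false) ∧
      (∀ j, i ≤ j → b'.getD (j + κ.outs) false = b.getD (j + κ.ins) false) ∧
      LocalRule s κ (b.getD i false) (b.getD (i + 1) false) (b'.getD i false)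
        (b'.getD (i + 1) false) := by
  induction i generalizing b b' with
  | zero =>
    cases κ with
    | cup =>
      constructor
      · intro h
        simp only [successors, Finset.mem_insert, Finset.mem_singleton] at h
        rcases h with rfl | rfl <;> simp [Kind.ins, Kind.outs, LocalRule]
      · rintro ⟨h1, -, h2, h3⟩
        simp only [Kind.ins, Kind.outs, Nat.sub_zero] at h1
        obtain ⟨x, y, c, rfl⟩ := exists_cons_two (b := b') (by omega)
        have : c = b := by
          refine eq_of_getD_eq (by simpa using h1) fun j => ?_
          simpa [Kind.ins, Kind.outs] using h2 j (Nat.zero_le _)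
        subst this
        cases x <;> cases y <;> simp_all [successors, LocalRule]
    | cap =>
      obtain ⟨x, y, c, rfl⟩ := exists_cons_two (b := b) (by simpa [Kind.ins] using hb)
      simp only [successors]
      constructor
      · intro h
        split_ifs at h with hxy
        · simp at h
        · rw [Finset.mem_singleton] at h
          subst h
          simpa [Kind.ins, Kind.outs, LocalRule] using hxy
      · rintro ⟨h1, -, h2, h3⟩
        rw [if_neg (by simpa [LocalRule] using h3), Finset.mem_singleton]
        refine eq_of_getD_eq (by simpa [Kind.ins, Kind.outs] using h1) fun j => ?_
        simpa [Kind.ins, Kind.outs] using h2 j (Nat.zero_le _)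
    | _ =>
      obtain ⟨x, y, c, rfl⟩ := exists_cons_two (b := b) (by simpa [Kind.ins] using hb)
      simp only [successors]
      constructor
      · intro h
        (try split_ifs at h) <;> simp_all [Kind.ins, Kind.outs, LocalRule]
      · rintro ⟨h1, -, h2, h3⟩
        simp only [Kind.ins, Kind.outs, List.length_cons] at h1
        obtain ⟨x', y', c', rfl⟩ := exists_cons_two (b := b') (by omega)
        have : c' = c := by
          refine eq_of_getD_eq (by simpa using h1) fun j => ?_
          simpa [Kind.ins, Kind.outs] using h2 j (Nat.zero_le _)
        subst this
        (try split_ifs) <;> simp_all [LocalRule]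
  | succ i ih =>
    obtain ⟨x, c, rfl⟩ := exists_cons_one (b := b) (by omega)
    have hc : i + κ.ins ≤ c.length := by simp at hb; omega
    simp only [successors, Finset.mem_map, Function.Embedding.coeFn_mk]
    constructor
    · rintro ⟨c', hc', rfl⟩
      obtain ⟨h1, h2, h3, h4⟩ := (ih hc).1 hc'
      refine ⟨by simp; omega, fun j hj => ?_, fun j hj => ?_, by simpa using h4⟩
      · rcases j with _ | j
        · rfl
        · simpa using h2 j (by omega)
      · obtain ⟨j, rfl⟩ := Nat.exists_eq_add_of_le' (show 1 ≤ j by omega)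
        have := h3 j (by omega)
        rw [add_right_comm, add_right_comm j 1]
        simpa using this
    · rintro ⟨h1, h2, h3, h4⟩
      have h0 : 1 ≤ b'.length := by simp at h1 hb; omega
      obtain ⟨x', c', rfl⟩ := exists_cons_one h0
      obtain rfl : x' = x := by simpa using h2 0 (by omega)
      refine ⟨c', (ih hc).2 ⟨by simp at h1; omega, fun j hj => ?_, fun j hj => ?_, by simpa using h4⟩,
        rfl⟩
      · simpa using h2 (j + 1) (by omega)
      · have := h3 (j + 1) (by omega)
        rw [add_right_comm, add_right_comm j 1] at this
        simpa using this

/-- The sequences of bits on the levels of a picture, from the bits `b` at the bottom to no bits at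
the top. -/
def paths (s : Bool) : Word → List Bool → Finset (List (List Bool))
  | [], b => if b = [] then {[[]]} else ∅
  | l :: w, b => (successors s l.kind l.place b).biUnion fun b' =>
      (paths s w b').map ⟨List.cons b, List.cons_injective⟩

/-- The total sign of the crossings. -/
def pathSign : Word → List (List Bool) → ℤ
  | l :: w, b :: L => layerSign l.kind l.place b + pathSign w L
  | _, _ => 0

theorem head_of_mem_paths {s : Bool} {w : Word} {b : List Bool} {L : List (List Bool)}
    (h : L ∈ paths s w b) : L.getD 0 [] = b := by
  cases w with
  | nil =>
    simp only [paths] at h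
    split_ifs at h with hb
    · simp_all
    · simp at h
  | cons l w =>
    simp only [paths, Finset.mem_biUnion, Finset.mem_map] at h
    obtain ⟨_, _, _, _, rfl⟩ := h
    rfl

theorem stateSumFrom_eq_sum_paths (s : Bool) (w : Word) (b : List Bool) :
    stateSumFrom s w b = ∑ L ∈ paths s w b, T (pathSign w L) := by
  induction w generalizing b with
  | nil =>
    simp only [stateSumFrom, wordOp_nil, Module.End.one_apply, paths]
    split_ifs <;> simp [pathSign]
  | cons l w ih =>
    have h : stateSumFrom s (l :: w) b = layerOp s l.kind l.place (stateSumFrom s w) b := by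
      rw [stateSumFrom, wordOp_cons]
      rfl
    rw [h, layerOp_apply, paths, Finset.sum_biUnion, Finset.mul_sum]
    · refine Finset.sum_congr rfl fun b' _ => ?_
      rw [ih, Finset.sum_map, Finset.mul_sum]
      exact Finset.sum_congr rfl fun L _ => by rw [← T_add]; rfl
    · intro b' _ b'' _ hne
      refine Finset.disjoint_left.2 fun L hL hL' => hne ?_
      obtain ⟨L', h1, rfl⟩ := Finset.mem_map.1 hL
      obtain ⟨L'', h2, h3⟩ := Finset.mem_map.1 hL'
      obtain rfl : L'' = L' := by simpa using h3
      exact (head_of_mem_paths h1).symm.trans (head_of_mem_paths h2)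

theorem mem_paths_iff (s : Bool) (w : Word) (b : List Bool) (L : List (List Bool)) :
    L ∈ paths s w b ↔ L.length = w.length + 1 ∧ L.getD 0 [] = b ∧ L.getD w.length [] = [] ∧
      ∀ k l, w[k]? = some l → L.getD (k + 1) [] ∈ successors s l.kind l.place (L.getD k []) := by
  induction w generalizing b L with
  | nil =>
    simp only [paths]
    constructor
    · intro h
      split_ifs at h with hb
      · simp_all
      · simp at h
    · rintro ⟨h1, rfl, h3, -⟩
      obtain ⟨c, rfl⟩ := List.length_eq_one_iff.1 h1
      simp_all
  | cons l w ih =>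
    simp only [paths, Finset.mem_biUnion, Finset.mem_map, Function.Embedding.coeFn_mk]
    constructor
    · rintro ⟨b', hb', L, hL, rfl⟩
      obtain ⟨h1, h2, h3, h4⟩ := (ih b' L).1 hL
      refine ⟨by simp [h1], rfl, by simpa using h3, fun k l' hk => ?_⟩
      rcases k with _ | k
      · obtain rfl : l = l' := by simpa using hk
        rw [← h2] at hb'
        exact hb'
      · exact h4 k l' (by simpa using hk)
    · rintro ⟨h1, rfl, h3, h4⟩
      rcases L with _ | ⟨b, L⟩
      · simp at h1
      · exact ⟨_, h4 0 l rfl, L, (ih _ L).2 ⟨by simpa using h1, rfl, by simpa using h3,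
          fun k l' hk => h4 (k + 1) l' (by simpa using hk)⟩, rfl⟩

theorem foldl_width_eq {n m : ℕ} {w : Word} (h : Runs n w m) :
    w.foldl (fun n l => n - l.kind.ins + l.kind.outs) n = m := by
  induction w generalizing n with
  | nil => exact h
  | cons l w ih => exact ih h.2

theorem IsDiagram.runs_drop {w : Word} (h : IsDiagram w) (k : ℕ) :
    Runs (widthAt w k) (w.drop k) 0 := by
  rw [IsDiagram, ← List.take_append_drop k w] at h
  obtain ⟨j, h1, h2⟩ := runs_append.1 h
  rw [widthAt, foldl_width_eq h1]
  exact h2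

theorem drop_eq_cons {w : Word} {k : ℕ} {l : Layer} (h : w[k]? = some l) :
    w.drop k = l :: w.drop (k + 1) := by
  obtain ⟨hk, rfl⟩ := List.getElem?_eq_some_iff.1 h
  exact List.drop_eq_getElem_cons hk

theorem IsDiagram.place_le {w : Word} (hw : IsDiagram w) {k : ℕ} {l : Layer} (h : w[k]? = some l) :
    l.place + l.kind.ins ≤ widthAt w k := by
  have := hw.runs_drop k
  rw [drop_eq_cons h] at this
  exact this.1

theorem widthAt_succ {w : Word} {k : ℕ} {l : Layer} (h : w[k]? = some l) :
    widthAt w (k + 1) = widthAt w k - l.kind.ins + l.kind.outs := by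
  rw [widthAt, List.take_add_one, h, List.foldl_append]
  rfl

theorem IsDiagram.widthAt_length {w : Word} (hw : IsDiagram w) : widthAt w w.length = 0 := by
  have := hw.runs_drop w.length
  rw [List.drop_length] at this
  exact this

/-- The bit at a point. -/
def bitAt (L : List (List Bool)) (p : ℕ × ℕ) : Bool := (L.getD p.1 []).getD p.2 false

theorem length_of_mem_paths {s : Bool} {w : Word} (hw : IsDiagram w) {L : List (List Bool)}
    (hL : L ∈ paths s w []) (k : ℕ) (hk : k ≤ w.length) : (L.getD k []).length = widthAt w k := by
  obtain ⟨h1, h2, h3, h4⟩ := (mem_paths_iff _ _ _ _).1 hL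
  induction k with
  | zero => rw [h2]; rfl
  | succ k ih =>
    have hl : w[k]? = some w[k] := List.getElem?_eq_getElem (by omega)
    have ih' := ih (by omega)
    rw [length_of_mem_successors (by rw [ih']; exact hw.place_le hl) (h4 k _ hl), ih',
      widthAt_succ hl]

/-- `Link s w p q c`: the points `p` and `q` are adjacent, and their bits differ if and only if `c`. -/
inductive Link (s : Bool) (w : Word) : ℕ × ℕ → ℕ × ℕ → Bool → Prop
  | left (k j : ℕ) (l : Layer) (h : w[k]? = some l) (hj : j < l.place) :
      Link s w (k, j) (k + 1, j) false
  | right (k j : ℕ) (l : Layer) (h : w[k]? = some l) (hj : l.place ≤ j) :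
      Link s w (k, j + l.kind.ins) (k + 1, j + l.kind.outs) false
  | slope_right (k : ℕ) (l : Layer) (h : w[k]? = some l) (hl : l.kind.IsNode) :
      Link s w (k, l.place) (k + 1, l.place + 1) (!s && decide (l.kind = .vertex))
  | slope_left (k : ℕ) (l : Layer) (h : w[k]? = some l) (hl : l.kind.IsNode) :
      Link s w (k, l.place + 1) (k + 1, l.place) (!s && decide (l.kind = .vertex))
  | cup (k i : ℕ) (h : w[k]? = some ⟨.cup, i⟩) : Link s w (k + 1, i) (k + 1, i + 1) true
  | cap (k i : ℕ) (h : w[k]? = some ⟨.cap, i⟩) : Link s w (k, i) (k, i + 1) true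
  | meet (hs : s = false) (k i : ℕ) (h : w[k]? = some ⟨.vertex, i⟩) :
      Link s w (k, i) (k, i + 1) true

/-- The bits of a state: they vanish outside of the diagram and satisfy the conditions at the layers. -/
structure IsState (s : Bool) (w : Word) (σ : ℕ × ℕ → Bool) : Prop where
  support : ∀ p, p ∉ points w → σ p = false
  link : ∀ p q c, Link s w p q c → (σ p ^^ σ q) = c

theorem xor_eq_false_iff (x y : Bool) : (x ^^ y) = false ↔ y = x := by
  cases x <;> cases y <;> simp

/-- The rule for the layers in terms of links. -/
theorem links_iff (s : Bool) (w : Word) (σ : ℕ × ℕ → Bool) :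
    (∀ p q c, Link s w p q c → (σ p ^^ σ q) = c) ↔
      ∀ k l, w[k]? = some l → (∀ j < l.place, σ (k + 1, j) = σ (k, j)) ∧
        (∀ j, l.place ≤ j → σ (k + 1, j + l.kind.outs) = σ (k, j + l.kind.ins)) ∧
        LocalRule s l.kind (σ (k, l.place)) (σ (k, l.place + 1)) (σ (k + 1, l.place))
          (σ (k + 1, l.place + 1)) := by
  constructor
  · intro h k l hl
    refine ⟨fun j hj => ?_, fun j hj => ?_, ?_⟩
    · exact (xor_eq_false_iff _ _).1 (h _ _ _ (.left k j l hl hj))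
    · exact (xor_eq_false_iff _ _).1 (h _ _ _ (.right k j l hl hj))
    · obtain ⟨κ, i⟩ := l
      cases κ with
      | cup => simpa [LocalRule] using h _ _ _ (.cup k i hl)
      | cap => simpa [LocalRule] using h _ _ _ (.cap k i hl)
      | pos =>
        have h1 := h _ _ _ (.slope_right k _ hl (.inl rfl))
        have h2 := h _ _ _ (.slope_left k _ hl (.inl rfl))
        simp_all [LocalRule]
      | neg =>
        have h1 := h _ _ _ (.slope_right k _ hl (.inr (.inl rfl)))
        have h2 := h _ _ _ (.slope_left k _ hl (.inr (.inl rfl)))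
        simp_all [LocalRule]
      | vertex =>
        have h1 := h _ _ _ (.slope_right k _ hl (.inr (.inr rfl)))
        have h2 := h _ _ _ (.slope_left k _ hl (.inr (.inr rfl)))
        cases s with
        | true => simp_all [LocalRule]
        | false =>
          have h3 := h _ _ _ (.meet rfl k i hl)
          simp only [LocalRule] at h1 h2 h3 ⊢
          revert h1 h2 h3
          cases σ (k, i) <;> cases σ (k, i + 1) <;> cases σ (k + 1, i) <;>
            cases σ (k + 1, i + 1) <;> simp
  · intro h p q c hc
    cases hc with
    | left k j l hl hj => exact (xor_eq_false_iff _ _).2 ((h k l hl).1 j hj)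
    | right k j l hl hj => exact (xor_eq_false_iff _ _).2 ((h k l hl).2.1 j hj)
    | slope_right k l hl hn =>
      have := (h k l hl).2.2
      obtain ⟨κ, i⟩ := l
      rcases hn with rfl | rfl | rfl
      · simp [this.1, this.2]
      · simp [this.1, this.2]
      · simp only [LocalRule] at this ⊢
        cases s <;> revert this <;> cases σ (k, i) <;> cases σ (k, i + 1) <;> cases σ (k + 1, i) <;>
            cases σ (k + 1, i + 1) <;> simp
    | slope_left k l hl hn =>
      have := (h k l hl).2.2
      obtain ⟨κ, i⟩ := l
      rcases hn with rfl | rfl | rfl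
      · simp [this.1, this.2]
      · simp [this.1, this.2]
      · simp only [LocalRule] at this ⊢
        cases s <;> revert this <;> cases σ (k, i) <;> cases σ (k, i + 1) <;> cases σ (k + 1, i) <;>
            cases σ (k + 1, i + 1) <;> simp
    | cup k i hl => simpa [LocalRule] using (h k _ hl).2.2
    | cap k i hl => simpa [LocalRule] using (h k _ hl).2.2
    | meet hs k i hl =>
      have := (h k _ hl).2.2
      subst hs
      simp [LocalRule] at this
      simpa using this.1

theorem isState_bitAt {s : Bool} {w : Word} (hw : IsDiagram w) {L : List (List Bool)}
    (hL : L ∈ paths s w []) : IsState s w (bitAt L) where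
  support := by
    rintro ⟨k, j⟩ hp
    have h1 := ((mem_paths_iff _ _ _ _).1 hL).1
    by_cases hk : k ≤ w.length
    · have := length_of_mem_paths hw hL k hk
      refine List.getD_eq_default _ _ ?_
      rw [this]
      by_contra hj
      exact hp ⟨hk, by simpa using hj⟩
    · rw [bitAt, List.getD_eq_default L _ (by simp; omega)]
      rfl
  link := by
    rw [links_iff]
    intro k l hl
    have hk : k < w.length := (List.getElem?_eq_some_iff.1 hl).1
    have h4 := ((mem_paths_iff _ _ _ _).1 hL).2.2.2 k l hl
    have hlen := length_of_mem_paths hw hL k hk.le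
    rw [mem_successors_iff _ _ _ (by rw [hlen]; exact hw.place_le hl)] at h4
    exact h4.2

/-- The sequence of bits on the levels that belongs to bits on the points. -/
def levels (w : Word) (σ : ℕ × ℕ → Bool) : List (List Bool) :=
  (List.range (w.length + 1)).map fun k => (List.range (widthAt w k)).map fun j => σ (k, j)

theorem getD_levels (w : Word) (σ : ℕ × ℕ → Bool) {k : ℕ} (hk : k ≤ w.length) :
    (levels w σ).getD k [] = (List.range (widthAt w k)).map fun j => σ (k, j) := by
  have : k < (levels w σ).length := by simp [levels]; omega
  rw [List.getD_eq_getElem _ _ this]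
  simp [levels]

theorem bitAt_levels {s : Bool} {w : Word} {σ : ℕ × ℕ → Bool} (hσ : IsState s w σ) :
    bitAt (levels w σ) = σ := by
  funext ⟨k, j⟩
  by_cases hk : k ≤ w.length
  · rw [bitAt, getD_levels w σ hk]
    by_cases hj : j < widthAt w k
    · rw [List.getD_eq_getElem _ _ (by simpa using hj)]
      simp
    · rw [List.getD_eq_default _ _ (by simpa using hj)]
      exact (hσ.support _ fun h => hj h.2).symm
  · rw [bitAt, List.getD_eq_default (levels w σ) _ (by simp [levels]; omega)]
    exact (hσ.support _ fun h => hk h.1).symm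

theorem levels_mem_paths {s : Bool} {w : Word} (hw : IsDiagram w) {σ : ℕ × ℕ → Bool}
    (hσ : IsState s w σ) : levels w σ ∈ paths s w [] := by
  rw [mem_paths_iff]
  refine ⟨by simp [levels], ?_, ?_, fun k l hl => ?_⟩
  · rw [getD_levels w σ (Nat.zero_le _)]
    rfl
  · rw [getD_levels w σ le_rfl, hw.widthAt_length]
    rfl
  · have hk : k < w.length := (List.getElem?_eq_some_iff.1 hl).1
    have hlen : ((levels w σ).getD k []).length = widthAt w k := by
      rw [getD_levels w σ hk.le]; simp
    have hlen' : ((levels w σ).getD (k + 1) []).length = widthAt w (k + 1) := by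
      rw [getD_levels w σ hk]; simp
    rw [mem_successors_iff _ _ _ (by rw [hlen]; exact hw.place_le hl)]
    refine ⟨by rw [hlen, hlen', widthAt_succ hl], ?_⟩
    have := (links_iff s w (bitAt (levels w σ))).1 (by rw [bitAt_levels hσ]; exact hσ.link) k l hl
    exact this

theorem bitAt_injOn {s : Bool} {w : Word} (hw : IsDiagram w) :
    Set.InjOn bitAt (paths s w [] : Set (List (List Bool))) := by
  intro L hL L' hL' h
  have h1 := ((mem_paths_iff _ _ _ _).1 hL).1
  have h1' := ((mem_paths_iff _ _ _ _).1 hL').1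
  refine List.ext_getElem (h1.trans h1'.symm) fun k hk hk' => ?_
  rw [← List.getD_eq_getElem _ [] hk, ← List.getD_eq_getElem _ [] hk']
  refine eq_of_getD_eq ?_ fun j => congrFun h (k, j)
  rw [length_of_mem_paths hw hL k (by omega), length_of_mem_paths hw hL' k (by omega)]

/-- The states of a diagram. -/
def states (s : Bool) (w : Word) : Set (ℕ × ℕ → Bool) := {σ | IsState s w σ}

theorem states_eq_image (s : Bool) {w : Word} (hw : IsDiagram w) :
    states s w = bitAt '' (paths s w [] : Set (List (List Bool))) := by
  ext σ
  constructor
  · intro h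
    exact ⟨levels w σ, levels_mem_paths hw h, bitAt_levels h⟩
  · rintro ⟨L, hL, rfl⟩
    exact isState_bitAt hw hL

theorem finite_states (s : Bool) {w : Word} (hw : IsDiagram w) : (states s w).Finite := by
  rw [states_eq_image s hw]
  exact (Finset.finite_toSet _).image _

/-- The sign of layer `k` in a state. -/
def signAt (w : Word) (σ : ℕ × ℕ → Bool) (k : ℕ) : ℤ :=
  match w[k]? with
  | some l => pieceSign l.kind (σ (k, l.place)) (σ (k, l.place + 1))
  | none => 0

theorem layerSign_eq {κ : Kind} {i : ℕ} {b : List Bool} (hb : i + κ.ins ≤ b.length) :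
    layerSign κ i b = pieceSign κ (b.getD i false) (b.getD (i + 1) false) := by
  induction i generalizing b with
  | zero =>
    rcases b with _ | ⟨x, _ | ⟨y, b⟩⟩
    · cases κ <;> simp [Kind.ins] at hb <;> rfl
    · cases κ <;> simp [Kind.ins] at hb <;> rfl
    · rfl
  | succ i ih =>
    obtain ⟨x, b, rfl⟩ := exists_cons_one (b := b) (by omega)
    rw [layerSign, ih (by simp at hb; omega)]
    rfl

theorem pathSign_eq_sum (w : Word) (L : List (List Bool)) (hL : L.length = w.length + 1)
    (h : ∀ k l, w[k]? = some l → l.place + l.kind.ins ≤ (L.getD k []).length) :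
    pathSign w L = ∑ k ∈ Finset.range w.length, signAt w (bitAt L) k := by
  induction w generalizing L with
  | nil => rcases L with _ | ⟨b, L⟩ <;> rfl
  | cons l w ih =>
    rcases L with _ | ⟨b, L⟩
    · simp at hL
    · rw [pathSign, ih L (by simpa using hL) fun k l' hk => h (k + 1) l' (by simpa using hk),
        List.length_cons, Finset.sum_range_succ', add_comm, layerSign_eq (b := b) (h 0 l rfl)]
      rfl

theorem stateSum_eq_finsum (s : Bool) {w : Word} (hw : IsDiagram w) :
    stateSum s w = ∑ᶠ σ ∈ states s w, T (∑ k ∈ Finset.range w.length, signAt w σ k) := by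
  rw [states_eq_image s hw, finsum_mem_image (bitAt_injOn hw), finsum_mem_coe_finset, stateSum,
    stateSumFrom_eq_sum_paths]
  refine Finset.sum_congr rfl fun L hL => ?_
  rw [pathSign_eq_sum w L ((mem_paths_iff _ _ _ _).1 hL).1]
  intro k l hl
  rw [length_of_mem_paths hw hL k (List.getElem?_eq_some_iff.1 hl).1.le]
  exact hw.place_le hl

theorem mem_points_iff_of_link {s : Bool} {w : Word} (hw : IsDiagram w) {p q : ℕ × ℕ} {c : Bool}
    (h : Link s w p q c) : p ∈ points w ↔ q ∈ points w := by
  have key : ∀ {k : ℕ} {l : Layer}, w[k]? = some l → k + 1 ≤ w.length ∧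
      l.place + l.kind.ins ≤ widthAt w k ∧
      widthAt w (k + 1) = widthAt w k - l.kind.ins + l.kind.outs := fun hl =>
    ⟨(List.getElem?_eq_some_iff.1 hl).1, hw.place_le hl, widthAt_succ hl⟩
  cases h with
  | left k j l hl hj =>
    have := key hl
    simp only [points, Set.mem_ofPred_eq]
    omega
  | right k j l hl hj =>
    have := key hl
    simp only [points, Set.mem_ofPred_eq]
    omega
  | slope_right k l hl hn =>
    have := key hl
    simp only [points, Set.mem_ofPred_eq]
    rcases hn with h | h | h <;> simp only [h, Kind.ins, Kind.outs] at this <;> omega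
  | slope_left k l hl hn =>
    have := key hl
    simp only [points, Set.mem_ofPred_eq]
    rcases hn with h | h | h <;> simp only [h, Kind.ins, Kind.outs] at this <;> omega
  | cup k i hl =>
    have := key hl
    simp only [points, Set.mem_ofPred_eq, Kind.ins, Kind.outs] at this ⊢
    omega
  | cap k i hl =>
    have := key hl
    simp only [points, Set.mem_ofPred_eq, Kind.ins, Kind.outs] at this ⊢
    omega
  | meet hs k i hl =>
    have := key hl
    simp only [points, Set.mem_ofPred_eq, Kind.ins, Kind.outs] at this ⊢
    omega

/-- Outside the diagram all bits are `false`, so a link that demands different bits has to lie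
inside it; otherwise states could not exist. -/
theorem mem_points_of_link_true {s : Bool} {w : Word} (hw : IsDiagram w) {p q : ℕ × ℕ}
    (h : Link s w p q true) : p ∈ points w := by
  have key : ∀ {k : ℕ} {l : Layer}, w[k]? = some l → k + 1 ≤ w.length ∧
      l.place + l.kind.ins ≤ widthAt w k ∧
      widthAt w (k + 1) = widthAt w k - l.kind.ins + l.kind.outs := fun hl =>
    ⟨(List.getElem?_eq_some_iff.1 hl).1, hw.place_le hl, widthAt_succ hl⟩
  have node : ∀ {κ : Kind}, κ.IsNode → κ.ins = 2 := by
    rintro κ (rfl | rfl | rfl) <;> rfl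
  generalize hc : true = c at h
  cases h with
  | left k j l hl hj => cases hc
  | right k j l hl hj => cases hc
  | slope_right k l hl hn =>
    have := key hl
    have := node hn
    exact ⟨by simp only; omega, by simp only; omega⟩
  | slope_left k l hl hn =>
    have := key hl
    have := node hn
    exact ⟨by simp only; omega, by simp only; omega⟩
  | cup k i hl =>
    have := key hl
    simp only [points, Set.mem_ofPred_eq, Kind.ins, Kind.outs] at this ⊢
    omega
  | cap k i hl =>
    have := key hl
    simp only [points, Set.mem_ofPred_eq, Kind.ins, Kind.outs] at this ⊢
    omega
  | meet hs k i hl =>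
    have := key hl
    simp only [points, Set.mem_ofPred_eq, Kind.ins, Kind.outs] at this ⊢
    omega

theorem finite_points (w : Word) : (points w).Finite := by
  have : points w ⊆ ⋃ k ∈ Finset.range (w.length + 1), (fun j => (k, j)) '' Set.Iio (widthAt w k) := by
    rintro ⟨k, j⟩ ⟨hk, hj⟩
    simp only [Set.mem_iUnion]
    exact ⟨k, by simpa [Nat.lt_succ_iff] using hk, j, hj, rfl⟩
  exact (Set.Finite.biUnion (Finset.finite_toSet _)
    fun k _ => (Set.finite_Iio _).image _).subset this

/-- Points are adjacent if a condition on the states links them. -/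
def Adjacent (s : Bool) (w : Word) (p q : ℕ × ℕ) : Prop := ∃ c, Link s w p q c

theorem graphAdj_eq (w : Word) : GraphAdj w = Adjacent false w := by
  funext p q
  refine propext ⟨?_, ?_⟩
  · rintro (h | h | h)
    · cases h with
      | left k j l h hj => exact ⟨_, .left k j l h hj⟩
      | right k j l h hj => exact ⟨_, .right k j l h hj⟩
      | slope_right k l h hl => exact ⟨_, .slope_right k l h hl⟩
      | slope_left k l h hl => exact ⟨_, .slope_left k l h hl⟩
    · cases h with
      | cup k i h => exact ⟨_, .cup k i h⟩
      | cap k i h => exact ⟨_, .cap k i h⟩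
    · cases h with
      | vertex k i h => exact ⟨_, .meet rfl k i h⟩
  · rintro ⟨c, h⟩
    cases h with
    | left k j l h hj => exact .inl (.left k j l h hj)
    | right k j l h hj => exact .inl (.right k j l h hj)
    | slope_right k l h hl => exact .inl (.slope_right k l h hl)
    | slope_left k l h hl => exact .inl (.slope_left k l h hl)
    | cup k i h => exact .inr (.inl (.cup k i h))
    | cap k i h => exact .inr (.inl (.cap k i h))
    | meet _ k i h => exact .inr (.inr (.vertex k i h))

theorem link_of_through {w : Word} {p q : ℕ × ℕ} (h : Through w p q) : Link true w p q false := by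
  cases h with
  | left k j l h hj => exact .left k j l h hj
  | right k j l h hj => exact .right k j l h hj
  | slope_right k l h hl => exact .slope_right k l h hl
  | slope_left k l h hl => exact .slope_left k l h hl

theorem link_of_turn {s : Bool} {w : Word} {p q : ℕ × ℕ} (h : Turn w p q) : Link s w p q true := by
  cases h with
  | cup k i h => exact .cup k i h
  | cap k i h => exact .cap k i h

theorem strandAdj_eq (w : Word) : StrandAdj w = Adjacent true w := by
  funext p q
  refine propext ⟨?_, ?_⟩
  · rintro (h | h)
    · exact ⟨_, link_of_through h⟩
    · exact ⟨_, link_of_turn h⟩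
  · rintro ⟨c, h⟩
    cases h with
    | left k j l h hj => exact .inl (.left k j l h hj)
    | right k j l h hj => exact .inl (.right k j l h hj)
    | slope_right k l h hl => exact .inl (.slope_right k l h hl)
    | slope_left k l h hl => exact .inl (.slope_left k l h hl)
    | cup k i h => exact .inr (.cup k i h)
    | cap k i h => exact .inr (.cap k i h)
    | meet hs k i h => exact absurd hs (by simp)

open Classical in
/-- The state obtained by reversing the bits of some classes of adjacent points. -/
noncomputable def reverseOn (s : Bool) (w : Word) (σ : ℕ × ℕ → Bool) (g : Quot (Adjacent s w) → Bool)
    (p : ℕ × ℕ) : Bool :=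
  if p ∈ points w then σ p ^^ g (Quot.mk _ p) else false

theorem isState_reverseOn {s : Bool} {w : Word} (hw : IsDiagram w) {σ : ℕ × ℕ → Bool}
    (hσ : IsState s w σ) (g : Quot (Adjacent s w) → Bool) : IsState s w (reverseOn s w σ g) where
  support p hp := if_neg hp
  link p q c h := by
    have h1 := hσ.link p q c h
    have h2 : Quot.mk (Adjacent s w) p = Quot.mk _ q := Quot.sound ⟨c, h⟩
    have h3 := mem_points_iff_of_link hw h
    by_cases hp : p ∈ points w
    · rw [reverseOn, reverseOn, if_pos hp, if_pos (h3.1 hp), h2, ← h1]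
      cases σ p <;> cases σ q <;> cases g (Quot.mk _ q) <;> rfl
    · have e1 := hσ.support p hp
      have e2 := hσ.support q fun hq => hp (h3.2 hq)
      rw [reverseOn, reverseOn, if_neg hp, if_neg fun hq => hp (h3.2 hq), ← h1, e1, e2]

theorem exists_eq_reverseOn {s : Bool} {w : Word} {σ τ : ℕ × ℕ → Bool}
    (hσ : IsState s w σ) (hτ : IsState s w τ) : ∃ g, τ = reverseOn s w σ g := by
  refine ⟨Quot.lift (fun p => σ p ^^ τ p) ?_, ?_⟩
  · rintro p q ⟨c, h⟩
    have h1 := hσ.link p q c h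
    have h2 := hτ.link p q c h
    subst h1
    revert h2
    cases σ p <;> cases σ q <;> cases τ p <;> cases τ q <;> simp
  · funext p
    by_cases hp : p ∈ points w
    · rw [reverseOn, if_pos hp]
      change τ p = (σ p ^^ (σ p ^^ τ p))
      cases σ p <;> cases τ p <;> rfl
    · rw [reverseOn, if_neg hp]
      exact hτ.support p hp

open Classical in
-- The states, if there are any, form a torsor under reversal of the classes of adjacent points,
-- because links fix precisely the relative directions within a class.
theorem ncard_states {s : Bool} {w : Word} (hw : IsDiagram w) (h : (states s w).Nonempty) :
    (states s w).ncard = 2 ^ (Quot.mk (Adjacent s w) '' points w).ncard := by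
  obtain ⟨σ, hσ⟩ := h
  set C := Quot.mk (Adjacent s w) '' points w with hC
  have : Finite C := ((finite_points w).image _).to_subtype
  let Φ : (C → Bool) → states s w := fun g =>
    ⟨reverseOn s w σ fun c => if h : c ∈ C then g ⟨c, h⟩ else false, isState_reverseOn hw hσ _⟩
  have hΦ : Function.Bijective Φ := by
    constructor
    · intro g g' hg
      funext ⟨c, p, hp, hc⟩
      subst hc
      have h1 := congrFun (congrArg Subtype.val hg) p
      have h2 : Quot.mk (Adjacent s w) p ∈ C := ⟨p, hp, rfl⟩
      simp only [Φ, reverseOn, if_pos hp, dif_pos h2] at h1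
      revert h1
      cases σ p <;> simp
    · rintro ⟨τ, hτ⟩
      obtain ⟨g, rfl⟩ := exists_eq_reverseOn hσ hτ
      refine ⟨fun c => g c, Subtype.ext (funext fun p => ?_)⟩
      by_cases hp : p ∈ points w
      · have h2 : Quot.mk (Adjacent s w) p ∈ C := ⟨p, hp, rfl⟩
        simp only [Φ, reverseOn, if_pos hp, dif_pos h2]
      · simp only [Φ, reverseOn, if_neg hp]
  rw [← Nat.card_coe_set_eq, ← Nat.card_eq_of_bijective Φ hΦ, Nat.card_fun, Nat.card_coe_set_eq]
  simp

open Classical in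
-- Checkerboard colouring: without crossings, the parity of the number of strands to the left is
-- constant along edges and changes between the ends of an extremum and across a vertex. Directing
-- strands by this parity makes every vertex a source-sink.
theorem nonempty_states_of_planar {w : Word} (hw : IsPlanarDiagram w) : (states false w).Nonempty := by
  refine ⟨fun p => if p ∈ points w then decide (p.2 % 2 = 0) else false, fun p hp => if_neg hp,
    fun p q c h => ?_⟩
  have h3 := mem_points_iff_of_link hw.1 h
  have key : p ∈ points w → (decide (p.2 % 2 = 0) ^^ decide (q.2 % 2 = 0)) = c := by
    have vertex : ∀ {k : ℕ} {l : Layer}, w[k]? = some l → l.kind.IsNode → l.kind = .vertex := by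
      intro k l hl hn
      have := hw.2 l (List.mem_of_getElem? hl)
      rcases hn with h | h | h
      · exact absurd (.inl h) this
      · exact absurd (.inr h) this
      · exact h
    have succ : ∀ i : ℕ, (decide (i % 2 = 0) ^^ decide ((i + 1) % 2 = 0)) = true := by
      intro i
      rcases Nat.mod_two_eq_zero_or_one i with h | h <;> simp [h, Nat.add_mod]
    intro _
    cases h with
    | left k j l hl hj => simp
    | right k j l hl hj => cases h : l.kind <;> simp [Kind.ins, Kind.outs]
    | slope_right k l hl hn => simpa [vertex hl hn] using succ l.place
    | slope_left k l hl hn =>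
      rw [Bool.xor_comm]
      simpa [vertex hl hn] using succ l.place
    | cup k i hl => exact succ i
    | cap k i hl => exact succ i
    | meet hs k i hl => exact succ i
  by_cases hp : p ∈ points w
  · simpa only [if_pos hp, if_pos (h3.1 hp)] using key hp
  · simp only [if_neg hp, if_neg fun hq => hp (h3.2 hq)]
    cases c
    · rfl
    · exact absurd (mem_points_of_link_true hw.1 h) hp

/-! ### Every diagram has a straight orientation -/

theorem append_mem_successors {s : Bool} {κ : Kind} {b c : List Bool} (h : c ∈ successors s κ 0 b)
    (u : List Bool) : u ++ c ∈ successors s κ u.length (u ++ b) := by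
  induction u with
  | nil => exact h
  | cons x u ih => simpa [successors] using ih

theorem exists_split {α : Type*} {L : List α} {i : ℕ} (h : i ≤ L.length) :
    ∃ u v, L = u ++ v ∧ u.length = i :=
  ⟨L.take i, L.drop i, (List.take_append_drop i L).symm, by simpa using h⟩

theorem exists_split_two {α : Type*} {L : List α} {i : ℕ} (h : i + 2 ≤ L.length) :
    ∃ u x y v, L = u ++ x :: y :: v ∧ u.length = i := by
  obtain ⟨u, v, rfl, rfl⟩ := exists_split (show i ≤ L.length by omega)
  rcases v with _ | ⟨x, _ | ⟨y, v⟩⟩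
  · simp at h
  · simp at h
  · exact ⟨u, x, y, v, rfl, rfl⟩

/-- The bits with values `f` on the strands, where `l` lists the strands and their directions. -/
def strandBits (f : ℕ → Bool) (l : List (ℕ × Bool)) : List Bool := l.map fun x => f x.1 ^^ x.2

theorem nonempty_paths_cons {s : Bool} {κ : Kind} {i : ℕ} {w : Word} {b b' : List Bool}
    (hb : b' ∈ successors s κ i b) (h : (paths s w b').Nonempty) :
    (paths s (⟨κ, i⟩ :: w) b).Nonempty := by
  obtain ⟨L, hL⟩ := h
  exact ⟨b :: L, Finset.mem_biUnion.2 ⟨b', hb, Finset.mem_map.2 ⟨L, hL, rfl⟩⟩⟩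

theorem strandBits_append (f : ℕ → Bool) (u v : List (ℕ × Bool)) :
    strandBits f (u ++ v) = strandBits f u ++ strandBits f v := List.map_append

theorem length_strandBits (f : ℕ → Bool) (u : List (ℕ × Bool)) :
    (strandBits f u).length = u.length := List.length_map _

/-- The strands above a horizontal line can be directed independently of each other. -/
theorem exists_strands {w : Word} {n : ℕ} (hw : Runs n w 0) :
    ∃ l : List (ℕ × Bool), l.length = n ∧ l.Nodup ∧
      ∀ f, (paths true w (strandBits f l)).Nonempty := by
  -- A label consists of the number of a strand above the line and a flag for its end. Distinct
  -- labels ensure that two ends of one strand carry opposite flags, so directions are compatible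
  -- when a minimum closes that strand.
  induction w generalizing n with
  | nil =>
    obtain rfl : n = 0 := hw
    exact ⟨[], rfl, List.nodup_nil, fun f => by simp [paths, strandBits]⟩
  | cons l w ih =>
    obtain ⟨κ, i⟩ := l
    obtain ⟨h1, h2⟩ := hw
    obtain ⟨l, hlen, hnd, hl⟩ := ih h2
    have node : κ.IsNode → ∃ l : List (ℕ × Bool), l.length = n ∧ l.Nodup ∧
        ∀ f, (paths true (⟨κ, i⟩ :: w) (strandBits f l)).Nonempty := by
      intro hκ
      have hio : κ.ins = 2 ∧ κ.outs = 2 := by rcases hκ with rfl | rfl | rfl <;> exact ⟨rfl, rfl⟩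
      simp only [hio] at h1 hlen
      obtain ⟨u, x, y, v, rfl, rfl⟩ := exists_split_two (L := l) (i := i) (by omega)
      refine ⟨u ++ y :: x :: v, by simp at hlen ⊢; omega, ?_, fun f => nonempty_paths_cons ?_ (hl f)⟩
      · exact ((List.Perm.swap x y v).append_left u).nodup_iff.2 hnd
      · rw [strandBits_append, strandBits_append, ← length_strandBits f u]
        refine append_mem_successors ?_ _
        rcases hκ with rfl | rfl | rfl <;> simp [strandBits, successors]
    cases κ with
    | pos => exact node (.inl rfl)
    | neg => exact node (.inr (.inl rfl))
    | vertex => exact node (.inr (.inr rfl))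
    | cap =>
      simp only [Kind.ins, Kind.outs] at h1 hlen
      obtain ⟨u, v, rfl, rfl⟩ := exists_split (L := l) (i := i) (by omega)
      obtain ⟨m, hm⟩ := Infinite.exists_notMem_finset ((u ++ v).map Prod.fst).toFinset
      have hm' : ∀ d, (m, d) ∉ u ++ v := fun d hd =>
        hm (List.mem_toFinset.2 (List.mem_map.2 ⟨_, hd, rfl⟩))
      refine ⟨u ++ (m, true) :: (m, false) :: v, by simp at hlen ⊢; omega, ?_,
        fun f => nonempty_paths_cons ?_ (hl f)⟩
      · rw [List.nodup_middle, List.nodup_cons, List.mem_append, List.mem_cons, List.nodup_middle,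
          List.nodup_cons]
        refine ⟨?_, hm' _, hnd⟩
        have := hm' true
        simp_all
      · rw [strandBits_append, strandBits_append, ← length_strandBits f u]
        refine append_mem_successors ?_ _
        simp [strandBits, successors]
    | cup =>
      simp only [Kind.ins, Kind.outs] at h1 hlen
      obtain ⟨u, ⟨m₁, d₁⟩, ⟨m₂, d₂⟩, v, rfl, rfl⟩ := exists_split_two (L := l) (i := i) (by omega)
      rw [List.nodup_middle, List.nodup_cons, List.mem_append, List.mem_cons, List.nodup_middle,
          List.nodup_cons, List.mem_append] at hnd
      obtain ⟨hn1, hn2, hn3⟩ := hnd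
      push Not at hn1 hn2
      -- The minimum joins the ends $(m_1,d_1)$ and $(m_2,d_2)$, so the other end of the second
      -- strand takes over the vacated label of the first. If both ends lie on one strand, the
      -- renaming is trivial.
      let ren : ℕ × Bool → ℕ × Bool := fun x => if x = (m₂, !d₂) then (m₁, d₁) else x
      refine ⟨(u ++ v).map ren, by simp at hlen ⊢; omega, ?_, fun f => ?_⟩
      · refine (List.nodup_map_iff_inj_on hn3).2 fun x hx y hy hxy => ?_
        have ne : ∀ x ∈ u ++ v, x ≠ (m₁, d₁) := by
          rintro x hx rfl
          rcases List.mem_append.1 hx with h | h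
          · exact hn1.1 h
          · exact hn1.2.2 h
        simp only [ren] at hxy
        split_ifs at hxy with h h' h'
        · rw [h, h']
        · exact absurd hxy.symm (ne y hy)
        · exact absurd hxy (ne x hx)
        · exact hxy
      · have key : ∃ f' : ℕ → Bool, (f' m₁ ^^ d₁) ≠ (f' m₂ ^^ d₂) ∧
            ∀ x ∈ u ++ v, (f (ren x).1 ^^ (ren x).2) = (f' x.1 ^^ x.2) := by
          have ne : ∀ x ∈ u ++ v, x ≠ (m₂, d₂) := by
            rintro x hx rfl
            rcases List.mem_append.1 hx with h | h
            · exact hn2.1 h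
            · exact hn2.2 h
          by_cases hm : m₁ = m₂
          · subst hm
            have hd : d₁ = !d₂ := by
              have := hn1.2.1
              revert this
              cases d₁ <;> cases d₂ <;> simp
            subst hd
            refine ⟨f, by cases f m₁ <;> cases d₂ <;> simp, fun x _ => ?_⟩
            simp only [ren]
            split_ifs with h
            · rw [h]
            · rfl
          -- This value directs the second strand oppositely to the first at the minimum, as seen
          -- upwards.
          · refine ⟨Function.update f m₂ (!f m₁ ^^ d₁ ^^ d₂), ?_, fun x hx => ?_⟩
            · rw [Function.update_self, Function.update_of_ne hm]
              cases f m₁ <;> cases d₁ <;> cases d₂ <;> simp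
            · simp only [ren]
              split_ifs with h
              · subst h
                rw [Function.update_self]
                cases f m₁ <;> cases d₁ <;> cases d₂ <;> rfl
              · have hx2 : x.1 ≠ m₂ := by
                  intro h'
                  have h3 := ne x hx
                  obtain ⟨m, d⟩ := x
                  subst h'
                  revert h h3
                  cases d <;> cases d₂ <;> simp
                rw [Function.update_of_ne hx2]
        obtain ⟨f', hf1, hf2⟩ := key
        have e : strandBits f ((u ++ v).map ren) = strandBits f' u ++ strandBits f' v := by
          rw [← strandBits_append, strandBits, strandBits, List.map_map]
          exact List.map_congr_left hf2
        refine nonempty_paths_cons ?_ (hl f')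
        rw [e, strandBits_append, ← length_strandBits f' u]
        refine append_mem_successors ?_ _
        simp only [strandBits, successors, List.map_cons, Finset.mem_insert, Finset.mem_singleton]
        revert hf1
        cases (f' m₁ ^^ d₁) <;> cases (f' m₂ ^^ d₂) <;> simp

theorem nonempty_states_true {w : Word} (hw : IsDiagram w) : (states true w).Nonempty := by
  obtain ⟨l, hl, -, h⟩ := exists_strands hw
  obtain rfl := List.length_eq_zero_iff.1 hl
  obtain ⟨L, hL⟩ := h fun _ => true
  exact ⟨bitAt L, isState_bitAt hw hL⟩

/-! ### Diagrams isotopic to planar ones: all states have one total sign -/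

/-- The total sign of a state. -/
def totalSign (w : Word) (σ : ℕ × ℕ → Bool) : ℤ := ∑ k ∈ Finset.range w.length, signAt w σ k

theorem stateSum_eq_sum (s : Bool) {w : Word} (hw : IsDiagram w) :
    stateSum s w = ∑ σ ∈ (finite_states s hw).toFinset, T (totalSign w σ) := by
  rw [stateSum_eq_finsum s hw, finsum_mem_eq_finite_toFinset_sum _ (finite_states s hw)]
  rfl

theorem stateSum_planar (s : Bool) {w : Word} (hw : IsPlanarDiagram w) :
    stateSum s w = ((states s w).ncard : ℤ[T;T⁻¹]) := by
  have h0 : ∀ σ, totalSign w σ = 0 := by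
    refine fun σ => Finset.sum_eq_zero fun k _ => ?_
    rw [signAt]
    split
    · rename_i l hl
      have := hw.2 l (List.mem_of_getElem? hl)
      rw [Kind.IsCrossing] at this
      cases h : l.kind <;> simp_all [pieceSign]
    · rfl
  rw [stateSum_eq_sum s hw.1, Set.ncard_eq_toFinset_card _ (finite_states s hw.1)]
  simp [h0]

theorem evalAt_one_stateSum (s : Bool) {w : Word} (hw : IsDiagram w) :
    evalAt (1 : ℤˣ) (stateSum s w) = (states s w).ncard := by
  rw [stateSum_eq_sum s hw, map_sum, Set.ncard_eq_toFinset_card _ (finite_states s hw)]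
  simp [evalAt_T]

/-- All states have the same total sign if the state sum is that of a planar diagram, up to the
factor that curls contribute. -/
theorem totalSign_eq {s : Bool} {w P : Word} (hw : IsDiagram w) (hP : IsPlanarDiagram P) {k : ℤ}
    (h : stateSum s w = T k * stateSum s P) {σ : ℕ × ℕ → Bool} (hσ : σ ∈ states s w) :
    totalSign w σ = k := by
  rw [stateSum_planar s hP, stateSum_eq_sum s hw] at h
  by_contra hne
  -- Compare coefficients at the total sign of `σ`. If it differs from `k` the right side gives 0,
  -- whereas the left side is a sum of nonnegative terms with the term 1 from `σ`.
  have h1 := congrArg (fun f : ℤ[T;T⁻¹] => f.coeff (totalSign w σ)) h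
  have h2 : (T k * ((states s P).ncard : ℤ[T;T⁻¹])).coeff (totalSign w σ) = 0 := by
    rw [mul_comm, ← nsmul_eq_mul, AddMonoidAlgebra.coeff_smul, Finsupp.smul_apply, T_apply,
      if_neg (Ne.symm hne), smul_zero]
  have h3 : (∑ τ ∈ (finite_states s hw).toFinset, T (totalSign w τ) : ℤ[T;T⁻¹]).coeff
      (totalSign w σ) = ∑ τ ∈ (finite_states s hw).toFinset,
        if totalSign w τ = totalSign w σ then 1 else 0 := by
    simp [Finsupp.finsetSum_apply]
  simp only [h2, h3] at h1
  have h4 := (Finset.sum_eq_zero_iff_of_nonneg fun τ _ => by split_ifs <;> simp).1 h1 σ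
    ((finite_states s hw).mem_toFinset.2 hσ)
  simp at h4

/-- At $T = 1$ the state sum counts states, so both diagrams have equally many. -/
theorem nonempty_states_of_stateSum_eq {s : Bool} {w P : Word} (hw : IsDiagram w)
    (hP : IsPlanarDiagram P) {k : ℤ} (h : stateSum s w = T k * stateSum s P)
    (hne : (states s P).Nonempty) : (states s w).Nonempty := by
  have h1 := congrArg (evalAt (1 : ℤˣ)) h
  rw [map_mul, evalAt_one_stateSum s hw, evalAt_one_stateSum s hP.1, evalAt_T] at h1
  simp only [one_zpow, Units.val_one, one_mul, Nat.cast_inj] at h1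
  rw [← Set.ncard_pos (finite_states s hw), h1]
  exact (Set.ncard_pos (finite_states s hP.1)).2 hne

theorem stateSum_eq_of_totalSign {s : Bool} {w : Word} (hw : IsDiagram w) {k : ℤ}
    (h : ∀ σ ∈ states s w, totalSign w σ = k) (hne : (states s w).Nonempty) :
    stateSum s w = 2 ^ (Quot.mk (Adjacent s w) '' points w).ncard * T k := by
  rw [stateSum_eq_sum s hw, Finset.sum_congr rfl fun σ hσ => by
    rw [h σ ((finite_states s hw).mem_toFinset.1 hσ)], Finset.sum_const,
    ← Set.ncard_eq_toFinset_card _ (finite_states s hw), ncard_states hw hne, nsmul_eq_mul]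
  simp

theorem numComponents_pos {w : Word} (hw : IsDiagram w) (hne : w ≠ []) : 0 < numComponents w := by
  obtain ⟨w, rfl, -⟩ := hw.exists_cons hne
  refine (Set.ncard_pos ((finite_points _).image _)).2 ⟨_, (1, 0), ⟨by simp, ?_⟩, rfl⟩
  simp [widthAt, Kind.ins, Kind.outs]

/-! ### The twisting number -/

theorem directed_eq {w : Word} {σ : ℕ × ℕ → Bool} (hσ : IsState true w σ) {p q : ℕ × ℕ}
    (h : Quot.mk (StrandAdj w) p = Quot.mk (StrandAdj w) q) (d : Bool) :
    Quot.mk (DirectedAdj w) (p, σ p ^^ d) = Quot.mk (DirectedAdj w) (q, σ q ^^ d) := by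
  have key : ∀ p q, StrandAdj w p q →
      Quot.mk (DirectedAdj w) (p, σ p ^^ d) = Quot.mk (DirectedAdj w) (q, σ q ^^ d) := by
    rintro p q (h | h)
    · refine Quot.sound (.inl ⟨h, ?_⟩)
      have := hσ.link _ _ _ (link_of_through h)
      simp only
      rw [(xor_eq_false_iff _ _).1 this]
    · refine Quot.sound (.inr ⟨h, ?_⟩)
      have := hσ.link _ _ _ (link_of_turn (s := true) h)
      simp only
      revert this
      cases σ p <;> cases σ q <;> cases d <;> simp
  exact congrArg (Quot.lift (fun p => Quot.mk (DirectedAdj w) (p, σ p ^^ d)) key) h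

/-- A state is a consistent direction of every circuit: travelling with or against it is invariant
under directed adjacency. So any state decides whether upward travel at `p` and at `q` is the same
travel along their common circuit. -/
theorem directed_eq_iff {w : Word} {σ : ℕ × ℕ → Bool} (hσ : IsState true w σ) {p q : ℕ × ℕ}
    (h : Quot.mk (StrandAdj w) p = Quot.mk (StrandAdj w) q) :
    Quot.mk (DirectedAdj w) (p, true) = Quot.mk (DirectedAdj w) (q, true) ↔ σ p = σ q := by
  constructor
  · intro h'
    have key : ∀ x y, DirectedAdj w x y → (x.2 ^^ σ x.1) = (y.2 ^^ σ y.1) := by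
      rintro ⟨p, d⟩ ⟨q, e⟩ (⟨h, he⟩ | ⟨h, he⟩)
      · have := hσ.link _ _ _ (link_of_through h)
        simp only at he ⊢
        rw [he, (xor_eq_false_iff _ _).1 this]
      · have := hσ.link _ _ _ (link_of_turn (s := true) h)
        simp only at he this ⊢
        subst he
        revert this
        cases σ p <;> cases σ q <;> cases d <;> simp
    have := congrArg (Quot.lift (fun x : (ℕ × ℕ) × Bool => x.2 ^^ σ x.1) key) h'
    simpa using this
  · intro h'
    have := directed_eq hσ h (!σ p)
    rw [← h'] at this
    simpa using this

/-- Layer `k` is a crossing both of whose strands belong to the same circuit. -/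
def IsSelfCrossing (w : Word) (k : ℕ) : Prop := ∃ C, SelfCrossing w C k

/-- Both strands of a self-crossing are reversed together, so its sign is the same in every state.
-/
theorem signAt_eq_crossingSign {w : Word} {σ : ℕ × ℕ → Bool} (hσ : IsState true w σ) {k : ℕ}
    (hk : IsSelfCrossing w k) : signAt w σ k = crossingSign w k := by
  obtain ⟨C, ⟨κ, i⟩, hl, hκ, h1, h2⟩ := hk
  have := directed_eq_iff hσ (h1.trans h2.symm)
  rw [signAt, crossingSign, hl]
  rcases hκ with h | h <;> simp only at h <;> subst h <;> simp only [pieceSign] <;>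
    simp only at this <;> simp only [this]

theorem eq_of_selfCrossing {w : Word} {k : ℕ} {l : Layer} (hl : w[k]? = some l)
    {C : Quot (StrandAdj w)} (h : SelfCrossing w C k) : C = Quot.mk _ (k, l.place) := by
  obtain ⟨l', hl', -, h1, -⟩ := h
  obtain rfl : l = l' := Option.some.inj (hl.symm.trans hl')
  exact h1.symm

open Classical in
theorem twistingNumber_eq {w : Word} (hw : IsDiagram w) :
    twistingNumber w =
      ∑ k ∈ Finset.range w.length, if IsSelfCrossing w k then crossingSign w k else 0 := by
  have hf : (circuits w).Finite := (finite_points w).image _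
  rw [twistingNumber, finsum_mem_eq_finite_toFinset_sum _ hf]
  simp only [writhe, Finset.sum_filter]
  rw [Finset.sum_comm]
  refine Finset.sum_congr rfl fun k hk => ?_
  have hl : w[k]? = some (w[k]'(Finset.mem_range.1 hk)) :=
    List.getElem?_eq_getElem (Finset.mem_range.1 hk)
  by_cases h : IsSelfCrossing w k
  · rw [if_pos h]
    obtain ⟨C, hC⟩ := h
    have hC' := eq_of_selfCrossing hl hC
    rw [Finset.sum_eq_single C, if_pos hC]
    · intro D _ hD
      exact if_neg fun hD' => hD ((eq_of_selfCrossing hl hD').trans hC'.symm)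
    · intro hn
      refine absurd ?_ hn
      rw [Set.Finite.mem_toFinset, hC']
      refine ⟨_, ⟨(Finset.mem_range.1 hk).le, ?_⟩, rfl⟩
      have := hw.place_le hl
      obtain ⟨l, hl', hκ, -⟩ := hC
      obtain rfl := Option.some.inj (hl.symm.trans hl')
      have h2 : (w[k]'(Finset.mem_range.1 hk)).kind.ins = 2 := by
        rcases hκ with h | h <;> rw [h] <;> rfl
      simp only
      omega
  · rw [if_neg h]
    exact Finset.sum_eq_zero fun C _ => if_neg fun hC => h ⟨C, hC⟩

open Classical in
-- Reversing only the circuit through the lower left end is a fixed-point-free involution of the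
-- states which negates the sign of a crossing between two circuits.
theorem sum_signAt_eq_zero {w : Word} (hw : IsDiagram w) {k : ℕ} (hk : ¬ IsSelfCrossing w k) :
    ∑ σ ∈ (finite_states true hw).toFinset, signAt w σ k = 0 := by
  by_cases hc : ∃ l, w[k]? = some l ∧ l.kind.IsCrossing
  · obtain ⟨l, hl, hκ⟩ := hc
    have hne : Quot.mk (Adjacent true w) (k, l.place) ≠ Quot.mk _ (k, l.place + 1) := by
      intro h
      rw [← strandAdj_eq] at h
      exact hk ⟨_, l, hl, hκ, rfl, h.symm⟩
    have h2 : l.kind.ins = 2 := by rcases hκ with h | h <;> rw [h] <;> rfl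
    have hle := hw.place_le hl
    have hkl : k ≤ w.length := (List.getElem?_eq_some_iff.1 hl).1.le
    have hp : (k, l.place) ∈ points w := ⟨hkl, by simp only; omega⟩
    have hp' : (k, l.place + 1) ∈ points w := ⟨hkl, by simp only; omega⟩
    let g : Quot (Adjacent true w) → Bool := fun C => decide (C = Quot.mk _ (k, l.place))
    have hflip : ∀ σ, reverseOn true w σ g (k, l.place) = !σ (k, l.place) := fun σ => by
      simp [reverseOn, hp, g]
    have hkeep : ∀ σ, reverseOn true w σ g (k, l.place + 1) = σ (k, l.place + 1) := fun σ => by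
      simp [reverseOn, hp', g, Ne.symm hne]
    refine Finset.sum_involution (fun σ _ => reverseOn true w σ g) ?_ ?_ ?_ ?_
    · intro σ _
      rw [signAt, signAt, hl]
      simp only [hflip, hkeep]
      rcases hκ with h | h <;> rw [h] <;> cases σ (k, l.place) <;> cases σ (k, l.place + 1) <;> rfl
    · intro σ _ _ h
      have := congrFun h (k, l.place)
      rw [hflip] at this
      revert this
      cases σ (k, l.place) <;> simp
    · intro σ hσ
      rw [Set.Finite.mem_toFinset] at hσ ⊢
      exact isState_reverseOn hw hσ g
    · intro σ hσ
      rw [Set.Finite.mem_toFinset] at hσ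
      funext p
      by_cases hp : p ∈ points w
      · simp only [reverseOn, if_pos hp]
        cases σ p <;> cases g (Quot.mk _ p) <;> rfl
      · rw [reverseOn, if_neg hp]
        exact (hσ.support p hp).symm
  · refine Finset.sum_eq_zero fun σ _ => ?_
    rw [signAt]
    split
    · rename_i l hl
      have : ¬ l.kind.IsCrossing := fun h => hc ⟨l, hl, h⟩
      rw [Kind.IsCrossing] at this
      cases h : l.kind <;> simp_all [pieceSign]
    · rfl

/-- Sum the total sign over all straight orientations and exchange the sums: self-crossings
contribute their sign once per state, all other layers contribute 0. Dividing by the number of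
states requires that there be at least one. -/
theorem twistingNumber_eq_of_totalSign {w : Word} (hw : IsDiagram w) {k : ℤ}
    (h : ∀ σ ∈ states true w, totalSign w σ = k) : twistingNumber w = k := by
  classical
  set S := (finite_states true hw).toFinset with hS
  have hne : S.Nonempty := by
    rw [hS, Set.Finite.toFinset_nonempty]
    exact nonempty_states_true hw
  have h1 : ∑ σ ∈ S, totalSign w σ = S.card * k := by
    rw [Finset.sum_congr rfl fun σ hσ => h σ ((finite_states true hw).mem_toFinset.1 hσ),
      Finset.sum_const, nsmul_eq_mul]
  have h2 : ∑ σ ∈ S, totalSign w σ = S.card * twistingNumber w := by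
    simp only [totalSign]
    rw [Finset.sum_comm, twistingNumber_eq hw, Finset.mul_sum]
    refine Finset.sum_congr rfl fun j _ => ?_
    split_ifs with hj
    · rw [Finset.sum_congr rfl fun σ hσ =>
        signAt_eq_crossingSign ((finite_states true hw).mem_toFinset.1 hσ) hj,
        Finset.sum_const, nsmul_eq_mul]
    · rw [sum_signAt_eq_zero hw hj, mul_zero]
  have h3 : (S.card : ℤ) ≠ 0 := by exact_mod_cast hne.card_pos.ne'
  exact mul_left_cancel₀ h3 (h2.symm.trans h1)

/-- The common exponent `k` is identified with the twisting number through `s = true` and then used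
for `s = false`, where adjacency classes are the components of the graph. -/
theorem halfStateSum_eq {w P : Word} (hw : IsDiagram w) (hne : w ≠ []) (hP : IsPlanarDiagram P)
    (h : AmbientIsotopic w P) :
    halfStateSum false w = 2 ^ (numComponents w - 1) * T (twistingNumber w) := by
  obtain ⟨k, hk⟩ := stateSum_ambientIsotopic h
  have ht : twistingNumber w = k :=
    twistingNumber_eq_of_totalSign hw fun σ hσ => totalSign_eq hw hP (hk true) hσ
  have h1 := stateSum_eq_of_totalSign hw (fun σ hσ => totalSign_eq hw hP (hk false) hσ)
    (nonempty_states_of_stateSum_eq hw hP (hk false) (nonempty_states_of_planar hP))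
  rw [← graphAdj_eq] at h1
  apply mul_left_cancel₀ two_ne_zero_laurent
  rw [two_mul_halfStateSum false hw hne, h1, ht, ← mul_assoc, ← pow_succ',
    Nat.sub_add_cancel (numComponents_pos hw hne)]
  rfl

end RigidVertex

theorem corollary5 {R : Type*} [CommRing R] (A : Rˣ)
    (hA : IsUnit ((A : R) - ((A⁻¹ : Rˣ) : R)))
    (G : RigidVertex.Word) (hG : RigidVertex.IsDiagram G) (hne : G ≠ [])
    (hplanar : ∃ P : RigidVertex.Word,
      RigidVertex.IsPlanarDiagram P ∧ RigidVertex.AmbientIsotopic G P)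
    (m : RigidVertex.Vertices G → RigidVertex.Marker) :
    RigidVertex.kauffmanVogel (A : R) ((A⁻¹ : Rˣ) : R) A G m =
      2 ^ (RigidVertex.numComponents G - 1) *
        (-(A : R) - ((A⁻¹ : Rˣ) : R)) ^ RigidVertex.numVertices G *
        ((A ^ RigidVertex.twistingNumber G : Rˣ) : R) := by
  obtain ⟨P, hP, h⟩ := hplanar
  rw [RigidVertex.kauffmanVogel_eq A hA hG hne m, RigidVertex.halfStateSum_eq hG hne hP h]
  simp only [map_mul, map_pow, map_sub, map_neg, map_ofNat, RigidVertex.evalAt_T, zpow_one,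
    zpow_neg_one]
  ring
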